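/- **Setting.** Let $d\ge 1$, $m\ge 1$, $k_R\ge 1$ be integers, $\ell=d\lceil\log_2 d\rceil+2d$, and assume $\ell<k:=3m$. Put $q=2^m$, $n_R=k_R+2d+2\le q$, $\ell_p=k+\ell$ and $n=\ell_p+mn_R+(2d+2)d$. Let $\phi:\mathbb F_q\to\mathbb F_2^m$ be any bijection, $X=\{a\in\mathbb F_q: w_H(\phi(a))\ge d\}$, $r=|X|=\sum_{i=d}^m\binom mi$, and $M=r^{k_R}$. Let $\sigma_0,\dots,\sigma_{M-1}$ be a Gray code over $X$: a list of all vectors of $X^{k_R}$, each once, in which consecutive vectors differ in exactly one position. Fix distinct $x_0,\dots,x_{n_R-1}\in\mathbb F_q$, and let $c_i=(f_i(x_0),\dots,f_i(x_{n_R-1}))$, where $f_i$ is the polynomial of degree less than $k_R$ with $(f_i(x_0),\dots,f_i(x_{k_R-1}))=\sigma_i$ (a systematic Reed–Solomon code). Let $$s_i=\phi(c_i[0])\cdots\phi(c_i[k_R-1])\,1^d\phi(c_i[k_R])\,1^d\phi(c_i[k_R+1])\cdots 1^d\phi(c_i[n_R-1]),$$ let $u=1^du_0u_1\cdots u_{\lceil\log_2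 d\rceil}$, where $u_i$ consists of the first $d$ letters of $(1^{2^i}0^{2^i})^d$, let $p=0^ku$ (the marker), and let $S=p\,s_0\,p\,s_1\cdots p\,s_{M-1}$. **Algorithm.** Given a binary word $w$ of length $n$: 1. Find $\hat i\in[0,n-1]$ such that the length-$\ell_p$ subword of $w$ that starts at $\hat i$, read cyclically, is at Hamming distance at most $(d-1)/2$ from $p$. Let $\bar i\in[0,n-1]$ be such that $\bar i+\hat i\equiv0\pmod n$. 2. Rotate $w$ cyclically leftwards by $\hat i$ positions. In the result delete the first $\ell_p$ letters and the $2d+2$ blocks of length $d$ at the places where $p\,s_i$ has the inserted blocks $1^d$. Apply $\phi^{-1}$ to the $n_R$ remaining blocks of length $m$. This gives $\bar c\in\mathbb F_q^{n_R}$. 3. Restrict $\bar c$ to the coordinate set - $[0,n_R-1]$ if $\bar i<\ell_p+mk_R$; - $[0,k_R-1]\cup[k_R+d+1,n_R-1]$ if $\ell_p+mk_R\le\bar i<\ell_p+mk_R+(d+1)(m+d)$; - $[0,k_R+d]$ otherwise. With $N$ the size of this set, apply bounded-distance decoding (up to $(N-k_R)/2$ errors) for the Reed–Solomon code of dimension $k_R$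 with the evaluation points $x_j$ indexed by this set. Keep the first $k_R$ symbols of the decoded word. 4. Let $b$ be the index of these $k_R$ symbols in the Gray code. Put $a=b$ in the first two cases and $a=b-1$ in the last one. Return $an+\bar i$. **Theorem.** Let $0\le i\le|S|-n$, and let $w$ be a binary word of length $n$ that differs from the subword $S[i,i+n-1]$ in exactly $e$ positions, where $2e<d$. (a) For every Gray code over $X$, the index $\hat i$ of step 1 exists and is unique, and the algorithm returns exactly $i$. (b) Let the Gray code be the reflected $r$-ary Gray code, transported to $X$ by any numbering of the letters of $X$. Then the algorithm runs in time $O(n^3)$, where the implied constant is absolute; in particular it does not depend on $d$. Precisely: there are a constant $C$ and four programs, independent of all parameters, for a random access machine, which, run one after the other, compute the results of steps 1, 2, 3 and 4 in at most $Cn^3$ machine steps in total on every such $w$. The machine has registers and two-index arrays of natural numbers. Tests, loop rounds, array accesses, assignments of constants, additions, truncated subtractions and halvings take one step each. Elements of $\mathbb F_q$ are held as the $m$-bit numbers given by $\phi$, and each field instruction ($0$, $1$, $+$, $-$, $\times$, $/$) takes $m^2=(\log_2 q)^2$ steps. The input consists of $n,d,m,k_R,\ell_p,r$, the word $w$, the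 evaluation points, the marker $p$, and the table of the numbering of the letters of $X$. -/

import Mathlib

namespace RPS

/-! ### The marker -/

/-- `ℓ = d ⌈log₂ d⌉ + 2 d`, the length of the auto-cyclic vector `u`. -/
def ell (d : ℕ) : ℕ := d * Nat.clog 2 d + 2 * d

/-- `u_i = ((1^{2^i} 0^{2^i})^d)[0, d-1]`. -/
def uBlock (d i : ℕ) : List (ZMod 2) :=
  ((List.replicate d (List.replicate (2 ^ i) 1 ++ List.replicate (2 ^ i) 0)).flatten).take d

/-- `u = 1^d u_0 u_1 ⋯ u_{⌈log₂ d⌉}`. -/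
def u (d : ℕ) : List (ZMod 2) :=
  List.replicate d 1 ++ ((List.range (Nat.clog 2 d + 1)).map (uBlock d)).flatten

/-! ### Gray codes -/

/-- `G` lists all vectors of `A^k`, each once, and consecutive vectors differ in exactly one
position. -/
def IsGrayCode {A : Type*} [DecidableEq A] {M k : ℕ} (G : Fin M → Fin k → A) : Prop :=
  Function.Bijective G ∧
    ∀ (i : ℕ) (h : i + 1 < M), hammingDist (G ⟨i, Nat.lt_of_succ_lt h⟩) (G ⟨i + 1, h⟩) = 1

/-- The digit of weight `r^t` of the `i`-th word of the reflected `r`-ary Gray code: the digit of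
`i` of weight `r^t`, reflected when the number formed by the higher digits of `i` is odd. -/
def grayDigit (r t i : ℕ) : ℕ :=
  if i / r ^ t / r % 2 = 0 then i / r ^ t % r else r - 1 - i / r ^ t % r

theorem grayDigit_lt {r : ℕ} (hr : 0 < r) (t i : ℕ) : grayDigit r t i < r := by
  unfold grayDigit
  have := Nat.mod_lt (i / r ^ t) hr
  split <;> omega

theorem pos_of_fin_pow {r k : ℕ} (i : Fin (r ^ k)) (j : Fin k) : 0 < r := by
  have hk : k ≠ 0 := by have := j.isLt; omega
  have hi : 0 < r ^ k := by have := i.isLt; omega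
  by_contra h
  have h0 : r = 0 := by omega
  simp [h0, hk] at hi

/-- The reflected Gray code of length `k` over an alphabet `A` whose `r` letters are numbered by
`ρ`, most significant position first. -/
def reflectedGray {A : Type*} {r : ℕ} (k : ℕ) (ρ : Fin r ≃ A) : Fin (r ^ k) → Fin k → A :=
  fun i j => ρ ⟨grayDigit r (k - 1 - j) i, grayDigit_lt (pos_of_fin_pow i j) _ _⟩

/-! ### Reed-Solomon codes -/

/-- The Reed-Solomon code of dimension `k` with evaluation points `x`: all evaluation vectors of
polynomials of degree less than `k`. -/
def rsCode {F : Type*} [Field F] {N : ℕ} (x : Fin N → F) (k : ℕ) : Set (Fin N → F) :=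
  {c | ∃ f : Polynomial F, f.degree < (k : WithBot ℕ) ∧ ∀ j, c j = f.eval (x j)}

open Classical in
/-- Bounded-distance decoding for `rsCode x k`, whose minimum distance is `d_R = N - k + 1`: return
a codeword at distance at most `(d_R - 1) / 2` from `y`, if there is one. -/
noncomputable def decRS {F : Type*} [Field F] {N : ℕ} (x : Fin N → F) (k : ℕ)
    (y : Fin N → F) : Fin N → F :=
  if h : ∃ c ∈ rsCode x k, 2 * hammingDist y c ≤ N - k then h.choose else 0

/-! ### The positioning sequence -/

/-- The parameters of the construction: the distance `d`, the symbol length `m` (so that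
`q = |F| = 2^m`), the dimension `k_R`, the bijection `φ` and the evaluation points of the
Reed-Solomon code. The strength `n` is computed from them below. -/
structure Construction (F : Type*) where
  d : ℕ
  m : ℕ
  kR : ℕ
  φ : F ≃ (Fin m → ZMod 2)
  x : Fin (kR + (2 * d + 2)) → F
  x_injective : Function.Injective x
  one_le_kR : 1 ≤ kR
  ell_lt : ell d < 3 * m

namespace Construction

variable {F : Type*}

/-- The length `n_R = k_R + 2 d + 2` of the Reed-Solomon code. -/
abbrev nR (D : Construction F) : ℕ := D.kR + (2 * D.d + 2)

/-- The length `ℓ_p = k + ℓ` of the marker, where `k = 3 m`. -/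
def lp (D : Construction F) : ℕ := 3 * D.m + ell D.d

/-- The strength `n = ℓ_p + n'`, where `n' = m n_R + (2 d + 2) d`. -/
def n (D : Construction F) : ℕ := D.lp + (D.m * D.nR + (2 * D.d + 2) * D.d)

/-- The marker `p = 0^k u`. -/
def p (D : Construction F) : List (ZMod 2) := List.replicate (3 * D.m) 0 ++ u D.d

/-- The set `X` of field elements `a` with `w_H(φ(a)) ≥ d`. -/
abbrev X (D : Construction F) : Type _ := {a : F // D.d ≤ hammingNorm (D.φ a)}

/-- `r = ∑_{i=d}^m C(m,i)`, the number of elements of `X`. -/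
def r (D : Construction F) : ℕ := ∑ i ∈ Finset.Icc D.d D.m, D.m.choose i

/-- The systematic encoder: the evaluation vector of the polynomial of degree less than `k_R` that
takes the value `σ j` at the point `x j` for `j < k_R`. -/
noncomputable def enc [Field F] (D : Construction F) (σ : Fin D.kR → F) : Fin D.nR → F :=
  fun j => (Lagrange.interpolate Finset.univ
    (fun i : Fin D.kR => D.x (Fin.castAdd (2 * D.d + 2) i)) σ).eval (D.x j)

/-- The binary image
`φ(c[0]) ⋯ φ(c[k_R-1]) 1^d φ(c[k_R]) 1^d φ(c[k_R+1]) ⋯ 1^d φ(c[n_R-1])`. -/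
def embed (D : Construction F) (c : Fin D.nR → F) : List (ZMod 2) :=
  (List.ofFn fun j : Fin D.kR =>
      List.ofFn (D.φ (c (Fin.castAdd (2 * D.d + 2) j)))).flatten ++
    (List.ofFn fun j : Fin (2 * D.d + 2) =>
      List.replicate D.d 1 ++ List.ofFn (D.φ (c (Fin.natAdd D.kR j)))).flatten

/-- The sequence `S = p s_0 p s_1 ⋯ p s_{M-1}`, where `M = r^{k_R}` and `s_i` is the binary image
of the encoding of the `i`-th word of the Gray code `G`. -/
noncomputable def S [Field F] (D : Construction F)
    (G : Fin (D.r ^ D.kR) → Fin D.kR → D.X) : List (ZMod 2) :=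
  (List.ofFn fun i => D.p ++ D.embed (D.enc fun j => (G i j : F))).flatten

/-- The subword `S[i, i+n-1]` (used for `i + n ≤ |S|` only). -/
noncomputable def window [Field F] (D : Construction F)
    (G : Fin (D.r ^ D.kR) → Fin D.kR → D.X) (i : ℕ) : Fin D.n → ZMod 2 :=
  fun t => (D.S G).getD (i + t) 0

/-! ### The locating algorithm, step by step -/

/-- The letter of `w` at position `t`, read cyclically. -/
def cyc {N : ℕ} (w : Fin N → ZMod 2) (t : ℕ) : ZMod 2 :=
  if h : 0 < N then w ⟨t % N, Nat.mod_lt t h⟩ else 0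

/-- `d_H(w[i, i+ℓ_p-1], p)`, with `w` read cyclically. -/
def markerDist (D : Construction F) (w : Fin D.n → ZMod 2) (i : ℕ) : ℕ :=
  hammingDist (fun t : Fin D.lp => cyc w (i + t)) (fun t : Fin D.lp => D.p.getD t 0)

/-- `i` is an index with `d_H(w[i, i+ℓ_p-1], p) ≤ (d-1)/2`. -/
def IsOffset (D : Construction F) (w : Fin D.n → ZMod 2) (i : ℕ) : Prop :=
  i < D.n ∧ 2 * D.markerDist w i < D.d

/-- Step 1: the index `î` at which `w` agrees with the marker up to `(d-1)/2` errors. -/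
noncomputable def offset (D : Construction F) (w : Fin D.n → ZMod 2) : ℕ :=
  sInf {i | D.IsOffset w i}

/-- The number `ī` in `[0, n-1]` with `ī + î ≡ 0 (mod n)`. -/
noncomputable def modPos (D : Construction F) (w : Fin D.n → ZMod 2) : ℕ :=
  (D.n - D.offset w) % D.n

/-- The vector `v`: `w` rotated cyclically leftwards by `î` positions. -/
noncomputable def rotated (D : Construction F) (w : Fin D.n → ZMod 2) (t : ℕ) : ZMod 2 :=
  cyc w (D.offset w + t)

/-- Step 2: the `q`-ary estimate `c̄`, obtained from `v` by deleting the marker and the `2 d + 2`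
inserted blocks of length `d`, and applying `φ⁻¹` to each of the remaining blocks of length `m`. -/
noncomputable def cbar (D : Construction F) (w : Fin D.n → ZMod 2) : Fin D.nR → F :=
  Fin.addCases
    (fun j => D.φ.symm fun b => D.rotated w (D.lp + D.m * j + b))
    (fun j => D.φ.symm fun b =>
      D.rotated w (D.lp + D.m * D.kR + (D.m + D.d) * j + D.d + b))

/-- The positions `[0, k_R-1] ∪ [k_R+(d+1), n_R-1]`. -/
def keepLast (D : Construction F) : Fin (D.kR + (D.d + 1)) → Fin D.nR :=
  Fin.addCases (fun j => Fin.castAdd (2 * D.d + 2) j)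
    (fun j => Fin.natAdd D.kR ⟨D.d + 1 + j, by have := j.isLt; omega⟩)

/-- The positions `[0, k_R+(d+1)-1]`. -/
def keepFirst (D : Construction F) : Fin (D.kR + (D.d + 1)) → Fin D.nR :=
  Fin.castLE (by unfold nR; omega)

/-- Step 3: the length-`k_R` prefix of the decoded (possibly shortened) codeword. -/
noncomputable def decoded [Field F] (D : Construction F) (w : Fin D.n → ZMod 2) :
    Fin D.kR → F :=
  if D.modPos w < D.lp + D.m * D.kR then
    fun j => decRS D.x D.kR (D.cbar w) (Fin.castAdd (2 * D.d + 2) j)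
  else if D.modPos w < D.lp + D.m * D.kR + (D.d + 1) * (D.m + D.d) then
    fun j => decRS (D.x ∘ D.keepLast) D.kR (D.cbar w ∘ D.keepLast) (Fin.castAdd (D.d + 1) j)
  else
    fun j => decRS (D.x ∘ D.keepFirst) D.kR (D.cbar w ∘ D.keepFirst) (Fin.castAdd (D.d + 1) j)

/-- The index of `σ` in the Gray code. -/
noncomputable def decGray (D : Construction F) (G : Fin (D.r ^ D.kR) → Fin D.kR → D.X)
    (σ : Fin D.kR → F) : ℕ :=
  sInf {i | ∃ h : i < D.r ^ D.kR, ∀ j, (G ⟨i, h⟩ j : F) = σ j}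

/-- Step 4, the output `a n + ī`: Gray decoding gives `a` in the first two cases, and `a + 1` in the
last one. -/
noncomputable def locate [Field F] (D : Construction F)
    (G : Fin (D.r ^ D.kR) → Fin D.kR → D.X) (w : Fin D.n → ZMod 2) : ℕ :=
  if D.modPos w < D.lp + D.m * D.kR + (D.d + 1) * (D.m + D.d) then
    D.decGray G (D.decoded w) * D.n + D.modPos w
  else
    (D.decGray G (D.decoded w) - 1) * D.n + D.modPos w

/-! ### Machine representation of field elements -/

/-- The machine word that represents the field element `a`: the number with binary digits
`φ(a)`. -/
def code (D : Construction F) (a : F) : ℕ := ∑ b : Fin D.m, (D.φ a b).val * 2 ^ (b : ℕ)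

/-- The field element represented by the low `m` bits of the machine word `v`. -/
def elt (D : Construction F) (v : ℕ) : F :=
  D.φ.symm fun b => ((v / 2 ^ (b : ℕ) : ℕ) : ZMod 2)

end Construction

/-! ### Machine model

A random access machine with registers and two-index arrays holding natural numbers. The integer
instructions are addition, truncated subtraction and halving (no multiplication); field elements are
held as machine words, and arithmetic in the field is done by separate instructions. A program is
a fixed piece of text: it contains register numbers, array numbers and numerical constants only. -/

inductive Instr where
  /-- `x := c` -/
  | const (x c : ℕ)
  /-- `x := y + z` -/
  | add (x y z : ℕ)
  /-- `x := y - z`, and `0` if `y < z` -/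
  | sub (x y z : ℕ)
  /-- `x := ⌊y / 2⌋` -/
  | half (x y : ℕ)
  /-- `x := A[y, z]` for the array number `A` -/
  | load (x A y z : ℕ)
  /-- `A[y, z] := x` for the array number `A` -/
  | store (A y z x : ℕ)
  /-- `x := 0` in the field -/
  | fzero (x : ℕ)
  /-- `x := 1` in the field -/
  | fone (x : ℕ)
  /-- `x := y + z` in the field -/
  | fadd (x y z : ℕ)
  /-- `x := y - z` in the field -/
  | fsub (x y z : ℕ)
  /-- `x := y z` in the field -/
  | fmul (x y z : ℕ)
  /-- `x := y / z` in the field, and `0` if `z = 0` -/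
  | fdiv (x y z : ℕ)

inductive Prog where
  | skip
  | instr (I : Instr)
  /-- first `P`, then `Q` -/
  | seq (P Q : Prog)
  /-- `P` if register `x` is at most register `y`, otherwise `Q` -/
  | ifLe (x y : ℕ) (P Q : Prog)
  /-- `for i = 0, …, N - 1 do P`, where `N` is the content of register `x` on entry -/
  | loop (i x : ℕ) (P : Prog)

structure State where
  reg : ℕ → ℕ
  arr : ℕ → ℕ → ℕ → ℕ

/-- Assignment to a register. -/
def State.set (s : State) (x v : ℕ) : State := { s with reg := Function.update s.reg x v }

/-- Assignment to the array entry `A[y, z]`. -/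
def State.setArr (s : State) (A y z v : ℕ) : State :=
  let row := Function.update (s.arr A y) z v
  { s with arr := Function.update s.arr A (Function.update (s.arr A) y row) }

variable {F : Type*} [Field F]

/-- The effect of an instruction. -/
def Instr.exec (D : Construction F) (s : State) : Instr → State
  | .const x c => s.set x c
  | .add x y z => s.set x (s.reg y + s.reg z)
  | .sub x y z => s.set x (s.reg y - s.reg z)
  | .half x y => s.set x (s.reg y / 2)
  | .load x A y z => s.set x (s.arr A (s.reg y) (s.reg z))
  | .store A y z x => s.setArr A (s.reg y) (s.reg z) (s.reg x)
  | .fzero x => s.set x (D.code 0)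
  | .fone x => s.set x (D.code 1)
  | .fadd x y z => s.set x (D.code (D.elt (s.reg y) + D.elt (s.reg z)))
  | .fsub x y z => s.set x (D.code (D.elt (s.reg y) - D.elt (s.reg z)))
  | .fmul x y z => s.set x (D.code (D.elt (s.reg y) * D.elt (s.reg z)))
  | .fdiv x y z => s.set x (D.code (D.elt (s.reg y) / D.elt (s.reg z)))

/-- The number of steps of an instruction: one step each, except that an instruction on elements
of the field with `2^m` elements takes `m^2` steps. -/
def Instr.cost (m : ℕ) : Instr → ℕ
  | .const _ _ | .add _ _ _ | .sub _ _ _ | .half _ _ | .load _ _ _ _ | .store _ _ _ _ => 1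
  | .fzero _ | .fone _ | .fadd _ _ _ | .fsub _ _ _ | .fmul _ _ _ | .fdiv _ _ _ => m ^ 2

/-- The final state and the number of steps of a run of a program. A test takes one step, and a
loop takes one step plus one for each of its rounds, besides the steps of its body. -/
def Prog.run (D : Construction F) : Prog → State → State × ℕ
  | .skip, s => (s, 0)
  | .instr I, s => (I.exec D s, I.cost D.m)
  | .seq P Q, s =>
      ((Q.run D (P.run D s).1).1, (P.run D s).2 + (Q.run D (P.run D s).1).2)
  | .ifLe x y P Q, s =>
      if s.reg x ≤ s.reg y then ((P.run D s).1, (P.run D s).2 + 1)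
      else ((Q.run D s).1, (Q.run D s).2 + 1)
  | .loop i x P, s =>
      (List.range (s.reg x)).foldl
        (fun t j => ((P.run D (t.1.set i j)).1, t.2 + (P.run D (t.1.set i j)).2 + 1)) (s, 1)

/-- The initial state for the received word `w`. Registers `0, …, 5` hold `n, d, m, k_R, ℓ_p, r`.
Array `0` holds `w`, array `1` the evaluation points, array `2` the marker `p`, and array `3` the
table that gives the number of each letter of `X` in the numbering `ρ`. Everything else is `0`. -/
noncomputable def initState (D : Construction F) (ρ : Fin D.r ≃ D.X)
    (w : Fin D.n → ZMod 2) : State where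
  reg := fun x => [D.n, D.d, D.m, D.kR, D.lp, D.r].getD x 0
  arr := fun A t z =>
    if z ≠ 0 then 0 else
    match A with
    | 0 => if h : t < D.n then (w ⟨t, h⟩).val else 0
    | 1 => if h : t < D.nR then D.code (D.x ⟨t, h⟩) else 0
    | 2 => (D.p.getD t 0).val
    | 3 => if h : t < 2 ^ D.m ∧ D.d ≤ hammingNorm (D.φ (D.elt t)) then
             (ρ.symm ⟨D.elt t, h.2⟩ : ℕ) else 0
    | _ => 0

end RPS

/-! ### Letters of concatenated lists, of the marker and of the sequence -/

namespace RPS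

/-! Write `i = a n + t` with `0 ≤ t < n`. The window at `i` is the end of block `a`, from its letter
`t` on, followed by the first `t` letters of block `a + 1`. Rotated by `(n - t) mod n` it is aligned
with the blocks: it agrees with block `a + 1` before position `t` and with block `a` from `t` on
(`cyc_window`, `splice`). So the place of the marker gives `t`, and decoding has to give `a`.

Place of the marker. In the aligned word the marker stands at `0`, and at every other cyclic
position the distance to `p` is at least `d` (`le_hammingDist_marker`). A shift by `δ < d`, in
either direction, compares the marker with itself: the border between `0^{3m}` and `1^d` gives `δ`
disagreements, and the block `u_j` for which `2^j` is the exact power of two in `δ` gives `d - δ`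
more. For other shifts, either the run `1^d` of the marker meets zeros of its next copy, or the
zeros `0^{3m}` are compared with a stretch that contains a subword of weight at least `d`: a run
`1^d`, or a symbol from `X` that the cut at `t` does not pass through. Fewer than `d/2` errors
cannot bridge the gap between `0` and `d` (`isOffset_iff`).

Decoding. Neighbouring Gray vectors differ in one symbol, so wherever the cut falls, the information
part is within one symbol of that of block `a`. The parity symbols kept in step 3 come from one
codeword, and `e` wrong letters spoil at most `e` symbols. This makes at most `e + 1` symbol errors
against a redundancy of at least `d + 1`, and `2 (e + 1) ≤ d + 1` (`close_of_splice`). If the cut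
lies late, the kept symbols belong to block `a + 1`, which explains the correction by one.

Running time. Decoding solves the key equation `A(x_h) + y_h B(x_h) = 0` by Newton-like elimination
on two independent pairs of polynomials with controlled weighted degrees (`KeyPairs.step`). The
lighter pair satisfies `A = -B f`, so the data are correct wherever `B` does not vanish, and `f` is
interpolated from there (`KeyPairs.eval_eq`). The machine holds only values at the evaluation
points. It performs `O(N^3)` field operations of cost `m^2`, and `N ≤ n_R` with `n_R m ≤ n` gives
`N^3 m^2 ≤ n^3`. The Gray index is computed by Horner's scheme (`div_pow_step`) with shift-and-add
multiplication. Programs are verified by loop invariants with automatic frame conditions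
(`exec_loop_induct`) and timed by a syntactic bound (`run_le_bound`). -/

theorem length_flatten_ofFn {α : Type*} {M L : ℕ} (f : Fin M → List α)
    (hf : ∀ i, (f i).length = L) : (List.ofFn f).flatten.length = L * M := by
  induction M with
  | zero => simp
  | succ M ih =>
    rw [List.ofFn_succ, List.flatten_cons, List.length_append, hf, ih _ fun i => hf i.succ]
    ring

theorem getD_flatten_ofFn {α : Type*} {M L : ℕ} (f : Fin M → List α)
    (hf : ∀ i, (f i).length = L) (z : α) {a t : ℕ} (ha : a < M) (ht : t < L) :
    (List.ofFn f).flatten.getD (L * a + t) z = (f ⟨a, ha⟩).getD t z := by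
  induction M generalizing a with
  | zero => omega
  | succ M ih =>
    rw [List.ofFn_succ, List.flatten_cons]
    cases a with
    | zero =>
      rw [List.getD_append _ _ _ _ (by simpa [hf] using ht)]
      simp
    | succ a =>
      rw [List.getD_append_right _ _ _ _ (by rw [hf]; nlinarith), hf,
        show L * (a + 1) + t - L = L * a + t by rw [mul_add]; omega,
        ih (fun i => f i.succ) (fun i => hf i.succ) (by omega)]
      rfl

theorem getD_ofFn {α : Type*} {m : ℕ} (f : Fin m → α) (z : α) {b : ℕ} (hb : b < m) :
    (List.ofFn f).getD b z = f ⟨b, hb⟩ := by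
  rw [List.getD_eq_getElem _ _ (by simpa using hb)]
  simp

theorem getD_replicate {α : Type*} (x z : α) {b m : ℕ} (hb : b < m) :
    (List.replicate m x).getD b z = x := by
  rw [List.getD_eq_getElem _ _ (by simpa using hb)]
  simp

/-! ### The marker -/

theorem length_uBlock (d i : ℕ) : (uBlock d i).length = d := by
  have h : 1 ≤ 2 ^ i := Nat.one_le_two_pow
  simp only [uBlock, List.length_take, List.length_flatten, List.map_replicate,
    List.length_append, List.length_replicate, List.sum_replicate, smul_eq_mul]
  exact min_eq_left (by nlinarith)

theorem getD_flatten_replicate {α : Type*} (l : List α) (z : α) {N t : ℕ}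
    (ht : t < l.length * N) :
    (List.replicate N l).flatten.getD t z = l.getD (t % l.length) z := by
  have hl : 0 < l.length := Nat.pos_of_ne_zero fun h => by simp [h] at ht
  have := getD_flatten_ofFn (fun _ : Fin N => l) (fun _ => rfl) z
    (Nat.div_lt_of_lt_mul ht) (Nat.mod_lt t hl)
  rwa [Nat.div_add_mod, List.ofFn_const] at this

/-- The block `u_i` spells out the complement of bit `i` of the position, so comparing it with its
shifts becomes a question on the parity of `b / 2 ^ i`. -/
theorem getD_uBlock {d i b : ℕ} (hb : b < d) :
    (uBlock d i).getD b 0 = if b / 2 ^ i % 2 = 0 then 1 else 0 := by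
  have h : 0 < 2 ^ i := Nat.two_pow_pos i
  have hlen : (List.replicate (2 ^ i) (1 : ZMod 2) ++ List.replicate (2 ^ i) 0).length
      = 2 ^ i * 2 := by simp; ring
  have hlt : b < (2 ^ i * 2) * d := by nlinarith
  have e : (uBlock d i).getD b 0 = ((List.replicate d
      (List.replicate (2 ^ i) (1 : ZMod 2) ++ List.replicate (2 ^ i) 0)).flatten).getD b 0 := by
    rw [uBlock, List.getD_eq_getElem?_getD, List.getD_eq_getElem?_getD, List.getElem?_take,
      if_pos hb]
  rw [e, getD_flatten_replicate _ _ (by rw [hlen]; exact hlt), hlen, Nat.mod_mul]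
  have h1 := Nat.mod_lt b h
  rcases Nat.mod_two_eq_zero_or_one (b / 2 ^ i) with h2 | h2
  · rw [h2, if_pos rfl, List.getD_append _ _ _ _ (by simpa using h1)]
    exact getD_replicate _ _ (by simpa using h1)
  · rw [h2, if_neg one_ne_zero, List.getD_append_right _ _ _ _ (by simp)]
    exact getD_replicate _ _ (by simpa using h1)

theorem u_eq (d : ℕ) : u d = List.replicate d 1 ++
    (List.ofFn fun i : Fin (Nat.clog 2 d + 1) => uBlock d i).flatten := by
  rw [u, List.ofFn_eq_map, ← List.map_coe_finRange_eq_range, List.map_map]; rfl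

theorem length_u (d : ℕ) : (u d).length = ell d := by
  rw [u_eq, List.length_append, length_flatten_ofFn _ fun _ => length_uBlock _ _, ell]
  simp; ring

namespace Construction

variable {F : Type*}

theorem length_p (D : Construction F) : D.p.length = D.lp := by
  simp [p, length_u, lp]

theorem p_zero (D : Construction F) {t : ℕ} (ht : t < 3 * D.m) : D.p.getD t 0 = 0 := by
  rw [p, List.getD_append _ _ _ _ (by simpa using ht), getD_replicate _ _ ht]

theorem p_one (D : Construction F) {t : ℕ} (ht : t < D.d) : D.p.getD (3 * D.m + t) 0 = 1 := by
  rw [p, List.getD_append_right _ _ _ _ (by simp), List.length_replicate, Nat.add_sub_cancel_left,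
    u_eq, List.getD_append _ _ _ _ (by simpa using ht), getD_replicate _ _ ht]

theorem p_block (D : Construction F) {i b : ℕ} (hi : i ≤ Nat.clog 2 D.d) (hb : b < D.d) :
    D.p.getD (3 * D.m + D.d + D.d * i + b) 0 = if b / 2 ^ i % 2 = 0 then 1 else 0 := by
  rw [p, List.getD_append_right _ _ _ _ (by simp; omega), List.length_replicate,
    show 3 * D.m + D.d + D.d * i + b - 3 * D.m = D.d + (D.d * i + b) by omega,
    u_eq, List.getD_append_right _ _ _ _ (by simp), List.length_replicate,
    Nat.add_sub_cancel_left,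
    getD_flatten_ofFn _ (fun _ => length_uBlock _ _) _ (by omega) hb, getD_uBlock hb]

/-! ### The letters of the sequence -/

/-- The letters of the marker followed by the binary image of `c`. -/
def word (D : Construction F) (c : Fin D.nR → F) (t : ℕ) : ZMod 2 := (D.p ++ D.embed c).getD t 0

theorem length_info (D : Construction F) (c : Fin D.nR → F) :
    (List.ofFn fun j : Fin D.kR =>
      List.ofFn (D.φ (c (Fin.castAdd (2 * D.d + 2) j)))).flatten.length = D.m * D.kR :=
  length_flatten_ofFn _ fun _ => by simp

theorem length_embed (D : Construction F) (c : Fin D.nR → F) :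
    (D.embed c).length = D.m * D.nR + (2 * D.d + 2) * D.d := by
  rw [embed, List.length_append, length_info,
    length_flatten_ofFn (L := D.d + D.m) _ fun _ => by simp, nR]
  ring

theorem length_word (D : Construction F) (c : Fin D.nR → F) :
    (D.p ++ D.embed c).length = D.n := by
  rw [List.length_append, length_p, length_embed, n]

theorem word_p (D : Construction F) (c : Fin D.nR → F) {t : ℕ} (ht : t < D.lp) :
    D.word c t = D.p.getD t 0 := by
  rw [word, List.getD_append _ _ _ _ (by rwa [length_p])]

theorem word_info (D : Construction F) (c : Fin D.nR → F) {j b : ℕ} (hj : j < D.kR)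
    (hb : b < D.m) :
    D.word c (D.lp + D.m * j + b) = D.φ (c (Fin.castAdd _ ⟨j, hj⟩)) ⟨b, hb⟩ := by
  have h : D.m * j + b < D.m * D.kR := by nlinarith
  rw [word, List.getD_append_right _ _ _ _ (by rw [length_p]; omega), length_p,
    show D.lp + D.m * j + b - D.lp = D.m * j + b by omega, embed,
    List.getD_append _ _ _ _ (by rwa [length_info]),
    getD_flatten_ofFn _ (fun _ => List.length_ofFn) _ hj hb, getD_ofFn _ _ hb]

theorem word_parity (D : Construction F) (c : Fin D.nR → F) {j b : ℕ} (hj : j < 2 * D.d + 2)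
    (hb : b < D.d + D.m) :
    D.word c (D.lp + D.m * D.kR + (D.m + D.d) * j + b) =
      (List.replicate D.d 1 ++ List.ofFn (D.φ (c (Fin.natAdd D.kR ⟨j, hj⟩)))).getD b 0 := by
  rw [word, List.getD_append_right _ _ _ _ (by rw [length_p]; omega), length_p,
    show D.lp + D.m * D.kR + (D.m + D.d) * j + b - D.lp = D.m * D.kR + ((D.d + D.m) * j + b) by
      rw [add_comm D.d]; omega, embed,
    List.getD_append_right _ _ _ _ (by rw [length_info]; omega), length_info,
    Nat.add_sub_cancel_left, getD_flatten_ofFn _ (fun _ => by simp) _ hj hb]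

theorem word_ones (D : Construction F) (c : Fin D.nR → F) {j b : ℕ} (hj : j < 2 * D.d + 2)
    (hb : b < D.d) : D.word c (D.lp + D.m * D.kR + (D.m + D.d) * j + b) = 1 := by
  rw [word_parity D c hj (by omega), List.getD_append _ _ _ _ (by simpa using hb),
    getD_replicate _ _ hb]

theorem word_symbol (D : Construction F) (c : Fin D.nR → F) {j b : ℕ} (hj : j < 2 * D.d + 2)
    (hb : b < D.m) : D.word c (D.lp + D.m * D.kR + (D.m + D.d) * j + D.d + b) =
      D.φ (c (Fin.natAdd D.kR ⟨j, hj⟩)) ⟨b, hb⟩ := by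
  rw [add_assoc _ D.d b, word_parity D c hj (by omega),
    List.getD_append_right _ _ _ _ (by simp), List.length_replicate, Nat.add_sub_cancel_left,
    getD_ofFn _ _ hb]

theorem lp_lt_n (D : Construction F) : D.lp < D.n := by
  have := D.one_le_kR
  unfold n
  rcases Nat.eq_zero_or_pos D.m with h | h
  · have := D.ell_lt; omega
  · have : 0 < D.m * D.nR := Nat.mul_pos h (by unfold nR; omega)
    omega

/-- For `d ≥ 2` the logarithm is at least `1`, hence `3 d ≤ ℓ < 3 m`; the cases `d ≤ 1` are checked
by hand. All later estimates of room inside a stretch of length `3 m` rest on this. -/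
theorem d_le_m (D : Construction F) : D.d ≤ D.m := by
  have h := D.ell_lt
  unfold ell at h
  by_contra! hlt
  rcases Nat.lt_or_ge D.d 2 with h2 | h2
  · interval_cases D.d <;> simp_all
  · have : 1 ≤ Nat.clog 2 D.d := Nat.clog_pos one_lt_two h2
    nlinarith

variable [Field F]

theorem length_S (D : Construction F) (G : Fin (D.r ^ D.kR) → Fin D.kR → D.X) :
    (D.S G).length = D.n * D.r ^ D.kR :=
  length_flatten_ofFn _ fun _ => D.length_word _

theorem S_getD (D : Construction F) (G : Fin (D.r ^ D.kR) → Fin D.kR → D.X) {a t : ℕ}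
    (ha : a < D.r ^ D.kR) (ht : t < D.n) :
    (D.S G).getD (D.n * a + t) 0 = D.word (D.enc fun j => (G ⟨a, ha⟩ j : F)) t :=
  getD_flatten_ofFn _ (fun _ => D.length_word _) _ ha ht

/-! ### Cyclic reading -/

theorem cyc_lt {N : ℕ} (w : Fin N → ZMod 2) {t : ℕ} (ht : t < N) : cyc w t = w ⟨t, ht⟩ := by
  unfold cyc
  rw [dif_pos (by omega)]
  simp [Nat.mod_eq_of_lt ht]

theorem cyc_congr {N : ℕ} (w : Fin N → ZMod 2) {s t : ℕ} (h : s % N = t % N) :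
    cyc w s = cyc w t := by
  simp [cyc, h]

/-- The rotation that moves the beginning of a window of residue `t` to a multiple of `n`. -/
def shift (D : Construction F) (t : ℕ) : ℕ := (D.n - t) % D.n

/-- A word that is `c₁` before position `t` and `c₀` from there on. -/
def splice (D : Construction F) (t : ℕ) (c₀ c₁ : Fin D.nR → F) (s : ℕ) : ZMod 2 :=
  if s < t then D.word c₁ s else D.word c₀ s

/-- The rotation puts the two parts of the window back to their places within a block. For residue
`0` only one block is met and the next one need not exist; then `b₁ = b₀` is taken, so the value of
`b₁` is asserted for positive residues only. -/
theorem cyc_window [DecidableEq F] (D : Construction F)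
    (G : Fin (D.r ^ D.kR) → Fin D.kR → D.X) (hG : IsGrayCode G) {i : ℕ}
    (hi : i + D.n ≤ (D.S G).length) :
    ∃ b₀ b₁ : Fin (D.r ^ D.kR), (b₀ : ℕ) = i / D.n ∧ (0 < i % D.n → (b₁ : ℕ) = i / D.n + 1) ∧
      hammingDist (G b₁) (G b₀) ≤ 1 ∧
      ∀ s < D.n, cyc (D.window G i) (D.shift (i % D.n) + s) =
        D.splice (i % D.n) (D.enc fun j => (G b₀ j : F)) (D.enc fun j => (G b₁ j : F)) s := by
  have hn : 0 < D.n := by have := D.lp_lt_n; omega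
  rw [length_S] at hi
  have hdm := Nat.div_add_mod i D.n
  have hlt := Nat.mod_lt i hn
  set a := i / D.n with ha
  set t := i % D.n with ht
  have h0 : a < D.r ^ D.kR := by
    by_contra! h
    nlinarith
  have h1 : 0 < t → a + 1 < D.r ^ D.kR := by
    intro h
    by_contra! h'
    nlinarith
  rcases Nat.eq_zero_or_pos t with h | h
  · refine ⟨⟨a, h0⟩, ⟨a, h0⟩, rfl, by omega, by simp, fun s hs => ?_⟩
    rw [h, splice, if_neg (by omega), shift, Nat.sub_zero, Nat.mod_self, zero_add, cyc_lt _ hs,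
      window, show i + s = D.n * a + s by omega, S_getD D G h0 hs]
  · refine ⟨⟨a, h0⟩, ⟨a + 1, h1 h⟩, rfl, fun _ => rfl, ?_, fun s hs => ?_⟩
    · rw [hammingDist_comm]
      exact (hG.2 a (h1 h)).le
    · rw [shift, Nat.mod_eq_of_lt (by omega), splice]
      split_ifs with hst
      · rw [cyc_lt _ (show D.n - t + s < D.n by omega), window,
          show i + (D.n - t + s) = D.n * (a + 1) + s by rw [mul_add]; omega, S_getD D G (h1 h) hs]
      · rw [cyc_congr _ (show (D.n - t + s) % D.n = (s - t) % D.n by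
          rw [show D.n - t + s = s - t + D.n by omega, Nat.add_mod_right]),
          cyc_lt _ (show s - t < D.n by omega), window,
          show i + (s - t) = D.n * a + s by omega, S_getD D G h0 hs]

end Construction
end RPS

/-! ### The marker occurs at one cyclic position only -/

namespace RPS

/-- A hamming distance on `Fin L` is bounded below by a set of places of disagreement. -/
theorem card_le_hammingDist_fin {α : Type*} [DecidableEq α] {L : ℕ} {f g : ℕ → α}
    (s : Finset ℕ) (hs : ∀ x ∈ s, x < L ∧ f x ≠ g x) :
    s.card ≤ hammingDist (fun x : Fin L => f x) (fun x : Fin L => g x) := by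
  rw [hammingDist]
  refine Finset.card_le_card_of_surjOn (fun x : Fin L => (x : ℕ)) fun x hx => ?_
  exact ⟨⟨x, (hs x hx).1⟩, by simpa using (hs x hx).2, rfl⟩

/-- Shifting by `2 ^ i` times an odd number changes the parity of `b / 2 ^ i`. -/
theorem exists_shift_parity {δ : ℕ} (hδ : 0 < δ) :
    ∃ i, 2 ^ i ≤ δ ∧ ∀ b, (b + δ) / 2 ^ i % 2 ≠ b / 2 ^ i % 2 := by
  obtain ⟨i, c, hc, rfl⟩ := Nat.exists_eq_two_pow_mul_odd hδ.ne'
  refine ⟨i, Nat.le_mul_of_pos_right _ hc.pos, fun b => ?_⟩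
  rw [Nat.add_mul_div_left _ _ (Nat.two_pow_pos i)]
  have := Nat.odd_iff.1 hc
  omega

namespace Construction

variable {F : Type*} (D : Construction F)

theorem lp_eq : D.lp = 3 * D.m + D.d + D.d * (Nat.clog 2 D.d + 1) := by
  rw [lp, ell]; ring

/-- The marker differs from its shift by `δ < d` positions in at least `d` places. -/
theorem exists_autocyclic {δ : ℕ} (h0 : 0 < δ) (hδ : δ < D.d) :
    ∃ s : Finset ℕ, D.d ≤ s.card ∧ ∀ x ∈ s, δ ≤ x ∧ x < D.lp ∧
      D.p.getD x 0 ≠ D.p.getD (x - δ) 0 := by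
  obtain ⟨i, hi, hpar⟩ := exists_shift_parity h0
  have hic : i ≤ Nat.clog 2 D.d := by
    by_contra! h
    have h1 := Nat.le_pow_clog (one_lt_two) D.d
    have h2 := Nat.pow_lt_pow_right one_lt_two h
    omega
  have hic' : D.d * i ≤ D.d * Nat.clog 2 D.d := Nat.mul_le_mul_left _ hic
  have hm := D.d_le_m
  -- The first interval has `δ` places, where the run `1^d` meets the zeros before it; the second
  -- has `d - δ` places inside `u_i`, where the shift flips the parity of `b / 2 ^ i`.
  refine ⟨Finset.Ico (3 * D.m) (3 * D.m + δ) ∪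
    Finset.Ico (3 * D.m + D.d + D.d * i + δ) (3 * D.m + D.d + D.d * i + D.d), ?_, ?_⟩
  · rw [Finset.card_union_of_disjoint, Nat.card_Ico, Nat.card_Ico]
    · omega
    · rw [Finset.disjoint_left]
      intro x hx
      simp only [Finset.mem_Ico] at hx ⊢
      omega
  · intro x hx
    rw [lp_eq, mul_add, mul_one]
    rw [Finset.mem_union, Finset.mem_Ico, Finset.mem_Ico] at hx
    rcases hx with hx | hx
    · refine ⟨by omega, by omega, ?_⟩
      rw [D.p_zero (show x - δ < 3 * D.m by omega),
        show x = 3 * D.m + (x - 3 * D.m) by omega, D.p_one (by omega)]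
      exact one_ne_zero
    · refine ⟨by omega, by omega, ?_⟩
      obtain ⟨b, rfl⟩ : ∃ b, x = 3 * D.m + D.d + D.d * i + (b + δ) :=
        ⟨x - (3 * D.m + D.d + D.d * i + δ), by omega⟩
      rw [show 3 * D.m + D.d + D.d * i + (b + δ) - δ = 3 * D.m + D.d + D.d * i + b by omega,
        D.p_block hic (by omega), D.p_block hic (by omega)]
      have := hpar b
      rcases Nat.mod_two_eq_zero_or_one (b / 2 ^ i) with h | h
      · rw [if_pos h, if_neg (by omega)]; exact zero_ne_one
      · rw [if_neg (show ¬ b / 2 ^ i % 2 = 0 by omega), if_pos (by omega)]; exact one_ne_zero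

/-- The last block has half-period `2 ^ ⌈log₂ d⌉ ≥ d`, so its `d` letters are all ones. -/
theorem p_last {b : ℕ} (hb : b < D.d) : D.p.getD (D.lp - D.d + b) 0 = 1 := by
  rw [show D.lp - D.d + b = 3 * D.m + D.d + D.d * Nat.clog 2 D.d + b by
    rw [lp_eq, mul_add]; omega, D.p_block le_rfl hb, if_pos]
  rw [Nat.div_eq_of_lt (hb.trans_le (Nat.le_pow_clog one_lt_two _))]

/-- A subword of `V` inside `[y, z)` of weight at least `d`. -/
def Heavy (V : ℕ → ZMod 2) (y z : ℕ) : Prop :=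
  ∃ (a L : ℕ) (f : Fin L → ZMod 2), D.d ≤ hammingNorm f ∧ y ≤ a ∧ a + L ≤ z ∧
    ∀ b : Fin L, V (a + b) = f b

variable {D}

theorem Heavy.mono {V : ℕ → ZMod 2} {y z y' z' : ℕ} (h : D.Heavy V y z) (hy : y' ≤ y)
    (hz : z ≤ z') : D.Heavy V y' z' := by
  obtain ⟨a, L, f, h1, h2, h3, h4⟩ := h
  exact ⟨a, L, f, h1, by omega, by omega, h4⟩

theorem heavy_of_ones {V : ℕ → ZMod 2} {y : ℕ} (h : ∀ b < D.d, V (y + b) = 1) :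
    D.Heavy V y (y + D.d) :=
  ⟨y, D.d, fun _ => 1, by simp [hammingNorm], le_rfl, le_rfl, fun b => h b b.isLt⟩

/-- The marker begins with `3 m` zeros, so every nonzero letter of the heavy subword is a
disagreement. -/
theorem Heavy.le_hammingDist {V W : ℕ → ZMod 2} {s : ℕ} (h : D.Heavy V s (s + 3 * D.m))
    (hVW : ∀ x, x < 3 * D.m → W (s + x) = V (s + x)) :
    D.d ≤ hammingDist (fun x : Fin D.lp => W (s + x)) (fun x : Fin D.lp => D.p.getD x 0) := by
  obtain ⟨a, L, f, h1, h2, h3, h4⟩ := h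
  refine h1.trans ?_
  rw [hammingNorm]
  have hlp : 3 * D.m ≤ D.lp := by unfold lp; omega
  calc _ = (({b | f b ≠ 0} : Finset (Fin L)).image fun b : Fin L => a - s + (b : ℕ)).card := by
        rw [Finset.card_image_of_injective]
        intro b c hbc
        ext
        simpa using hbc
    _ ≤ _ := by
        refine card_le_hammingDist_fin (f := fun x => W (s + x)) (g := fun x => D.p.getD x 0) _ ?_
        intro x hx
        obtain ⟨b, hb, rfl⟩ := Finset.mem_image.1 hx
        have hbL := b.isLt
        refine ⟨by omega, ?_⟩
        rw [hVW _ (by omega), D.p_zero (by omega), show s + (a - s + b) = a + b by omega, h4]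
        simpa using hb

variable {t : ℕ} {c₀ c₁ : Fin D.nR → F}

theorem splice_p {s : ℕ} (hs : s < D.lp) : D.splice t c₀ c₁ s = D.p.getD s 0 := by
  rw [splice, word_p D _ hs, word_p D _ hs, ite_self]

theorem splice_ones {j b : ℕ} (hj : j < 2 * D.d + 2) (hb : b < D.d) :
    D.splice t c₀ c₁ (D.lp + D.m * D.kR + (D.m + D.d) * j + b) = 1 := by
  rw [splice, word_ones D _ hj hb, word_ones D _ hj hb, ite_self]

/-- Only a symbol that the cut passes through can mix two codewords; any other one is whole and
carries the weight of its codeword's symbol. -/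
theorem heavy_info (h₀ : ∀ j, D.d ≤ hammingNorm (D.φ (c₀ (Fin.castAdd _ j))))
    (h₁ : ∀ j, D.d ≤ hammingNorm (D.φ (c₁ (Fin.castAdd _ j)))) {j : ℕ} (hj : j < D.kR)
    (ht : t ≤ D.lp + D.m * j ∨ D.lp + D.m * j + D.m ≤ t) :
    D.Heavy (D.splice t c₀ c₁) (D.lp + D.m * j) (D.lp + D.m * j + D.m) := by
  rcases ht with ht | ht
  · refine ⟨_, D.m, _, h₀ ⟨j, hj⟩, le_rfl, le_rfl, fun b => ?_⟩
    rw [splice, if_neg (by omega), word_info D _ hj b.isLt]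
  · refine ⟨_, D.m, _, h₁ ⟨j, hj⟩, le_rfl, le_rfl, fun b => ?_⟩
    have := b.isLt
    rw [splice, if_pos (by omega), word_info D _ hj b.isLt]

theorem heavy_parity {j : ℕ} (hj : j < 2 * D.d + 2) :
    D.Heavy (D.splice t c₀ c₁) (D.lp + D.m * D.kR + (D.m + D.d) * j)
      (D.lp + D.m * D.kR + (D.m + D.d) * j + D.d) :=
  heavy_of_ones fun _ hb => splice_ones hj hb

theorem exists_mul_ge (T : ℕ) {m : ℕ} (hm : 0 < m) : ∃ j, T ≤ m * j ∧ m * j < T + m := by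
  refine ⟨(T + m - 1) / m, ?_⟩
  have h1 := Nat.div_add_mod (T + m - 1) m
  have h2 := Nat.mod_lt (T + m - 1) hm
  omega

theorem n_eq : D.n = D.lp + D.m * D.kR + (D.m + D.d) * (2 * D.d + 2) := by
  rw [n, nR]; ring

/-- This is where the length `3 m` comes from. In the information part the first whole symbol ends
within `2 m` letters and the next one within `3 m`, and the cut breaks at most one of them. In the
parity part the period is `m + d`, so a run `1^d` ends within `m + 2 d ≤ 3 m` letters. Near the
border the first such run serves. Starting fewer than `d` letters before the data does no harm,
since `d ≤ m`. -/
theorem heavy_data (hd : 0 < D.d) (h₀ : ∀ j, D.d ≤ hammingNorm (D.φ (c₀ (Fin.castAdd _ j))))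
    (h₁ : ∀ j, D.d ≤ hammingNorm (D.φ (c₁ (Fin.castAdd _ j)))) {s : ℕ}
    (hs : D.lp < s + D.d) (hn : s + 3 * D.m ≤ D.n) :
    D.Heavy (D.splice t c₀ c₁) s (s + 3 * D.m) := by
  have hm := D.d_le_m
  have hk := D.one_le_kR
  rw [n_eq] at hn
  -- `T` is the start of the stretch measured from the end of the marker, replaced by `0` if the
  -- stretch begins inside the marker.
  obtain ⟨T, hT, hTs⟩ : ∃ T, s ≤ D.lp + T ∧ (T = 0 ∨ D.lp + T = s) := by
    rcases Nat.le_total s D.lp with h | h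
    · exact ⟨0, h, Or.inl rfl⟩
    · exact ⟨s - D.lp, by omega, Or.inr (by omega)⟩
  rcases Nat.lt_or_ge (D.m * D.kR) T with hTk | hTk
  · obtain ⟨j, hj1, hj2⟩ := exists_mul_ge (T - D.m * D.kR) (show 0 < D.m + D.d by omega)
    have hj : j < 2 * D.d + 2 := by
      by_contra! h
      have := Nat.mul_le_mul_left (D.m + D.d) h
      omega
    exact (heavy_parity hj).mono (by omega) (by omega)
  obtain ⟨j, hj1, hj2⟩ := exists_mul_ge T (show 0 < D.m by omega)
  have hj0 : T = 0 → D.m * j = 0 := by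
    rintro rfl
    rcases Nat.eq_zero_or_pos j with h | h
    · simp [h]
    · have := Nat.mul_le_mul_left D.m h
      omega
  have hj3 : D.m * (j + 1) = D.m * j + D.m := by ring
  rcases Nat.lt_or_ge (j + 1) D.kR with hjk | hjk
  · by_cases hsp : t ≤ D.lp + D.m * j ∨ D.lp + D.m * j + D.m ≤ t
    · exact (heavy_info h₀ h₁ (by omega) hsp).mono (by omega) (by omega)
    · exact (heavy_info h₀ h₁ hjk (by omega)).mono (by omega) (by omega)
  · have h1 := Nat.mul_le_mul_left D.m hjk
    have := heavy_parity (D := D) (t := t) (c₀ := c₀) (c₁ := c₁) (j := 0) (by omega)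
    rw [Nat.mul_zero, Nat.add_zero] at this
    refine this.mono (by omega) ?_
    rcases hTs with rfl | h
    · have : D.kR ≤ 1 ∨ D.m ≤ D.m * j := by
        rcases Nat.eq_zero_or_pos j with h | h
        · left; omega
        · right; exact Nat.le_mul_of_pos_right _ h
      omega
    · omega

/-- The marker occurs in a cyclic window up to fewer than `d` errors at the beginning only. -/
theorem le_hammingDist_marker (hd : 0 < D.d)
    (h₀ : ∀ j, D.d ≤ hammingNorm (D.φ (c₀ (Fin.castAdd _ j))))
    (h₁ : ∀ j, D.d ≤ hammingNorm (D.φ (c₁ (Fin.castAdd _ j)))) {W : ℕ → ZMod 2}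
    (hW : ∀ s < D.n, W s = D.splice t c₀ c₁ s) (hper : ∀ s < D.n, W (D.n + s) = W s) {s : ℕ}
    (hs0 : 0 < s) (hs : s < D.n) :
    D.d ≤ hammingDist (fun x : Fin D.lp => W (s + x)) (fun x : Fin D.lp => D.p.getD x 0) := by
  have hm := D.d_le_m
  have hell : D.lp < 6 * D.m := by have := D.ell_lt; unfold lp; omega
  have hlp := D.lp_eq
  have hn := D.lp_lt_n
  have hWp : ∀ x < D.lp, W x = D.p.getD x 0 := fun x hx => by
    rw [hW x (by omega), splice_p hx]
  rw [mul_add, mul_one] at hlp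
  -- A small forward shift: the marker is compared with its own continuation.
  rcases Nat.lt_or_ge s D.d with hsd | hsd
  · obtain ⟨A, hA, hA'⟩ := D.exists_autocyclic hs0 hsd
    calc D.d ≤ (A.image fun x => x - s).card := by
          rwa [Finset.card_image_of_injOn]
          intro x hx y hy hxy
          have := (hA' x hx).1
          have := (hA' y hy).1
          simp only at hxy
          omega
      _ ≤ _ := by
          refine card_le_hammingDist_fin (f := fun x => W (s + x))
            (g := fun x => D.p.getD x 0) _ ?_
          intro y hy
          obtain ⟨x, hx, rfl⟩ := Finset.mem_image.1 hy
          obtain ⟨h1, h2, h3⟩ := hA' x hx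
          refine ⟨by omega, ?_⟩
          rwa [show s + (x - s) = x by omega, hWp x h2]
  -- Here the first `3 m` letters read run past the end of the cycle into the marker. For `n - s <
  -- d` this is a small backward shift; otherwise the run `1^d` of `p` falls on zeros of the copy.
  rcases Nat.lt_or_ge D.n (s + 3 * D.m) with hwrap | hwrap
  · have hWs : ∀ x, D.n - s ≤ x → x < D.lp → W (s + x) = D.p.getD (x - (D.n - s)) 0 := by
      intro x h1 h2
      rw [show s + x = D.n + (x - (D.n - s)) by omega, hper _ (by omega), hWp _ (by omega)]
    rcases Nat.lt_or_ge (D.n - s) D.d with hδ | hδ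
    · obtain ⟨A, hA, hA'⟩ := D.exists_autocyclic (show 0 < D.n - s by omega) hδ
      refine hA.trans (card_le_hammingDist_fin (f := fun x => W (s + x))
            (g := fun x => D.p.getD x 0) _ fun x hx => ?_)
      obtain ⟨h1, h2, h3⟩ := hA' x hx
      refine ⟨h2, ?_⟩
      rw [hWs x h1 h2]
      exact h3.symm
    · calc D.d = (Finset.Ico (3 * D.m) (3 * D.m + D.d)).card := by simp
        _ ≤ _ := by
          refine card_le_hammingDist_fin (f := fun x => W (s + x))
            (g := fun x => D.p.getD x 0) _ fun x hx => ?_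
          rw [Finset.mem_Ico] at hx
          refine ⟨by omega, ?_⟩
          rw [hWs x (by omega) (by omega), D.p_zero (by omega),
            show x = 3 * D.m + (x - 3 * D.m) by omega, D.p_one (by omega)]
          exact zero_ne_one
  -- No wrap-around: the zeros of `p` meet data, or the final run `1^d` of the marker, or its first
  -- run `1^d`, according to the position of `s`. The second case needs `ℓ_p < 6 m`.
  refine Heavy.le_hammingDist (V := D.splice t c₀ c₁) ?_ fun x hx => hW _ (by omega)
  rcases Nat.lt_or_ge D.lp (s + D.d) with h4 | h4
  · exact heavy_data hd h₀ h₁ h4 hwrap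
  rcases Nat.lt_or_ge (3 * D.m) s with h3 | h3
  · refine (heavy_of_ones (y := D.lp - D.d) fun b hb => ?_).mono (by omega) (by omega)
    rw [splice_p (by omega), p_last D hb]
  · refine (heavy_of_ones (y := 3 * D.m) fun b hb => ?_).mono (by omega) (by omega)
    rw [splice_p (by omega), p_one D hb]

end Construction
end RPS

/-! ### Symbol errors, unique decoding, and correctness of the algorithm -/

namespace RPS

/-- At most `N` consecutive cyclic positions are pairwise distinct, so no error is counted twice. -/
theorem hammingDist_cyc_le {N L : ℕ} (hL : L ≤ N) (w w' : Fin N → ZMod 2) (i : ℕ) :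
    hammingDist (fun x : Fin L => Construction.cyc w (i + x)) (fun x : Fin L => Construction.cyc w' (i + x)) ≤
      hammingDist w w' := by
  rw [hammingDist, hammingDist]
  rcases Nat.eq_zero_or_pos N with rfl | hN
  · obtain rfl : L = 0 := by omega
    simp
  refine Finset.card_le_card_of_injOn (fun x => ⟨(i + x) % N, Nat.mod_lt _ hN⟩) ?_ ?_
  · intro x hx
    have h := Nat.mod_lt (i + x) hN
    have hcyc : ∀ v : Fin N → ZMod 2, v ⟨(i + x) % N, h⟩ = Construction.cyc v (i + x) := fun v => by
      rw [← Construction.cyc_lt v h, Construction.cyc_congr _ (Nat.mod_mod _ _)]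
    simpa [hcyc] using hx
  · intro x _ y _ hxy
    have h : i + x ≡ i + y [MOD N] := Fin.mk.inj_iff.1 hxy
    have h2 := Nat.ModEq.add_left_cancel' i h
    ext
    exact Nat.ModEq.eq_of_lt_of_lt h2 (by omega) (by omega)

/-! ### Reed-Solomon codes -/

section ReedSolomon

variable {F : Type*} [Field F] {N k : ℕ} {x : Fin N → F}

theorem eq_of_mem_rsCode [DecidableEq F] (hx : Function.Injective x) {c c' : Fin N → F}
    (hc : c ∈ rsCode x k) (hc' : c' ∈ rsCode x k) (h : hammingDist c c' + k ≤ N) : c = c' := by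
  obtain ⟨f, hf, hfc⟩ := hc
  obtain ⟨g, hg, hgc⟩ := hc'
  have hcard : k ≤ (Finset.univ.filter fun j => c j = c' j).card := by
    have := Finset.card_filter_add_card_filter_not (s := (Finset.univ : Finset (Fin N)))
      (p := fun j => c j = c' j)
    rw [hammingDist] at h
    simp only [Finset.card_univ, Fintype.card_fin] at this
    simp only [ne_eq] at h
    omega
  have hcard' : (k : WithBot ℕ) ≤ (Finset.univ.filter fun j => c j = c' j).card := by
    exact_mod_cast hcard
  have : f = g := Polynomial.eq_of_degrees_lt_of_eval_index_eq _ hx.injOn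
    (hf.trans_le hcard') (hg.trans_le hcard') fun j hj => by
      rw [← hfc, ← hgc]; simpa using hj
  funext j
  rw [hfc, hgc, this]

/-- Two codewords within `(N - k) / 2` of `y` are within `N - k` of each other and hence equal; so
the arbitrary choice in `decRS` has only one candidate. -/
theorem decRS_eq [DecidableEq F] (hx : Function.Injective x) {c y : Fin N → F}
    (hc : c ∈ rsCode x k) (hk : k ≤ N) (h : 2 * hammingDist y c ≤ N - k) : decRS x k y = c := by
  classical
  have hex : ∃ c ∈ rsCode x k, 2 * @hammingDist _ _ _ (fun _ a b => Classical.propDecidable (a = b)) y c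
      ≤ N - k := ⟨c, hc, by convert h⟩
  rw [decRS, dif_pos hex]
  obtain ⟨h1, h2⟩ := hex.choose_spec
  refine eq_of_mem_rsCode hx h1 hc ?_
  have h3 := hammingDist_triangle_left hex.choose c y
  have h4 : 2 * hammingDist y hex.choose ≤ N - k := by convert h2
  omega

end ReedSolomon

namespace Construction

variable {F : Type*} (D : Construction F)

theorem injective_x_castAdd :
    Function.Injective fun i : Fin D.kR => D.x (Fin.castAdd (2 * D.d + 2) i) :=
  D.x_injective.comp (Fin.castAdd_injective _ _)

section

variable [Field F]

/-- The polynomial whose values are the encoding of `σ`. -/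
noncomputable def encPoly (σ : Fin D.kR → F) : Polynomial F :=
  Lagrange.interpolate Finset.univ (fun i : Fin D.kR => D.x (Fin.castAdd (2 * D.d + 2) i)) σ

theorem degree_encPoly (σ : Fin D.kR → F) : (D.encPoly σ).degree < (D.kR : WithBot ℕ) := by
  have := Lagrange.degree_interpolate_lt (s := Finset.univ) σ D.injective_x_castAdd.injOn
  rwa [Finset.card_univ, Fintype.card_fin] at this

theorem enc_eq (σ : Fin D.kR → F) (j : Fin D.nR) : D.enc σ j = (D.encPoly σ).eval (D.x j) := rfl

theorem enc_castAdd (σ : Fin D.kR → F) (j : Fin D.kR) :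
    D.enc σ (Fin.castAdd (2 * D.d + 2) j) = σ j :=
  Lagrange.eval_interpolate_at_node (s := Finset.univ) σ D.injective_x_castAdd.injOn
    (Finset.mem_univ j)

/-- Dropping coordinates does not change the polynomial, so all shortened words of step 3 are
codewords of the same dimension. -/
theorem enc_mem (σ : Fin D.kR → F) {N : ℕ} (κ : Fin N → Fin D.nR) :
    D.enc σ ∘ κ ∈ rsCode (D.x ∘ κ) D.kR :=
  ⟨D.encPoly σ, D.degree_encPoly σ, fun _ => rfl⟩

end

/-! ### Positions of the symbols -/

/-- The position of letter `b` of symbol `j` behind the marker. -/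
def pos (j b : ℕ) : ℕ :=
  if j < D.kR then D.lp + D.m * j + b
  else D.lp + D.m * D.kR + (D.m + D.d) * (j - D.kR) + D.d + b

/-- The symbol to which a position belongs. -/
def symbolAt (s : ℕ) : ℕ :=
  if s < D.lp + D.m * D.kR then (s - D.lp) / D.m
  else D.kR + (s - (D.lp + D.m * D.kR)) / (D.m + D.d)

variable {D}

theorem pos_lt_info {j b : ℕ} (hj : j < D.kR) (hb : b < D.m) : D.pos j b < D.lp + D.m * D.kR := by
  rw [pos, if_pos hj]
  have := Nat.mul_le_mul_left D.m (Nat.succ_le_of_lt hj)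
  rw [Nat.mul_succ] at this
  omega

theorem pos_lt_parity {j b : ℕ} (J : ℕ) (hj : j < D.kR + J) (hb : b < D.m) :
    D.pos j b < D.lp + D.m * D.kR + (D.m + D.d) * J := by
  rcases Nat.lt_or_ge j D.kR with h | h
  · have := pos_lt_info h hb
    omega
  · rw [pos, if_neg (by omega)]
    have := Nat.mul_le_mul_left (D.m + D.d) (show j - D.kR + 1 ≤ J by omega)
    rw [Nat.mul_succ] at this
    omega

theorem pos_lt {j b : ℕ} (hj : j < D.nR) (hb : b < D.m) : D.pos j b < D.n := by
  rw [n_eq]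
  exact pos_lt_parity _ hj hb

theorem symbolAt_pos {j b : ℕ} (hb : b < D.m) : D.symbolAt (D.pos j b) = j := by
  rcases Nat.lt_or_ge j D.kR with h | h
  · rw [symbolAt, if_pos (pos_lt_info h hb), pos, if_pos h,
      show D.lp + D.m * j + b - D.lp = b + D.m * j by omega,
      Nat.add_mul_div_left _ _ (by omega), Nat.div_eq_of_lt hb, zero_add]
  · rw [symbolAt, pos, if_neg (show ¬ j < D.kR by omega), if_neg (by omega),
      show D.lp + D.m * D.kR + (D.m + D.d) * (j - D.kR) + D.d + b - (D.lp + D.m * D.kR) =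
        D.d + b + (D.m + D.d) * (j - D.kR) by omega,
      Nat.add_mul_div_left _ _ (by omega), Nat.div_eq_of_lt (by omega)]
    omega

theorem word_pos (c : Fin D.nR → F) (j : Fin D.nR) (b : Fin D.m) :
    D.word c (D.pos j b) = D.φ (c j) b := by
  refine Fin.addCases (fun j => ?_) (fun j => ?_) j
  · rw [pos, if_pos (by simp), Fin.val_castAdd, word_info D c j.isLt b.isLt]
  · rw [pos, if_neg (by simp), Fin.val_natAdd, Nat.add_sub_cancel_left,
      word_symbol D c j.isLt b.isLt]

theorem φ_cbar (w : Fin D.n → ZMod 2) (j : Fin D.nR) (b : Fin D.m) :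
    D.φ (D.cbar w j) b = D.rotated w (D.pos j b) := by
  refine Fin.addCases (fun j => ?_) (fun j => ?_) j
  · rw [pos, if_pos (by simp), Fin.val_castAdd, cbar, Fin.addCases_left, Equiv.apply_symm_apply]
  · rw [pos, if_neg (by simp), Fin.val_natAdd, Nat.add_sub_cancel_left, cbar,
      Fin.addCases_right, Equiv.apply_symm_apply]

open Classical in
/-- At most as many symbols are affected as there are erroneous letters. -/
theorem exists_bad (w : Fin D.n → ZMod 2) (V : ℕ → ZMod 2) :
    ∃ B : Finset (Fin D.nR),
      B.card ≤ hammingDist (fun s : Fin D.n => V s) (fun s : Fin D.n => D.rotated w s) ∧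
      ∀ j ∉ B, ∀ b : Fin D.m, D.φ (D.cbar w j) b = V (D.pos j b) := by
  refine ⟨Finset.univ.filter fun j : Fin D.nR =>
    ∃ b : Fin D.m, V (D.pos j b) ≠ D.rotated w (D.pos j b), ?_, ?_⟩
  · rw [hammingDist]
    calc _ = (Finset.image (fun j : Fin D.nR => (j : ℕ)) (Finset.univ.filter fun j : Fin D.nR =>
          ∃ b : Fin D.m, V (D.pos j b) ≠ D.rotated w (D.pos j b))).card :=
        (Finset.card_image_of_injective _ Fin.val_injective).symm
      _ ≤ _ := by
        -- Each bad symbol contains a wrong letter, which `symbolAt` sends back to it. The values of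
        -- `symbolAt` on inserted letters play no role.
        refine Finset.card_le_card_of_surjOn (fun s : Fin D.n => D.symbolAt s) ?_
        intro j' hj'
        simp only [Finset.coe_image, Set.mem_image, Finset.coe_filter, Finset.mem_univ,
          true_and, Set.mem_ofPred_eq] at hj'
        obtain ⟨j, ⟨b, hb⟩, rfl⟩ := hj'
        exact ⟨⟨D.pos j b, pos_lt j.isLt b.isLt⟩, by simpa using hb, symbolAt_pos b.isLt⟩
  · intro j hj b
    rw [φ_cbar]
    simp only [Finset.mem_filter, Finset.mem_univ, true_and, not_exists, not_not] at hj
    exact (hj b).symm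

theorem splice_pos {t : ℕ} {c₀ c₁ : Fin D.nR → F} (j : Fin D.nR) (b : Fin D.m) :
    D.splice t c₀ c₁ (D.pos j b) = D.φ (if D.pos j b < t then c₁ j else c₀ j) b := by
  rw [splice, word_pos, word_pos]
  split_ifs <;> rfl

theorem cbar_eq {w : Fin D.n → ZMod 2} {j : Fin D.nR} {c : F}
    (h : ∀ b, D.φ (D.cbar w j) b = D.φ c b) : D.cbar w j = c :=
  D.φ.injective (funext h)

theorem hammingDist_comp_le [DecidableEq F] {N : ℕ} {κ : Fin N → Fin D.nR}
    (hκ : Function.Injective κ) {y c : Fin D.nR → F} {B : Finset (Fin D.nR)}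
    (h : ∀ j, y (κ j) ≠ c (κ j) → κ j ∈ B) : hammingDist (y ∘ κ) (c ∘ κ) ≤ B.card := by
  rw [hammingDist]
  exact Finset.card_le_card_of_injOn κ (fun j hj => h j (by simpa using hj)) hκ.injOn

theorem keepFirst_injective : Function.Injective D.keepFirst := fun a b h => by
  simpa [keepFirst, Fin.ext_iff] using h

theorem keepLast_val (j : Fin (D.kR + (D.d + 1))) :
    (D.keepLast j : ℕ) = if (j : ℕ) < D.kR then (j : ℕ) else j + (D.d + 1) := by
  refine Fin.addCases (fun j => ?_) (fun j => ?_) j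
  · rw [keepLast, Fin.addCases_left]; simp
  · rw [keepLast, Fin.addCases_right]; simp; omega

theorem keepLast_injective : Function.Injective D.keepLast := fun a b h => by
  have := congrArg Fin.val h
  rw [keepLast_val, keepLast_val] at this
  ext
  split_ifs at this <;> omega

/-- The symbols that can be trusted up to few errors, for a cut at position `t`. -/
def Close [DecidableEq F] (w : Fin D.n → ZMod 2) (t : ℕ) (c₀ c₁ : Fin D.nR → F) : Prop :=
  (t < D.lp + D.m * D.kR → 2 * hammingDist (D.cbar w) c₀ ≤ D.nR - D.kR) ∧
  (D.lp + D.m * D.kR ≤ t → t < D.lp + D.m * D.kR + (D.d + 1) * (D.m + D.d) →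
    2 * hammingDist (D.cbar w ∘ D.keepLast) (c₀ ∘ D.keepLast) ≤ D.kR + (D.d + 1) - D.kR) ∧
  (D.lp + D.m * D.kR + (D.d + 1) * (D.m + D.d) ≤ t →
    2 * hammingDist (D.cbar w ∘ D.keepFirst) (c₁ ∘ D.keepFirst) ≤ D.kR + (D.d + 1) - D.kR)

/-- The count of symbol errors. Measured against `c₀`, they are the symbols hit by letter errors and
the one coordinate where Gray neighbours differ; the kept parity symbols lie behind the cut. From `2
e < d` follows `2 (e + 1) ≤ d + 1`, so `d + 1` parity symbols are exactly enough. -/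
theorem close_of_splice [DecidableEq F] (w : Fin D.n → ZMod 2) (t : ℕ) (c₀ c₁ : Fin D.nR → F)
    (hc : hammingDist (fun j => c₁ (Fin.castAdd (2 * D.d + 2) j))
      (fun j => c₀ (Fin.castAdd (2 * D.d + 2) j)) ≤ 1)
    (hw : 2 * hammingDist (fun s : Fin D.n => D.splice t c₀ c₁ s)
      (fun s : Fin D.n => D.rotated w s) < D.d) :
    Close w t c₀ c₁ := by
  obtain ⟨B, hB, hBw⟩ := exists_bad w (D.splice t c₀ c₁)
  set E : Finset (Fin D.nR) :=
    (Finset.univ.filter fun j : Fin D.kR => c₁ (Fin.castAdd _ j) ≠ c₀ (Fin.castAdd _ j)).map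
      (Fin.castAddEmb _) with hE
  have hEcard : E.card ≤ 1 := by rw [hE, Finset.card_map]; exact hc
  have hBE : (B ∪ E).card ≤ B.card + E.card := Finset.card_union_le _ _
  -- An information symbol may be cut anywhere: outside `E` both codewords agree on it. A parity
  -- symbol must lie behind the cut as a whole.
  have key : ∀ j : Fin D.nR, ((j : ℕ) < D.kR ∨ ∀ b < D.m, t ≤ D.pos j b) →
      D.cbar w j ≠ c₀ j → j ∈ B ∪ E := by
    intro j hj hne
    by_contra hmem
    rw [Finset.mem_union, not_or] at hmem
    refine hne (cbar_eq fun b => ?_)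
    rw [hBw j hmem.1, splice_pos]
    rcases hj with hj | hj
    · have : c₁ j = c₀ j := by
        by_contra hcj
        refine hmem.2 (Finset.mem_map.2 ⟨⟨j, hj⟩, ?_, rfl⟩)
        rw [Finset.mem_filter]
        exact ⟨Finset.mem_univ _, hcj⟩
      rw [this, ite_self]
    · rw [if_neg (by have := hj b b.isLt; omega)]
  refine ⟨fun h1 => ?_, fun h1 h2 => ?_, fun h1 => ?_⟩
  · have := hammingDist_comp_le (κ := id) Function.injective_id (y := D.cbar w) (c := c₀)
      (B := B ∪ E) fun j hj => key j ?_ hj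
    · simp only [Function.comp_id] at this
      unfold nR; omega
    · by_cases hjk : (j : ℕ) < D.kR
      · exact Or.inl hjk
      · right
        intro b hb
        simp only [pos, if_neg hjk]; omega
  · have := hammingDist_comp_le (κ := D.keepLast) keepLast_injective (y := D.cbar w) (c := c₀)
      (B := B ∪ E) fun j hj => key _ ?_ hj
    · omega
    · rw [keepLast_val]
      split_ifs with hjk
      · exact Or.inl hjk
      · right
        intro b hb
        rw [pos, if_neg (by omega)]
        have := Nat.mul_le_mul_left (D.m + D.d) (show D.d + 1 ≤ j + (D.d + 1) - D.kR by omega)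
        rw [mul_comm] at this
        omega
  -- All kept symbols now lie before the cut and belong to `c₁`, so the Gray step costs nothing.
  · have := hammingDist_comp_le (κ := D.keepFirst) keepFirst_injective (y := D.cbar w) (c := c₁)
      (B := B) fun j hj => ?_
    · omega
    · by_contra hmem
      refine hj (cbar_eq fun b => ?_)
      rw [hBw _ hmem, splice_pos, if_pos]
      have := pos_lt_parity (D := D) (j := D.keepFirst j) (D.d + 1) (by simp [keepFirst]) b.isLt
      rw [mul_comm (D.m + D.d)] at this
      omega

theorem decGray_eq [DecidableEq F] {G : Fin (D.r ^ D.kR) → Fin D.kR → D.X} (hG : IsGrayCode G) (b : Fin (D.r ^ D.kR)) :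
    D.decGray G (fun j => (G b j : F)) = b := by
  rw [decGray, show {i | ∃ h : i < D.r ^ D.kR, ∀ j, (G ⟨i, h⟩ j : F) = G b j} = {(b : ℕ)} from ?_,
    csInf_singleton]
  ext s
  constructor
  · rintro ⟨h, hj⟩
    have := hG.1.1 (funext fun j => Subtype.ext (hj j) : G ⟨s, h⟩ = G b)
    rw [← this]; rfl
  · rintro rfl
    exact ⟨b.isLt, fun _ => rfl⟩

variable [Field F] [DecidableEq F] {G : Fin (D.r ^ D.kR) → Fin D.kR → D.X} {i : ℕ}
  {w : Fin D.n → ZMod 2}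

/-- For the clean window the marker distance is `0` at the true offset and at least `d` elsewhere.
Passing to `w` changes it by at most `e < d / 2`, by the triangle inequality. -/
theorem isOffset_iff (hG : IsGrayCode G) (hi : i + D.n ≤ (D.S G).length)
    (hw : 2 * hammingDist (D.window G i) w < D.d) (s : ℕ) :
    D.IsOffset w s ↔ s = D.shift (i % D.n) := by
  have hlp := D.lp_lt_n
  have hd : 0 < D.d := by omega
  obtain ⟨b₀, b₁, -, -, -, hV⟩ := cyc_window D G hG hi
  have herr : ∀ s, hammingDist (fun x : Fin D.lp => cyc (D.window G i) (s + x))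
      (fun x : Fin D.lp => cyc w (s + x)) ≤ hammingDist (D.window G i) w :=
    fun s => hammingDist_cyc_le hlp.le _ _ s
  set o := D.shift (i % D.n) with ho
  have hon : o < D.n := Nat.mod_lt _ (by omega)
  constructor
  · rintro ⟨hs, hsd⟩
    by_contra hne
    have hX : ∀ (b : Fin (D.r ^ D.kR)) (j : Fin D.kR),
        D.d ≤ hammingNorm (D.φ (D.enc (fun j => (G b j : F)) (Fin.castAdd _ j))) := fun b j => by
      rw [enc_castAdd]
      exact (G b j).2
    obtain ⟨s', hs'0, hs'n, hs'⟩ : ∃ s', 0 < s' ∧ s' < D.n ∧ s % D.n = (o + s') % D.n := by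
      rcases Nat.lt_or_ge o s with h | h
      · exact ⟨s - o, by omega, by omega, by rw [Nat.add_sub_cancel' h.le]⟩
      · refine ⟨s + D.n - o, by omega, by omega, ?_⟩
        rw [show o + (s + D.n - o) = s + D.n by omega, Nat.add_mod_right]
    have h1 := le_hammingDist_marker (W := fun x => cyc (D.window G i) (o + x)) hd
      (hX b₀) (hX b₁) hV
      (fun x _ => cyc_congr _ (by rw [show o + (D.n + x) = o + x + D.n by ring,
        Nat.add_mod_right])) hs'0 hs'n
    have h2 : (fun x : Fin D.lp => cyc (D.window G i) (o + (s' + x))) =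
        fun x : Fin D.lp => cyc (D.window G i) (s + x) := by
      funext x
      refine cyc_congr _ ?_
      rw [← add_assoc]
      exact (Nat.ModEq.add_right _ hs').symm
    rw [h2] at h1
    have h3 := hammingDist_triangle (fun x : Fin D.lp => cyc (D.window G i) (s + x))
      (fun x : Fin D.lp => cyc w (s + x)) (fun x : Fin D.lp => D.p.getD x 0)
    have h4 := herr s
    rw [markerDist] at hsd
    omega
  · rintro rfl
    refine ⟨hon, ?_⟩
    rw [markerDist, show (fun t : Fin D.lp => D.p.getD t 0) =
      fun x : Fin D.lp => cyc (D.window G i) (o + x) from funext fun x => by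
        rw [hV x (by omega), splice_p x.isLt], hammingDist_comm]
    have := herr o
    omega

theorem offset_eq (hG : IsGrayCode G) (hi : i + D.n ≤ (D.S G).length)
    (hw : 2 * hammingDist (D.window G i) w < D.d) : D.offset w = D.shift (i % D.n) := by
  rw [offset, show {s | D.IsOffset w s} = {D.shift (i % D.n)} from
    Set.ext fun s => isOffset_iff hG hi hw s, csInf_singleton]

theorem modPos_eq (hG : IsGrayCode G) (hi : i + D.n ≤ (D.S G).length)
    (hw : 2 * hammingDist (D.window G i) w < D.d) : D.modPos w = i % D.n := by
  have hlp := D.lp_lt_n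
  rw [modPos, offset_eq hG hi hw, shift]
  have hlt := Nat.mod_lt i (show 0 < D.n by omega)
  rcases Nat.eq_zero_or_pos (i % D.n) with h | h
  · rw [h, Nat.sub_zero, Nat.mod_self, Nat.sub_zero, Nat.mod_self]
  · rw [Nat.mod_eq_of_lt (show D.n - i % D.n < D.n by omega), Nat.mod_eq_of_lt (by omega)]
    omega

theorem exists_close (hG : IsGrayCode G) (hi : i + D.n ≤ (D.S G).length)
    (hw : 2 * hammingDist (D.window G i) w < D.d) :
    ∃ b₀ b₁ : Fin (D.r ^ D.kR), (b₀ : ℕ) = i / D.n ∧ (0 < i % D.n → (b₁ : ℕ) = i / D.n + 1) ∧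
      Close w (D.modPos w) (D.enc fun j => (G b₀ j : F)) (D.enc fun j => (G b₁ j : F)) := by
  obtain ⟨b₀, b₁, h0, h1, hdist, hV⟩ := cyc_window D G hG hi
  refine ⟨b₀, b₁, h0, h1, close_of_splice w _ _ _ ?_ ?_⟩
  · simp only [enc_castAdd]
    refine le_trans ?_ hdist
    rw [hammingDist, hammingDist]
    refine Finset.card_le_card fun j hj => ?_
    simpa [Subtype.ext_iff] using hj
  · have := hammingDist_cyc_le le_rfl (D.window G i) w (D.shift (i % D.n))
    rw [modPos_eq hG hi hw]
    simp only [rotated, offset_eq hG hi hw]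
    rw [show (fun s : Fin D.n => D.splice (i % D.n) (D.enc fun j => (G b₀ j : F))
      (D.enc fun j => (G b₁ j : F)) s) = fun s : Fin D.n =>
        cyc (D.window G i) (D.shift (i % D.n) + s) from funext fun s => (hV s s.isLt).symm]
    omega

theorem decoded_eq {c₀ c₁ : Fin D.kR → F} (h : Close w (D.modPos w) (D.enc c₀) (D.enc c₁)) :
    D.decoded w = if D.modPos w < D.lp + D.m * D.kR + (D.d + 1) * (D.m + D.d) then c₀ else c₁ := by
  obtain ⟨h1, h2, h3⟩ := h
  rw [decoded]
  split_ifs with h4 h5 h5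
  · rw [decRS_eq D.x_injective (D.enc_mem c₀ id) (by omega) (h1 h4)]
    exact funext fun j => enc_castAdd D c₀ j
  · omega
  · rw [decRS_eq (D.x_injective.comp keepLast_injective) (D.enc_mem c₀ D.keepLast) (by omega)
      (h2 (by omega) h5)]
    funext j
    rw [Function.comp_apply, keepLast, Fin.addCases_left, enc_castAdd]
  · rw [decRS_eq (D.x_injective.comp keepFirst_injective) (D.enc_mem c₁ D.keepFirst) (by omega)
      (h3 (by omega))]
    exact funext fun j => enc_castAdd D c₁ j

theorem locate_eq (hG : IsGrayCode G) (hi : i + D.n ≤ (D.S G).length)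
    (hw : 2 * hammingDist (D.window G i) w < D.d) : D.locate G w = i := by
  obtain ⟨b₀, b₁, h0, h1, hc⟩ := exists_close hG hi hw
  rw [locate, decoded_eq hc]
  have hmod := modPos_eq hG hi hw
  have hdm := Nat.div_add_mod' i D.n
  have := D.ell_lt
  split_ifs with h
  · rw [decGray_eq hG, h0, hmod, hdm]
  -- In this case the residue is positive because `ℓ_p` is, so `b₁` is the index of the next block
  -- and the subtraction undoes the shift.
  · rw [decGray_eq hG, hmod, h1 (by unfold lp at *; omega), Nat.add_sub_cancel, hdm]

end Construction
end RPS

/-! ### The reflected Gray code -/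

namespace RPS

/-- Reflection is an involution on digits, and the parity that triggers it depends only on the
higher digits. So an index can be rebuilt from its Gray digits by Horner's scheme, most significant
first. -/
theorem div_pow_step {r : ℕ} (t i : ℕ) :
    i / r ^ t = i / r ^ (t + 1) * r +
      (if i / r ^ (t + 1) % 2 = 0 then grayDigit r t i else r - 1 - grayDigit r t i) := by
  rcases Nat.eq_zero_or_pos r with rfl | hr
  · rcases t with _ | t <;> simp [grayDigit]
  have h1 := Nat.div_add_mod (i / r ^ t) r
  have h2 := Nat.mod_lt (i / r ^ t) hr
  rw [Nat.div_div_eq_div_mul, ← pow_succ] at h1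
  rw [grayDigit, Nat.div_div_eq_div_mul, ← pow_succ, mul_comm]
  split_ifs <;> omega

/-- If `r ^ (t + 1)` divides `i + 1`, the plain digit drops from `r - 1` to `0`, but the parity of
the higher part flips and the reflected digit stays the same. If only `r ^ t` divides, the digit
moves by one with unchanged parity; otherwise nothing moves. -/
theorem grayDigit_succ_ne_iff {r t i : ℕ} (hr : 2 ≤ r) :
    grayDigit r t i ≠ grayDigit r t (i + 1) ↔ r ^ t ∣ i + 1 ∧ ¬ r ^ (t + 1) ∣ i + 1 := by
  have a1 := Nat.div_add_mod (i / r ^ t) r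
  have a2 := Nat.mod_lt (i / r ^ t) (show 0 < r by omega)
  have b1 := Nat.div_add_mod ((i + 1) / r ^ t) r
  have b2 := Nat.mod_lt ((i + 1) / r ^ t) (show 0 < r by omega)
  have e1 : i / r ^ t / r = i / r ^ (t + 1) := by rw [Nat.div_div_eq_div_mul, pow_succ]
  have e2 : (i + 1) / r ^ t / r = (i + 1) / r ^ (t + 1) := by
    rw [Nat.div_div_eq_div_mul, pow_succ]
  rw [grayDigit, grayDigit]
  rw [e1] at a1 ⊢
  rw [e2] at b1 ⊢
  have c1 := Nat.succ_div (a := i) (b := r ^ t)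
  have c2 := Nat.succ_div (a := i) (b := r ^ (t + 1))
  by_cases h1 : r ^ t ∣ i + 1
  · by_cases h2 : r ^ (t + 1) ∣ i + 1
    · rw [if_pos h1] at c1
      rw [if_pos h2] at c2
      rw [c2] at b1 ⊢
      rw [mul_add, mul_one] at b1
      simp only [h1, h2, not_true, and_false, iff_false, not_not]
      split_ifs <;> omega
    · rw [if_pos h1] at c1
      rw [if_neg h2, add_zero] at c2
      rw [c2] at b1 ⊢
      simp only [h1, h2, not_false_eq_true, and_true, iff_true]
      split_ifs <;> omega
  · have h2 : ¬ r ^ (t + 1) ∣ i + 1 := fun h => h1 ((pow_dvd_pow r (by omega)).trans h)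
    rw [if_neg h1, add_zero] at c1
    rw [if_neg h2, add_zero] at c2
    rw [c1, c2]
    simp [h1]

theorem isGrayCode_reflectedGray {A : Type*} [DecidableEq A] {r : ℕ} (k : ℕ) (ρ : Fin r ≃ A) :
    IsGrayCode (reflectedGray k ρ) := by
  have : Fintype A := Fintype.ofEquiv _ ρ
  have hdig : ∀ (i i' : Fin (r ^ k)) (j : Fin k), reflectedGray k ρ i j = reflectedGray k ρ i' j ↔
      grayDigit r (k - 1 - j) i = grayDigit r (k - 1 - j) i' := fun i i' j => by
    rw [reflectedGray, reflectedGray, ρ.apply_eq_iff_eq, Fin.mk.injEq]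
  refine ⟨(Fintype.bijective_iff_injective_and_card _).2 ⟨fun i i' h => ?_, ?_⟩, fun i h => ?_⟩
  -- The `s` leading digits determine the quotient by `r ^ (k - s)`; at `s = k` this is the index
  -- itself.
  · have key : ∀ s ≤ k, (i : ℕ) / r ^ (k - s) = i' / r ^ (k - s) := by
      intro s
      induction s with
      | zero => intro _; rw [Nat.sub_zero, Nat.div_eq_of_lt i.isLt, Nat.div_eq_of_lt i'.isLt]
      | succ s ih =>
        intro hs
        have h1 := (hdig i i' ⟨s, by omega⟩).1 (by rw [h])
        rw [div_pow_step (k - (s + 1)), div_pow_step (k - (s + 1)),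
          show k - (s + 1) + 1 = k - s by omega, ih (by omega),
          show k - (s + 1) = k - 1 - s by omega, h1]
    have := key k le_rfl
    rw [Nat.sub_self, pow_zero, Nat.div_one, Nat.div_one] at this
    exact Fin.ext this
  · simp [← Fintype.card_congr ρ]
  · have hr : 2 ≤ r := by
      by_contra! hr
      have := Nat.pow_le_pow_left (show r ≤ 1 by omega) k
      rw [one_pow] at this
      omega
    have hex : ∃ t, ¬ r ^ (t + 1) ∣ i + 1 :=
      ⟨k, fun hk => by
        have h1 := Nat.le_of_dvd (by omega) hk
        have h2 := Nat.pow_le_pow_right (show 0 < r by omega) (show k ≤ k + 1 by omega)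
        omega⟩
    classical
    -- `T` is the exponent of the largest power of `r` dividing `i + 1`, hence the weight of the
    -- only digit that changes.
    set T := Nat.find hex with hT
    have hT1 : ¬ r ^ (T + 1) ∣ i + 1 := Nat.find_spec hex
    have hT2 : r ^ T ∣ i + 1 := by
      rcases Nat.eq_zero_or_pos T with h0 | h0
      · rw [h0]; exact one_dvd _
      · have := Nat.find_min hex (show T - 1 < T by omega)
        rw [not_not, show T - 1 + 1 = T by omega] at this
        exact this
    have hTk : T < k := by
      by_contra! hk
      have h1 := Nat.le_of_dvd (by omega) hT2
      have h2 := Nat.pow_le_pow_right (show 0 < r by omega) hk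
      omega
    rw [hammingDist, Finset.card_eq_one]
    refine ⟨⟨k - 1 - T, by omega⟩, ?_⟩
    ext j
    rw [Finset.mem_filter, Finset.mem_singleton, ne_eq, hdig, ← ne_eq, grayDigit_succ_ne_iff hr]
    simp only [Finset.mem_univ, true_and, Fin.ext_iff]
    have hj := j.isLt
    constructor
    · rintro ⟨h1, h2⟩
      have h3 : k - 1 - j ≤ T := by
        by_contra! h3
        exact hT1 ((pow_dvd_pow r h3).trans h1)
      have h4 : T ≤ k - 1 - j := by
        by_contra! h4
        exact h2 ((pow_dvd_pow r h4).trans hT2)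
      omega
    · intro h1
      rw [show k - 1 - j = T by omega]
      exact ⟨hT2, hT1⟩

end RPS

namespace RPS

/-! ### Interpolation decoding -/

section Decoding

open Polynomial

variable {F : Type*} [Field F]

/-- Two independent pairs `(A, B)` with `A + y B = 0` at the first `i` points, with bounds
on the weighted degrees. -/
structure KeyPairs (x y : ℕ → F) (k i : ℕ) (A B : ℕ → F[X]) (δ : ℕ → ℕ) : Prop where
  natDegree_fst : ∀ s < 2, (A s).natDegree ≤ δ s
  natDegree_snd : ∀ s < 2, (B s * X ^ (k - 1)).natDegree ≤ δ s
  sum_le : δ 0 + δ 1 ≤ i + (k - 1)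
  det_ne : A 0 * B 1 - A 1 * B 0 ≠ 0
  vanish : ∀ s < 2, ∀ h < i, (A s).eval (x h) + y h * (B s).eval (x h) = 0

/-- The pairs `(1, 0)` and `(0, 1)`, where `B` is given the extra weight `k - 1` so that `A` and `B
f` are measured alike. -/
theorem keyPairs_zero (x y : ℕ → F) (k : ℕ) :
    KeyPairs x y k 0 (fun s => if s = 0 then 1 else 0) (fun s => if s = 0 then 0 else 1)
      (fun s => if s = 0 then 0 else k - 1) := by
  constructor
  · intro s hs; interval_cases s <;> simp
  · intro s hs; interval_cases s <;> simp
  · simp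
  · simp
  · intro s hs h hh; omega

theorem natDegree_sub_C_mul_le {p q : F[X]} {c : F} {m n : ℕ} (hp : p.natDegree ≤ m)
    (hq : q.natDegree ≤ n) (h : c ≠ 0 → n ≤ m) : (p - C c * q).natDegree ≤ m := by
  by_cases hc : c = 0
  · simpa [hc] using hp
  · exact natDegree_sub_le_of_le hp ((natDegree_C_mul_le _ _).trans (hq.trans (h hc)))|>.trans
      (max_self _).le

theorem natDegree_X_sub_C_mul_le {p : F[X]} {a : F} {m : ℕ} (hp : p.natDegree ≤ m) :
    ((X - C a) * p).natDegree ≤ m + 1 := by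
  refine natDegree_mul_le.trans ?_
  rw [natDegree_X_sub_C]
  omega

/-- The factor `X - x_i` makes the pivot pair `a` vanish at the new point, and subtracting `c` times
the old pivot does so for `b`. The determinant is multiplied by `X - x_i`. Only the bound of the
pivot grows, by one, as a nonzero multiple is subtracted only from a pair of at least the same
weight. -/
theorem KeyPairs.step {x y : ℕ → F} {k i : ℕ} {A B : ℕ → F[X]} {δ : ℕ → ℕ}
    (H : KeyPairs x y k i A B δ) {a b : ℕ} (hab : a = 0 ∧ b = 1 ∨ a = 1 ∧ b = 0) {c : F}
    (hc : (A b).eval (x i) + y i * (B b).eval (x i) =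
      c * ((A a).eval (x i) + y i * (B a).eval (x i)))
    (hδ : c ≠ 0 → δ a ≤ δ b) :
    KeyPairs x y k (i + 1) (fun s => if s = a then (X - C (x i)) * A a else A b - C c * A a)
      (fun s => if s = a then (X - C (x i)) * B a else B b - C c * B a)
      (fun s => if s = a then δ a + 1 else δ b) := by
  have ha : a < 2 := by omega
  have hb : b < 2 := by omega
  constructor
  · intro s hs
    split_ifs
    · exact natDegree_X_sub_C_mul_le (H.natDegree_fst a ha)
    · exact natDegree_sub_C_mul_le (H.natDegree_fst b hb) (H.natDegree_fst a ha) hδ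
  · intro s hs
    split_ifs
    · rw [mul_assoc]; exact natDegree_X_sub_C_mul_le (H.natDegree_snd a ha)
    · rw [sub_mul, mul_assoc]
      exact natDegree_sub_C_mul_le (H.natDegree_snd b hb) (H.natDegree_snd a ha) hδ
  · have := H.sum_le
    rcases hab with ⟨rfl, rfl⟩ | ⟨rfl, rfl⟩ <;> simp <;> omega
  · have hdet := mul_ne_zero (X_sub_C_ne_zero (x i)) H.det_ne
    rcases hab with ⟨rfl, rfl⟩ | ⟨rfl, rfl⟩
    · simp only [if_true, one_ne_zero, if_false]
      convert hdet using 1; ring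
    · simp only [if_true, zero_ne_one, if_false]
      convert hdet using 1; ring
  · intro s hs h hh
    rcases Nat.lt_succ_iff_lt_or_eq.1 hh with hh | rfl
    · have h1 := H.vanish a ha h hh
      have h2 := H.vanish b hb h hh
      split_ifs
      · simp only [eval_mul]; linear_combination (X - C (x i)).eval (x h) * h1
      · simp only [eval_sub, eval_mul, eval_C]; linear_combination h2 - c * h1
    · split_ifs
      · simp
      · simp only [eval_sub, eval_mul, eval_C]; linear_combination hc

variable [DecidableEq F]

/-- The lighter pair has weight at most `(N + k - 1) / 2`, which is small enough to force `A = -B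
f`. Its `B` vanishes at every wrong point, yet has few enough roots to leave `k` points for
interpolation. -/
theorem KeyPairs.eval_eq {x y : ℕ → F} {k N : ℕ} {A B : ℕ → F[X]} {δ : ℕ → ℕ}
    (H : KeyPairs x y k N A B δ) (hx : Set.InjOn x (Finset.range N)) (hk : 1 ≤ k) (hkN : k ≤ N)
    {f : F[X]} (hf : f.degree < (k : WithBot ℕ))
    (hy : 2 * ((Finset.range N).filter fun h => y h ≠ f.eval (x h)).card ≤ N - k)
    {s : ℕ} (hs : s = 0 ∧ δ 0 ≤ δ 1 ∨ s = 1 ∧ δ 1 ≤ δ 0) (z : F) :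
    f.eval z = ∑ g ∈ Finset.range N, if (B s).eval (x g) = 0 then 0 else
      y g * ∏ h ∈ Finset.range N, if (B s).eval (x h) = 0 ∨ h = g then 1 else
        (z - x h) / (x g - x h) := by
  have hs2 : s < 2 := by omega
  have hδ : 2 * δ s ≤ N + (k - 1) := by
    have := H.sum_le
    rcases hs with ⟨rfl, h⟩ | ⟨rfl, h⟩ <;> omega
  have hfd : f.natDegree ≤ k - 1 := by
    by_cases hf0 : f = 0
    · simp [hf0]
    · have := (Polynomial.natDegree_lt_iff_degree_lt hf0).2 hf
      omega
  have hBf : (B s * f).natDegree ≤ δ s := by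
    by_cases hB : B s = 0
    · simp [hB]
    · refine natDegree_mul_le.trans ((Nat.add_le_add_left hfd _).trans ?_)
      rw [← natDegree_mul_X_pow _ hB]
      exact H.natDegree_snd s hs2
  have hcard := Finset.card_filter_add_card_filter_not (s := Finset.range N)
      (p := fun h => y h = f.eval (x h))
  rw [Finset.card_range] at hcard
  -- The degree is below `(N + k) / 2`, and at least that many points carry correct values.
  have hzero : A s + B s * f = 0 := by
    refine eq_zero_of_natDegree_lt_card_of_eval_eq_zero' _
      (((Finset.range N).filter fun h => y h = f.eval (x h)).image x) ?_ ?_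
    · intro a ha
      obtain ⟨h, hh, rfl⟩ := Finset.mem_image.1 ha
      rw [Finset.mem_filter, Finset.mem_range] at hh
      have := H.vanish s hs2 h hh.1
      rw [eval_add, eval_mul, ← hh.2, ← this]
      ring
    · rw [Finset.card_image_of_injOn (hx.mono (Finset.coe_subset.2 (Finset.filter_subset _ _)))]
      have := natDegree_add_le_of_degree_le (H.natDegree_fst s hs2) hBf
      simp only [ne_eq] at hy
      omega
  -- If `B` were zero, so would be `A`, against the nonzero determinant.
  have hB : B s ≠ 0 := by
    intro hB
    have hA : A s = 0 := by rwa [hB, zero_mul, add_zero] at hzero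
    refine H.det_ne ?_
    rcases hs with ⟨rfl, h⟩ | ⟨rfl, h⟩ <;> simp [hA, hB]
  set good := (Finset.range N).filter fun h => ¬ (B s).eval (x h) = 0 with hgood
  have hyg : ∀ h ∈ good, y h = f.eval (x h) := by
    intro h hh
    rw [hgood, Finset.mem_filter, Finset.mem_range] at hh
    have h1 := H.vanish s hs2 h hh.1
    have h2 := congrArg (eval (x h)) hzero
    rw [eval_add, eval_mul, eval_zero] at h2
    refine mul_left_cancel₀ hh.2 ?_
    linear_combination h1 - h2
  have hxg : Set.InjOn x good := hx.mono (Finset.coe_subset.2 (Finset.filter_subset _ _))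
  -- `B` has at most `δ s - (k - 1)` roots, and `δ s ≤ N - 1` because `k ≤ N`.
  have hcard2 : k ≤ good.card := by
    have h1 := Finset.card_filter_add_card_filter_not (s := Finset.range N)
      (p := fun h => (B s).eval (x h) = 0)
    rw [Finset.card_range, ← hgood] at h1
    have h2 : ((Finset.range N).filter fun h => (B s).eval (x h) = 0).card ≤
        (B s).natDegree := by
      rw [← Finset.card_image_of_injOn (hx.mono (Finset.coe_subset.2 (Finset.filter_subset _ _)))]
      by_contra! h3
      refine hB (eq_zero_of_natDegree_lt_card_of_eval_eq_zero' _ _ ?_ h3)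
      intro a ha
      obtain ⟨h, hh, rfl⟩ := Finset.mem_image.1 ha
      exact (Finset.mem_filter.1 hh).2
    have h4 := H.natDegree_snd s hs2
    rw [natDegree_mul_X_pow _ hB] at h4
    omega
  have hint := Lagrange.eq_interpolate (v := x) (s := good) hxg
    (hf.trans_le (by exact_mod_cast hcard2))
  rw [hint, Lagrange.interpolate_apply, eval_finsetSum, hgood, Finset.sum_filter]
  refine Finset.sum_congr rfl fun g hg => ?_
  rw [ite_not]
  split_ifs with hBg
  · rfl
  have hgg : g ∈ good := Finset.mem_filter.2 ⟨hg, hBg⟩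
  rw [eval_mul, eval_C, ← hyg g hgg, ← hgood, Lagrange.basis, eval_prod,
    ← Finset.filter_ne', hgood, Finset.filter_filter, Finset.prod_filter]
  congr 1
  refine Finset.prod_congr rfl fun h _ => ?_
  by_cases hh : eval (x h) (B s) = 0 ∨ h = g
  · rw [if_pos hh, if_neg (by tauto)]
  · rw [if_neg hh, if_pos (by tauto), Lagrange.basisDivisor, eval_mul, eval_C, eval_sub, eval_X,
      eval_C]
    ring

end Decoding

end RPS

namespace RPS

/-! ### Reasoning about programs -/

@[simp] theorem State.reg_set (s : State) (x v y : ℕ) :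
    (s.set x v).reg y = if y = x then v else s.reg y := by
  simp [State.set, Function.update_apply]

@[simp] theorem State.arr_set (s : State) (x v : ℕ) : (s.set x v).arr = s.arr := rfl

@[simp] theorem State.reg_setArr (s : State) (A y z v : ℕ) : (s.setArr A y z v).reg = s.reg := rfl

@[simp] theorem State.arr_setArr (s : State) (A y z v A' y' z' : ℕ) :
    (s.setArr A y z v).arr A' y' z' = if A' = A ∧ y' = y ∧ z' = z then v else s.arr A' y' z' := by
  simp only [State.setArr, Function.update_apply]
  by_cases h1 : A' = A <;> by_cases h2 : y' = y <;> by_cases h3 : z' = z <;>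
    simp [h1, h2, h3]

theorem State.arr_setArr_of_ne (s : State) {A A' : ℕ} (y z v : ℕ) (h : A' ≠ A) :
    (s.setArr A y z v).arr A' = s.arr A' := by
  simp [State.setArr, h]

/-- The registers that an instruction may change. -/
def Instr.regs : Instr → List ℕ
  | .const x _ | .add x _ _ | .sub x _ _ | .half x _ | .load x _ _ _ => [x]
  | .store _ _ _ _ => []
  | .fzero x | .fone x | .fadd x _ _ | .fsub x _ _ | .fmul x _ _ | .fdiv x _ _ => [x]

/-- The arrays that an instruction may change. -/
def Instr.arrs : Instr → List ℕ
  | .store A _ _ _ => [A]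
  | _ => []

namespace Prog

/-- The registers that a program may change. -/
def regs : Prog → List ℕ
  | skip => []
  | instr I => I.regs
  | seq P Q => P.regs ++ Q.regs
  | ifLe _ _ P Q => P.regs ++ Q.regs
  | loop i _ P => i :: P.regs

/-- The arrays that a program may change. -/
def arrs : Prog → List ℕ
  | skip => []
  | instr I => I.arrs
  | seq P Q => P.arrs ++ Q.arrs
  | ifLe _ _ P Q => P.arrs ++ Q.arrs
  | loop _ _ P => P.arrs

/-- The registers that hold the numbers of rounds of the loops of a program. -/
def counters : Prog → List ℕ
  | skip => []
  | instr _ => []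
  | seq P Q => P.counters ++ Q.counters
  | ifLe _ _ P Q => P.counters ++ Q.counters
  | loop _ x P => x :: P.counters

/-- A bound for the number of steps of a program that does not change its counters, when these
have the values `v`. -/
def bound (m : ℕ) (v : ℕ → ℕ) : Prog → ℕ
  | skip => 0
  | instr I => I.cost m
  | seq P Q => P.bound m v + Q.bound m v
  | ifLe _ _ P Q => P.bound m v + Q.bound m v + 1
  | loop _ x P => 1 + v x * (P.bound m v + 1)

/-- `P` if the registers `x` and `y` agree, otherwise `Q` -/
def ifEq (x y : ℕ) (P Q : Prog) : Prog := ifLe x y (ifLe y x P Q) Q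

variable {F : Type*} [Field F] (D : Construction F)

/-- The final state of a run. -/
def exec (P : Prog) (s : State) : State := (P.run D s).1

variable {D}

@[simp] theorem exec_skip (s : State) : skip.exec D s = s := rfl

@[simp] theorem exec_instr (I : Instr) (s : State) : (instr I).exec D s = I.exec D s := rfl

@[simp] theorem exec_seq (P Q : Prog) (s : State) :
    (seq P Q).exec D s = Q.exec D (P.exec D s) := rfl

@[simp] theorem exec_ifLe (x y : ℕ) (P Q : Prog) (s : State) :
    (ifLe x y P Q).exec D s = if s.reg x ≤ s.reg y then P.exec D s else Q.exec D s := by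
  rw [exec, run]
  split_ifs <;> rfl

@[simp] theorem exec_ifEq (x y : ℕ) (P Q : Prog) (s : State) :
    (ifEq x y P Q).exec D s = if s.reg x = s.reg y then P.exec D s else Q.exec D s := by
  rw [ifEq, exec_ifLe, exec_ifLe]
  split_ifs <;> first | rfl | omega

/-- The number of rounds is fixed on entry, so the body may do anything to the register `x`. The
invariant covers the state and the step count together. -/
theorem run_loop_induct {i x : ℕ} {P : Prog} {s : State} (I : ℕ → State × ℕ → Prop)
    (h0 : I 0 (s, 1)) (hs : ∀ j < s.reg x, ∀ t, I j t →
      I (j + 1) (P.exec D (t.1.set i j), t.2 + (P.run D (t.1.set i j)).2 + 1)) :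
    I (s.reg x) ((loop i x P).run D s) := by
  rw [run]
  have key : ∀ N ≤ s.reg x, I N ((List.range N).foldl (fun t j =>
      ((P.run D (t.1.set i j)).1, t.2 + (P.run D (t.1.set i j)).2 + 1)) (s, 1)) := by
    intro N
    induction N with
    | zero => exact fun _ => h0
    | succ N ih =>
      intro hN
      rw [List.range_succ, List.foldl_append]
      exact hs N hN _ (ih (by omega))
  exact key _ le_rfl

/-- The frame rule. Register and array numbers are part of the program text, so for concrete
programs its side conditions are settled by `decide`. -/
theorem reg_arr_exec (P : Prog) (s : State) :
    (∀ y, y ∉ P.regs → (P.exec D s).reg y = s.reg y) ∧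
      ∀ A, A ∉ P.arrs → (P.exec D s).arr A = s.arr A := by
  induction P generalizing s with
  | skip => exact ⟨fun _ _ => rfl, fun _ _ => rfl⟩
  | instr I =>
    rw [exec_instr]
    cases I <;>
      simp +contextual [regs, arrs, Instr.regs, Instr.arrs, Instr.exec, State.arr_setArr_of_ne]
  | seq P Q hP hQ =>
    rw [exec_seq]
    refine ⟨fun y hy => ?_, fun A hA => ?_⟩
    · rw [regs, List.mem_append, not_or] at hy
      rw [(hQ _).1 y hy.2, (hP _).1 y hy.1]
    · rw [arrs, List.mem_append, not_or] at hA
      rw [(hQ _).2 A hA.2, (hP _).2 A hA.1]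
  | ifLe x y P Q hP hQ =>
    rw [exec_ifLe]
    refine ⟨fun y hy => ?_, fun A hA => ?_⟩
    · rw [regs, List.mem_append, not_or] at hy
      split_ifs
      · exact (hP _).1 _ hy.1
      · exact (hQ _).1 _ hy.2
    · rw [arrs, List.mem_append, not_or] at hA
      split_ifs
      · exact (hP _).2 A hA.1
      · exact (hQ _).2 A hA.2
  | loop i x P hP =>
    refine run_loop_induct (I := fun _ t => (∀ y, y ∉ (loop i x P).regs → t.1.reg y = s.reg y) ∧
      ∀ A, A ∉ (loop i x P).arrs → t.1.arr A = s.arr A) ⟨fun _ _ => rfl, fun _ _ => rfl⟩ ?_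
    rintro j - t ⟨h1, h2⟩
    refine ⟨fun y hy => ?_, fun A hA => ?_⟩
    · have hy' := hy
      rw [regs, List.mem_cons, not_or] at hy
      rw [(hP _).1 y hy.2, State.reg_set, if_neg hy.1, h1 y hy']
    · rw [(hP _).2 A hA, State.arr_set, h2 A hA]

theorem reg_exec {P : Prog} (s : State) {y : ℕ} (h : y ∉ P.regs) :
    (P.exec D s).reg y = s.reg y := (reg_arr_exec P s).1 y h

theorem arr_exec {P : Prog} (s : State) {A : ℕ} (h : A ∉ P.arrs) :
    (P.exec D s).arr A = s.arr A := (reg_arr_exec P s).2 A h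

/-- The loop rule with the frame facts built in, so that invariants mention only what the body
changes. -/
theorem exec_loop_induct {i x : ℕ} {P : Prog} {s : State} (I : ℕ → State → Prop) (h0 : I 0 s)
    (hs : ∀ j < s.reg x, ∀ t : State, (∀ y, y ∉ (loop i x P).regs → t.reg y = s.reg y) →
      (∀ A, A ∉ (loop i x P).arrs → t.arr A = s.arr A) → I j t →
      I (j + 1) (P.exec D (t.set i j))) :
    I (s.reg x) ((loop i x P).exec D s) := by
  refine (run_loop_induct (I := fun j t =>
    ((∀ y, y ∉ (loop i x P).regs → t.1.reg y = s.reg y) ∧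
      ∀ A, A ∉ (loop i x P).arrs → t.1.arr A = s.arr A) ∧ I j t.1)
      ⟨⟨fun _ _ => rfl, fun _ _ => rfl⟩, h0⟩ ?_).2
  rintro j hj t ⟨⟨h1, h2⟩, h3⟩
  refine ⟨⟨fun y hy => ?_, fun A hA => ?_⟩, hs j hj t.1 h1 h2 h3⟩
  · have hy' := hy
    rw [regs, List.mem_cons, not_or] at hy
    rw [reg_exec _ hy.2, State.reg_set, if_neg hy.1, h1 y hy']
  · have hA' : A ∉ P.arrs := hA
    rw [arr_exec _ hA', State.arr_set, h2 A hA]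

/-- If a program never writes to a loop counter, all numbers of rounds can be read from the initial
state. Programs that compute a counter are therefore timed in segments. -/
theorem run_le_bound {P : Prog} (h : ∀ x ∈ P.counters, x ∉ P.regs) {s : State} {v : ℕ → ℕ}
    (hv : ∀ x ∈ P.counters, s.reg x = v x) : (P.run D s).2 ≤ P.bound D.m v := by
  induction P generalizing s with
  | skip => exact le_rfl
  | instr I => exact le_rfl
  | seq P Q hP hQ =>
    simp only [counters, regs, List.mem_append, not_or] at h hv
    exact Nat.add_le_add (hP (fun x hx => (h x (Or.inl hx)).1) fun x hx => hv x (Or.inl hx))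
      (hQ (fun x hx => (h x (Or.inr hx)).2) fun x hx => by
        rw [← hv x (Or.inr hx)]
        exact reg_exec _ (h x (Or.inr hx)).1)
  | ifLe x y P Q hP hQ =>
    simp only [counters, regs, List.mem_append, not_or] at h hv
    have h1 := hP (fun x hx => (h x (Or.inl hx)).1) fun x hx => hv x (Or.inl hx)
    have h2 := hQ (fun x hx => (h x (Or.inr hx)).2) fun x hx => hv x (Or.inr hx)
    rw [run, bound]
    split_ifs <;> simp only <;> omega
  | loop i x P hP =>
    have key := run_loop_induct (D := D) (i := i) (x := x) (P := P) (s := s)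
      (I := fun j t => (∀ y ∈ P.counters, t.1.reg y = v y) ∧
        t.2 ≤ 1 + j * (P.bound D.m v + 1)) ⟨fun y hy => hv y (List.mem_cons_of_mem _ hy), by simp⟩ ?_
    · rw [bound, ← hv x List.mem_cons_self]
      exact key.2
    · rintro j - t ⟨h1, h2⟩
      simp only [counters, regs, List.mem_cons, not_or] at h
      have h3 : ∀ y ∈ P.counters, (t.1.set i j).reg y = v y := fun y hy => by
        rw [State.reg_set, if_neg (h y (Or.inr hy)).1, h1 y hy]
      refine ⟨fun y hy => ?_, ?_⟩
      · rw [reg_exec _ (h y (Or.inr hy)).2, h3 y hy]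
      · have h4 := hP (fun y hy => (h y (Or.inr hy)).2) h3
        simp only
        rw [add_mul, one_mul]
        omega

end Prog
end RPS

/-! ### Machine words and the input -/

namespace RPS

/-- The number with binary digits `f`. -/
def ofBits {m : ℕ} (f : Fin m → ZMod 2) : ℕ := ∑ b, (f b).val * 2 ^ (b : ℕ)

theorem ofBits_succ {m : ℕ} (f : Fin (m + 1) → ZMod 2) :
    ofBits f = (f 0).val + 2 * ofBits fun b => f b.succ := by
  rw [ofBits, Fin.sum_univ_succ, ofBits, Finset.mul_sum]
  simp only [Fin.val_zero, pow_zero, mul_one, Fin.val_succ]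
  congr 1
  exact Finset.sum_congr rfl fun b _ => by ring

theorem ofBits_lt {m : ℕ} (f : Fin m → ZMod 2) : ofBits f < 2 ^ m := by
  induction m with
  | zero => simp [ofBits]
  | succ m ih =>
    rw [ofBits_succ, pow_succ]
    have h1 := ih fun b => f b.succ
    have h2 := ZMod.val_lt (f 0)
    omega

theorem ofBits_div {m : ℕ} (f : Fin m → ZMod 2) (b : Fin m) :
    ((ofBits f / 2 ^ (b : ℕ) : ℕ) : ZMod 2) = f b := by
  induction m with
  | zero => exact b.elim0
  | succ m ih =>
    rw [ofBits_succ]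
    have h2 := ZMod.val_lt (f 0)
    refine Fin.cases ?_ (fun b => ?_) b
    · have : (2 : ZMod 2) = 0 := rfl
      simp [this]
    · rw [Fin.val_succ, pow_succ', ← Nat.div_div_eq_div_mul, Nat.add_mul_div_left _ _ two_pos,
        Nat.div_eq_of_lt h2, zero_add, ih]

theorem ofBits_eq_sum_range {m : ℕ} (f : Fin m → ZMod 2) (g : ℕ → ℕ)
    (h : ∀ b : Fin m, (f b).val = g b) :
    ofBits f = ∑ b ∈ Finset.range m, g b * 2 ^ b := by
  rw [ofBits, Finset.sum_range]
  exact Finset.sum_congr rfl fun b _ => by rw [h]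

namespace Construction

variable {F : Type*} (D : Construction F)

@[simp] theorem elt_code (a : F) : D.elt (D.code a) = a := by
  rw [elt, Equiv.symm_apply_eq]
  exact funext fun b => ofBits_div (D.φ a) b

theorem code_injective : Function.Injective D.code :=
  Function.LeftInverse.injective D.elt_code

@[simp] theorem code_inj {a b : F} : D.code a = D.code b ↔ a = b := D.code_injective.eq_iff

theorem code_lt (a : F) : D.code a < 2 ^ D.m := ofBits_lt _

end Construction

/-! ### The input -/

/-- The registers and arrays of `s` hold the input. -/
structure Input {F : Type*} (D : Construction F) (ρ : Fin D.r ≃ D.X) (w : Fin D.n → ZMod 2)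
    (s : State) : Prop where
  n : s.reg 0 = D.n
  d : s.reg 1 = D.d
  m : s.reg 2 = D.m
  kR : s.reg 3 = D.kR
  lp : s.reg 4 = D.lp
  r : s.reg 5 = D.r
  zero : s.reg 8 = 0
  one : s.reg 9 = 1
  letters : ∀ t < D.n, s.arr 0 t 0 = (Construction.cyc w t).val
  points : ∀ j : Fin D.nR, s.arr 1 j 0 = D.code (D.x j)
  marker : ∀ t, s.arr 2 t 0 = (D.p.getD t 0).val
  numbers : ∀ a : D.X, s.arr 3 (D.code a) 0 = ρ.symm a

theorem input_initState {F : Type*} (D : Construction F) (ρ : Fin D.r ≃ D.X)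
    (w : Fin D.n → ZMod 2) : Input D ρ w ((initState D ρ w).set 9 1) where
  n := rfl
  d := rfl
  m := rfl
  kR := rfl
  lp := rfl
  r := rfl
  zero := rfl
  one := rfl
  letters t ht := by simp [initState, ht, Construction.cyc_lt w ht]
  points j := by
    simp only [initState, State.arr_set]
    rw [if_neg (by simp), dif_pos j.isLt]
  marker t := by simp [initState]
  numbers a := by
    have h : D.code a < 2 ^ D.m ∧ D.d ≤ hammingNorm (D.φ (D.elt (D.code (a : F)))) :=
      ⟨D.code_lt _, by rw [Construction.elt_code]; exact a.2⟩
    simp only [initState, State.arr_set]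
    rw [if_neg (by simp), dif_pos h]
    congr 2
    ext
    simp

/-- The registers that hold the numbers of the input and the constants `0` and `1`. -/
def inputRegs : List ℕ := [0, 1, 2, 3, 4, 5, 8, 9]

/-- The arrays of the input. -/
def inputArrs : List ℕ := [0, 1, 2, 3]

theorem Input.of_eq {F : Type*} {D : Construction F} {ρ : Fin D.r ≃ D.X}
    {w : Fin D.n → ZMod 2} {s t : State} (h : Input D ρ w s)
    (hr : ∀ x ∈ inputRegs, t.reg x = s.reg x) (ha : ∀ A ∈ inputArrs, t.arr A = s.arr A) :
    Input D ρ w t := by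
  constructor
  · rw [hr 0 (by decide), h.n]
  · rw [hr 1 (by decide), h.d]
  · rw [hr 2 (by decide), h.m]
  · rw [hr 3 (by decide), h.kR]
  · rw [hr 4 (by decide), h.lp]
  · rw [hr 5 (by decide), h.r]
  · rw [hr 8 (by decide), h.zero]
  · rw [hr 9 (by decide), h.one]
  · rw [ha 0 (by decide)]; exact h.letters
  · rw [ha 1 (by decide)]; exact h.points
  · rw [ha 2 (by decide)]; exact h.marker
  · rw [ha 3 (by decide)]; exact h.numbers

theorem Input.exec {F : Type*} [Field F] {D : Construction F} {ρ : Fin D.r ≃ D.X}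
    {w : Fin D.n → ZMod 2} {s : State} (h : Input D ρ w s) (P : Prog)
    (hr : ∀ x ∈ inputRegs, x ∉ P.regs) (ha : ∀ A ∈ inputArrs, A ∉ P.arrs) :
    Input D ρ w (P.exec D s) :=
  h.of_eq (fun x hx => Prog.reg_exec _ (hr x hx)) fun A hA => Prog.arr_exec _ (ha A hA)

/-! ### Locating the marker -/

namespace Prog

open Instr

/-- Writes the received word twice in a row to array `6`. -/
def doubleWord : Prog :=
  loop 10 0 (seq (instr (load 11 0 10 8)) (seq (instr (store 6 10 8 11))
    (seq (instr (add 12 10 0)) (instr (store 6 12 8 11)))))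

/-- Register `13` becomes the number of disagreements between the marker and the subword at the
position in register `10`. -/
def countErrors : Prog :=
  seq (instr (const 13 0)) (loop 11 4 (seq (instr (add 12 10 11)) (seq (instr (load 14 6 12 8))
    (seq (instr (load 15 2 11 8)) (ifEq 14 15 skip (instr (add 13 13 9)))))))

/-- Register `6` becomes the position of the marker. -/
def findMarker : Prog :=
  loop 10 0 (seq countErrors (seq (instr (add 13 13 13)) (seq (instr (add 13 13 9))
    (ifLe 13 1 (instr (add 6 10 8)) skip))))

/-- Doubles the word and finds the marker. -/
def markerProg : Prog := seq (instr (const 9 1)) (seq doubleWord findMarker)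

variable {F : Type*} [Field F] {D : Construction F} {ρ : Fin D.r ≃ D.X} {w : Fin D.n → ZMod 2}
  {s : State}

/-- Array `6` holds the received word, twice in a row. -/
def Doubled (D : Construction F) (w : Fin D.n → ZMod 2) (s : State) : Prop :=
  ∀ t < 2 * D.n, s.arr 6 t 0 = (Construction.cyc w t).val

/-- With two copies in a row, a cyclic read at offset plus position stays below `2 n` and needs no
reduction modulo `n`. -/
theorem doubled_doubleWord (h : Input D ρ w s) : Doubled D w (doubleWord.exec D s) := by
  have key := exec_loop_induct (D := D) (s := s) (i := 10) (x := 0)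
    (P := (seq (instr (load 11 0 10 8)) (seq (instr (store 6 10 8 11))
    (seq (instr (add 12 10 0)) (instr (store 6 12 8 11))))))
    (fun j t => ∀ i < j, t.arr 6 i 0 = s.arr 0 i 0 ∧ t.arr 6 (i + D.n) 0 = s.arr 0 i 0)
    (by simp) ?_
  · rw [h.n] at key
    intro t ht
    rcases Nat.lt_or_ge t D.n with h1 | h1
    · rw [← h.letters t h1]
      exact (key t h1).1
    · obtain ⟨i, rfl⟩ : ∃ i, t = i + D.n := ⟨t - D.n, by omega⟩
      rw [Construction.cyc_congr w (Nat.add_mod_right i D.n), ← h.letters i (by omega)]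
      exact (key i (by omega)).2
  · intro j hj t hr ha hI i hi
    have r0 := hr 0 (by decide)
    have r8 := hr 8 (by decide)
    have a0 := ha 0 (by decide)
    rw [h.n] at hj
    simp only [exec_seq, exec_instr, Instr.exec, State.reg_set, State.arr_set, State.arr_setArr,
      State.reg_setArr, r0, r8, a0, h.n, h.zero]
    norm_num
    by_cases hij : i = j
    · subst hij
      simp
    · have := hI i (by omega)
      simp [hij, this, show i ≠ j + D.n by omega, show i + D.n ≠ j by omega]

theorem val_eq_val_iff {a b : ZMod 2} : a.val = b.val ↔ a = b := (ZMod.val_injective 2).eq_iff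

theorem reg_countErrors (h : Input D ρ w s) (hw : Doubled D w s) (hi : s.reg 10 < D.n) :
    (countErrors.exec D s).reg 13 = D.markerDist w (s.reg 10) := by
  have hlp := D.lp_lt_n
  rw [countErrors, exec_seq]
  set s' := (instr (const 13 0)).exec D s with hs'
  have key := exec_loop_induct (D := D) (s := s') (i := 11) (x := 4)
    (P := seq (instr (add 12 10 11)) (seq (instr (load 14 6 12 8))
      (seq (instr (load 15 2 11 8)) (ifEq 14 15 skip (instr (add 13 13 9))))))
    (fun j t => t.reg 13 = ∑ x ∈ Finset.range j,
      if Construction.cyc w (s.reg 10 + x) ≠ D.p.getD x 0 then 1 else 0)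
    (by simp [hs', Instr.exec]) ?_
  · rw [show s'.reg 4 = D.lp by simp [hs', Instr.exec, h.lp]] at key
    rw [key, Construction.markerDist, hammingDist, Finset.card_filter, Finset.sum_range]
  · intro j hj t hr ha hI
    rw [show s'.reg 4 = D.lp by simp [hs', Instr.exec, h.lp]] at hj
    have r10 : t.reg 10 = s.reg 10 := by rw [hr 10 (by decide)]; simp [hs', Instr.exec]
    have r8 : t.reg 8 = 0 := by rw [hr 8 (by decide)]; simp [hs', Instr.exec, h.zero]
    have r9 : t.reg 9 = 1 := by rw [hr 9 (by decide)]; simp [hs', Instr.exec, h.one]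
    have a6 : t.arr 6 (s.reg 10 + j) 0 = (Construction.cyc w (s.reg 10 + j)).val := by
      rw [ha 6 (by decide)]; exact hw _ (by omega)
    have a2 : t.arr 2 j 0 = (D.p.getD j 0).val := by
      rw [ha 2 (by decide)]; exact h.marker j
    rw [Finset.sum_range_succ, ← hI]
    simp only [exec_seq, exec_instr, exec_ifEq, exec_skip, Instr.exec]
    simp only [State.reg_set, State.arr_set, r10, r8, r9, a6, a2, val_eq_val_iff, reduceIte,
      Nat.reduceEqDiff]
    split_ifs <;> simp_all

theorem reg_findMarker (h : Input D ρ w s) (hw : Doubled D w s) {o : ℕ}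
    (ho : ∀ i, D.IsOffset w i ↔ i = o) : (findMarker.exec D s).reg 6 = o := by
  have key := exec_loop_induct (D := D) (s := s) (i := 10) (x := 0)
    (P := (seq countErrors (seq (instr (add 13 13 13)) (seq (instr (add 13 13 9))
      (ifLe 13 1 (instr (add 6 10 8)) skip)))))
    -- Nothing is claimed before round `o`; afterwards the register is kept because no other
    -- position passes the test.
    (fun j t => o < j → t.reg 6 = o) (by simp) ?_
  · rw [h.n] at key
    exact key ((ho o).2 rfl).1
  · intro j hj t hr ha hI hoj
    rw [h.n] at hj
    have ht : Input D ρ w (t.set 10 j) := h.of_eq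
      (fun x hx => by
        rw [State.reg_set, if_neg (by rintro rfl; revert hx; decide)]
        exact hr x (by revert x; decide))
      fun A hA => ha A (by revert A; decide)
    have htw : Doubled D w (t.set 10 j) := fun i hi => by
      rw [State.arr_set, ha 6 (by decide)]; exact hw i hi
    have hc := reg_countErrors ht htw (by simpa using hj)
    have hf := fun x hx => reg_exec (D := D) (P := countErrors) (t.set 10 j) (y := x) hx
    have f1 := hf 1 (by decide)
    have f6 := hf 6 (by decide)
    have f8 := hf 8 (by decide)
    have f9 := hf 9 (by decide)
    have f10 := hf 10 (by decide)
    rw [ht.d] at f1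
    rw [ht.zero] at f8
    rw [ht.one] at f9
    rw [State.reg_set, if_pos rfl] at hc f10
    have hiff : D.markerDist w j + D.markerDist w j + 1 ≤ D.d ↔ j = o := by
      rw [← ho j, Construction.IsOffset]
      constructor
      · intro h1; exact ⟨hj, by omega⟩
      · rintro ⟨-, h1⟩; omega
    simp only [exec_seq, exec_instr, exec_ifLe, exec_skip, Instr.exec]
    simp only [State.reg_set, hc, f1, f8, f9, f10, reduceIte, Nat.reduceEqDiff, hiff]
    split_ifs with h1
    · simp [h1]
    · simpa [f6] using hI (by omega)

theorem markerProg_spec {o : ℕ} (ho : ∀ i, D.IsOffset w i ↔ i = o) :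
    Input D ρ w (markerProg.exec D (initState D ρ w)) ∧
      Doubled D w (markerProg.exec D (initState D ρ w)) ∧
      (markerProg.exec D (initState D ρ w)).reg 6 = o := by
  rw [markerProg, exec_seq, exec_seq]
  have h := input_initState D ρ w
  set s := (initState D ρ w).set 9 1 with hs
  rw [show (instr (const 9 1)).exec D (initState D ρ w) = s from rfl]
  have h2 := h.exec doubleWord (by decide) (by decide)
  have hw := doubled_doubleWord h
  refine ⟨h2.exec findMarker (by decide) (by decide), ?_, reg_findMarker h2 hw ho⟩
  rw [Doubled, arr_exec _ (show 6 ∉ findMarker.arrs by decide)]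
  exact hw

theorem cost_markerProg : (markerProg.run D (initState D ρ w)).2 ≤ 30 * D.n ^ 3 := by
  refine (run_le_bound (by decide) fun _ _ => rfl).trans ?_
  have hn := D.lp_lt_n
  simp only [markerProg, doubleWord, findMarker, countErrors, ifEq, bound, Instr.cost]
  have h0 : (initState D ρ w).reg 0 = D.n := rfl
  have h4 : (initState D ρ w).reg 4 = D.lp := rfl
  rw [h0, h4]
  have h1 : D.lp ≤ D.n := hn.le
  have h2 : 1 ≤ D.n := by omega
  have h3 : D.n * D.lp ≤ D.n ^ 2 := by rw [sq]; exact Nat.mul_le_mul_left _ h1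
  nlinarith [Nat.mul_le_mul_left (D.n ^ 2) h2, Nat.mul_le_mul_left D.n h2]

end Prog
end RPS

namespace RPS
namespace Prog

open Instr

/-! ### Reading the symbols -/

/-- Register `17` becomes the number whose binary digits begin at the position in register `16`,
and this position is moved behind them. -/
def readSymbol : Prog :=
  seq (instr (const 17 0)) (seq (instr (const 18 1)) (loop 11 2 (seq (instr (load 14 6 16 8))
    (seq (ifLe 9 14 (instr (add 17 17 18)) skip) (seq (instr (add 18 18 18))
      (instr (add 16 16 9)))))))

/-- Reads the information symbols. -/
def readInfo : Prog := loop 10 3 (seq readSymbol (instr (store 4 10 8 17)))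

/-- Reads the parity symbols. -/
def readParity : Prog :=
  loop 10 19 (seq (instr (add 16 16 1)) (seq readSymbol (seq (instr (add 20 10 3))
    (instr (store 4 20 8 17)))))

/-- Register `19` becomes `2 d + 2`. -/
def parityCount : Prog :=
  seq (instr (add 19 1 1)) (seq (instr (add 19 19 9)) (instr (add 19 19 9)))

/-- Reads all symbols behind the marker. -/
def symbolsProg : Prog :=
  seq (seq (instr (add 16 6 4)) parityCount) (seq readInfo readParity)

/-- The bound `n_R m ≤ n` is the one that later absorbs the cost `m^2` of field instructions. -/
theorem size_bounds {F : Type*} (D : Construction F) (hd : 0 < D.d) : D.d + 1 ≤ D.n ∧ 1 ≤ D.m ∧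
    D.kR ≤ D.n ∧ D.nR ≤ D.n ∧ D.nR * D.m ≤ D.n := by
  have h1 := D.d_le_m
  have h3 : D.nR * D.m ≤ D.n := by
    rw [Construction.n, mul_comm]; omega
  have h4 : D.nR ≤ D.nR * D.m := Nat.le_mul_of_pos_right _ (by omega)
  refine ⟨?_, ?_, ?_, ?_, h3⟩ <;> unfold Construction.nR at * <;> omega

variable {F : Type*} [Field F] {D : Construction F} {ρ : Fin D.r ≃ D.X} {w : Fin D.n → ZMod 2}
  {s : State}

theorem readSymbol_spec (h : Input D ρ w s) (f : Fin D.m → ZMod 2)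
    (hf : ∀ b : Fin D.m, s.arr 6 (s.reg 16 + b) 0 = (f b).val) :
    (readSymbol.exec D s).reg 17 = ofBits f ∧
      (readSymbol.exec D s).reg 16 = s.reg 16 + D.m := by
  rw [readSymbol, exec_seq, exec_seq]
  set s' := (instr (const 18 1)).exec D ((instr (const 17 0)).exec D s) with hs'
  have key := exec_loop_induct (D := D) (s := s') (i := 11) (x := 2)
    (P := seq (instr (load 14 6 16 8))
      (seq (ifLe 9 14 (instr (add 17 17 18)) skip) (seq (instr (add 18 18 18))
      (instr (add 16 16 9)))))
    (fun j t => t.reg 16 = s.reg 16 + j ∧ t.reg 18 = 2 ^ j ∧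
      t.reg 17 = ∑ b ∈ Finset.range j, s.arr 6 (s.reg 16 + b) 0 * 2 ^ b)
    (by simp [hs', Instr.exec]) ?_
  · rw [show s'.reg 2 = D.m by simp [hs', Instr.exec, h.m]] at key
    refine ⟨?_, key.1⟩
    rw [key.2.2, ofBits_eq_sum_range f (fun b => s.arr 6 (s.reg 16 + b) 0) fun b => (hf b).symm]
  · rintro j hj t hr ha ⟨I1, I2, I3⟩
    rw [show s'.reg 2 = D.m by simp [hs', Instr.exec, h.m]] at hj
    have r8 : t.reg 8 = 0 := by rw [hr 8 (by decide)]; simp [hs', Instr.exec, h.zero]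
    have r9 : t.reg 9 = 1 := by rw [hr 9 (by decide)]; simp [hs', Instr.exec, h.one]
    have a6 : t.arr 6 = s.arr 6 := ha 6 (by decide)
    have hb := hf ⟨j, hj⟩
    simp only at hb
    have hlt := ZMod.val_lt (f ⟨j, hj⟩)
    rw [← hb] at hlt
    rw [Finset.sum_range_succ, ← I3]
    simp only [exec_seq, exec_instr, exec_ifLe, exec_skip, Instr.exec]
    simp only [State.reg_set, State.arr_set, I1, I2, r8, r9, a6, reduceIte, Nat.reduceEqDiff]
    generalize s.arr 6 (s.reg 16 + j) 0 = v at *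
    obtain rfl | rfl : v = 0 ∨ v = 1 := by omega
    · simp [I1, I2, r9]; omega
    · simp [I1, I2, r9]; omega

theorem readCode (h : Input D ρ w s) (hw : Doubled D w s) (j : Fin D.nR)
    (hj : s.reg 16 = D.offset w + D.pos j 0) (ho : D.offset w < D.n) :
    (readSymbol.exec D s).reg 17 = D.code (D.cbar w j) ∧
      (readSymbol.exec D s).reg 16 = s.reg 16 + D.m := by
  refine readSymbol_spec h (D.φ (D.cbar w j)) fun b => ?_
  have hpos : D.pos j b = D.pos j 0 + b := by
    unfold Construction.pos
    split_ifs <;> omega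
  have := Construction.pos_lt j.isLt b.isLt
  rw [Construction.φ_cbar, Construction.rotated, hpos, hj, hw _ (by omega), add_assoc]

theorem readInfo_spec (h : Input D ρ w s) (hw : Doubled D w s) (ho : D.offset w < D.n)
    (hs : s.reg 16 = D.offset w + D.lp) :
    (readInfo.exec D s).reg 16 = D.offset w + D.lp + D.m * D.kR ∧
      ∀ j : Fin D.nR, (j : ℕ) < D.kR → (readInfo.exec D s).arr 4 j 0 = D.code (D.cbar w j) := by
  have key := exec_loop_induct (D := D) (s := s) (i := 10) (x := 3)
    (P := seq readSymbol (instr (store 4 10 8 17)))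
    (fun j t => t.reg 16 = D.offset w + D.lp + D.m * j ∧
      ∀ i : Fin D.nR, (i : ℕ) < j → t.arr 4 i 0 = D.code (D.cbar w i)) (by simp [hs]) ?_
  · rwa [h.kR] at key
  · rintro j hj t hr ha ⟨I1, I2⟩
    rw [h.kR] at hj
    have ht : Input D ρ w (t.set 10 j) := h.of_eq
      (fun x hx => by
        rw [State.reg_set, if_neg (by rintro rfl; revert hx; decide)]
        exact hr x (by revert x; decide))
      fun A hA => ha A (by revert A; decide)
    have htw : Doubled D w (t.set 10 j) := fun i hi => by
      rw [State.arr_set, ha 6 (by decide)]; exact hw i hi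
    have hjn : j < D.nR := by unfold Construction.nR; omega
    obtain ⟨c1, c2⟩ := readCode ht htw ⟨j, hjn⟩ (by
      simp only [State.reg_set, Nat.reduceEqDiff, reduceIte, I1, Construction.pos, if_pos hj]
      ring) ho
    have f8 := reg_exec (D := D) (P := readSymbol) (t.set 10 j) (y := 8) (by decide)
    have f10 := reg_exec (D := D) (P := readSymbol) (t.set 10 j) (y := 10) (by decide)
    have f4 := arr_exec (D := D) (P := readSymbol) (t.set 10 j) (A := 4) (by decide)
    rw [ht.zero] at f8
    simp only [State.reg_set, State.arr_set, Nat.reduceEqDiff, reduceIte, I1] at c2 f10 f4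
    simp only [exec_seq, exec_instr, Instr.exec, State.reg_setArr, State.arr_setArr, c1, c2, f8,
      f10, f4]
    refine ⟨by ring, fun i hi => ?_⟩
    split_ifs with h1
    · congr 2; ext; exact h1.2.1.symm
    · exact I2 i (by simp at h1; omega)

theorem readParity_spec (h : Input D ρ w s) (hw : Doubled D w s) (ho : D.offset w < D.n)
    (hs : s.reg 16 = D.offset w + D.lp + D.m * D.kR) (hc : s.reg 19 = 2 * D.d + 2)
    (hs4 : ∀ j : Fin D.nR, (j : ℕ) < D.kR → s.arr 4 j 0 = D.code (D.cbar w j)) :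
    ∀ j : Fin D.nR, (readParity.exec D s).arr 4 j 0 = D.code (D.cbar w j) := by
  have key := exec_loop_induct (D := D) (s := s) (i := 10) (x := 19)
    (P := seq (instr (add 16 16 1)) (seq readSymbol (seq (instr (add 20 10 3))
    (instr (store 4 20 8 17)))))
    (fun j t => t.reg 16 = D.offset w + D.lp + D.m * D.kR + (D.m + D.d) * j ∧
      ∀ i : Fin D.nR, (i : ℕ) < D.kR + j → t.arr 4 i 0 = D.code (D.cbar w i))
      (by simpa [hs] using hs4) ?_
  · rw [hc] at key
    exact fun j => key.2 j j.isLt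
  · rintro j hj t hr ha ⟨I1, I2⟩
    rw [hc] at hj
    rw [exec_seq]
    set t' := (instr (add 16 16 1)).exec D (t.set 10 j) with ht'
    have r1 : t.reg 1 = D.d := by rw [hr 1 (by decide), h.d]
    have ht : Input D ρ w t' := h.of_eq
      (fun x hx => by
        rw [ht', exec_instr, Instr.exec, State.reg_set, if_neg (by rintro rfl; revert hx; decide),
          State.reg_set, if_neg (by rintro rfl; revert hx; decide)]
        exact hr x (by revert x; decide))
      fun A hA => ha A (by revert A; decide)
    have htw : Doubled D w t' := fun i hi => by
      rw [ht', exec_instr, Instr.exec, State.arr_set, State.arr_set, ha 6 (by decide)]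
      exact hw i hi
    have hjn : D.kR + j < D.nR := by unfold Construction.nR; omega
    have t10 : t'.reg 10 = j := by simp [ht', Instr.exec]
    have t16 : t'.reg 16 = D.offset w + D.lp + D.m * D.kR + (D.m + D.d) * j + D.d := by
      simp [ht', Instr.exec, I1, r1]
    have t4 : t'.arr 4 = t.arr 4 := rfl
    obtain ⟨c1, c2⟩ := readCode ht htw ⟨D.kR + j, hjn⟩ (by
      rw [t16, Construction.pos, if_neg (by simp), Nat.add_sub_cancel_left]
      ring) ho
    have f8 := reg_exec (D := D) (P := readSymbol) t' (y := 8) (by decide)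
    have f3 := reg_exec (D := D) (P := readSymbol) t' (y := 3) (by decide)
    have f10 := reg_exec (D := D) (P := readSymbol) t' (y := 10) (by decide)
    have f4 := arr_exec (D := D) (P := readSymbol) t' (A := 4) (by decide)
    rw [ht.zero] at f8
    rw [ht.kR] at f3
    rw [t10] at f10
    rw [t16] at c2
    simp only [exec_seq, exec_instr, Instr.exec, State.reg_setArr, State.arr_setArr,
      State.reg_set, State.arr_set, Nat.reduceEqDiff, reduceIte, c1, c2, f8, f3, f10, f4, t4]
    refine ⟨by ring, fun i hi => ?_⟩
    split_ifs with h1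
    · congr 2; ext; simp only; omega
    · exact I2 i (by simp at h1; omega)

theorem symbolsProg_spec (h : Input D ρ w s) (hw : Doubled D w s) (ho : D.offset w < D.n)
    (hs : s.reg 6 = D.offset w) :
    Input D ρ w (symbolsProg.exec D s) ∧ (symbolsProg.exec D s).reg 6 = D.offset w ∧
      (symbolsProg.exec D s).reg 19 = 2 * D.d + 2 ∧
      ∀ j : Fin D.nR, (symbolsProg.exec D s).arr 4 j 0 = D.code (D.cbar w j) := by
  rw [symbolsProg, exec_seq, exec_seq]
  set s₁ := (seq (instr (add 16 6 4)) parityCount).exec D s with hs₁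
  have h₁ : Input D ρ w s₁ := h.exec _ (by decide) (by decide)
  have h16 : s₁.reg 16 = D.offset w + D.lp := by
    simp [hs₁, parityCount, Instr.exec, hs, h.lp]
  have h19 : s₁.reg 19 = 2 * D.d + 2 := by
    simp [hs₁, parityCount, Instr.exec, h.one, h.d]; ring
  have hw₁ : Doubled D w s₁ := hw
  obtain ⟨i1, i2⟩ := readInfo_spec h₁ hw₁ ho h16
  have h₂ : Input D ρ w (readInfo.exec D s₁) := h₁.exec _ (by decide) (by decide)
  have hw₂ : Doubled D w (readInfo.exec D s₁) := by
    rw [Doubled, arr_exec _ (show 6 ∉ readInfo.arrs by decide)]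
    exact hw₁
  have h19' : (readInfo.exec D s₁).reg 19 = 2 * D.d + 2 := by
    rw [reg_exec _ (by decide), h19]
  refine ⟨h₂.exec _ (by decide) (by decide), ?_, ?_, readParity_spec h₂ hw₂ ho i1 h19' i2⟩
  · rw [reg_exec _ (by decide), reg_exec _ (by decide), ← hs]
    simp [hs₁, parityCount, Instr.exec]
  · rw [reg_exec _ (by decide), h19']

theorem cost_symbolsProg (h : Input D ρ w s) (hd : 0 < D.d) : (symbolsProg.run D s).2 ≤ 60 * D.n ^ 3 := by
  obtain ⟨hn1, hm, hk, hnR, hnm⟩ := size_bounds D hd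
  -- Register `19` counts rounds but is computed by the program, so the cost is bounded from the
  -- state that follows this computation.
  have h19 : ((seq (instr (add 16 6 4)) parityCount).exec D s).reg 19 = 2 * D.d + 2 := by
    simp [parityCount, Instr.exec, h.one, h.d]; ring
  have h₁ : Input D ρ w ((seq (instr (add 16 6 4)) parityCount).exec D s) :=
    h.exec _ (by decide) (by decide)
  have c1 : ((seq (instr (add 16 6 4)) parityCount).run D s).2 = 4 := rfl
  rw [symbolsProg, run]
  change ((seq (instr (add 16 6 4)) parityCount).run D s).2 + ((seq readInfo readParity).run D
    ((seq (instr (add 16 6 4)) parityCount).exec D s)).2 ≤ _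
  rw [c1]
  refine (Nat.add_le_add_left (run_le_bound (by decide) fun _ _ => rfl) _).trans ?_
  simp only [readInfo, readParity, readSymbol, bound, Instr.cost]
  rw [h19, h₁.kR, h₁.m]
  unfold Construction.nR at *
  have hn : D.n ≤ D.n ^ 3 := Nat.le_self_pow (by norm_num) _
  nlinarith

end Prog
end RPS

namespace RPS
namespace Prog

open Instr Polynomial

/-! ### Decoding -/

/-- Starts with the pairs `(1, 0)` and `(0, 1)`. Row `a` of array `10` holds the values of
`A + y B` for pair number `a`, row `a` of array `11` holds the values of `B`, and registers `32` and
`33` bound the weighted degrees. -/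
def initPairs : Prog :=
  seq (seq (instr (fzero 30)) (seq (instr (fone 31)) (seq (instr (const 32 0))
    (instr (sub 33 3 9)))))
  (loop 10 28 (seq (instr (store 10 8 10 31)) (seq (instr (store 11 8 10 30))
    (seq (instr (load 14 8 10 8)) (seq (instr (store 10 9 10 14)) (instr (store 11 9 10 31)))))))

/-- Chooses pair `0` as the pivot. -/
def pivotZero : Prog :=
  seq (instr (const 34 0)) (seq (instr (const 35 1)) (seq (instr (add 32 32 9))
    (instr (fdiv 36 15 14))))

/-- Chooses pair `1` as the pivot. -/
def pivotOne : Prog :=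
  seq (instr (const 34 1)) (seq (instr (const 35 0)) (seq (instr (add 33 33 9))
    (instr (fdiv 36 14 15))))

/-- Chooses the pivot for the point whose number is in register `10`. -/
def choosePivot : Prog :=
  seq (instr (load 14 10 8 10)) (seq (instr (load 15 10 9 10))
    (ifEq 14 30 pivotOne (ifEq 15 30 pivotZero (ifLe 32 33 pivotZero pivotOne))))

/-- Updates column number `11` of array `A`. -/
def updateEntry (A : ℕ) : Prog :=
  seq (instr (load 38 A 34 11)) (seq (instr (load 39 A 35 11)) (seq (instr (fmul 40 36 38))
    (seq (instr (fsub 39 39 40)) (seq (instr (store A 35 11 39)) (seq (instr (load 41 7 11 8))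
    (seq (instr (fsub 41 41 37)) (seq (instr (fmul 38 41 38)) (instr (store A 34 11 38)))))))))

/-- Takes the points into account one by one. -/
def eliminate : Prog :=
  loop 10 28 (seq (seq choosePivot (instr (load 37 7 10 8)))
    (loop 11 28 (seq (updateEntry 10) (updateEntry 11))))

/-- Selects the pair of smaller weighted degree. -/
def selectPair : Prog := ifLe 32 33 (instr (const 34 0)) (instr (const 34 1))

/-- Multiplies register `43` by the factors of a Lagrange basis polynomial. -/
def basisLoop : Prog :=
  loop 12 28 (seq (instr (load 15 11 34 12)) (ifEq 15 30 skip (ifEq 12 11 skip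
    (seq (instr (load 45 7 12 8)) (seq (instr (fsub 46 37 45)) (seq (instr (fsub 47 44 45))
      (seq (instr (fdiv 46 46 47)) (instr (fmul 43 43 46)))))))))

/-- Adds up the terms of the Lagrange interpolation formula in register `42`. -/
def sumLoop : Prog :=
  loop 11 28 (seq (instr (load 14 11 34 11)) (ifEq 14 30 skip
    (seq (seq (instr (load 43 8 11 8)) (instr (load 44 7 11 8)))
      (seq basisLoop (instr (fadd 42 42 43))))))

/-- Interpolates from the points where the second component of the selected pair does not
vanish. -/
def interpolate : Prog :=
  loop 10 3 (seq (seq (instr (load 37 7 10 8)) (instr (fzero 42)))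
    (seq sumLoop (instr (store 5 10 8 42))))

/-- Decoding of the values in array `8` at the points in array `7`. -/
def decode : Prog := seq initPairs (seq eliminate (seq selectPair interpolate))

/-- Arrays `7` and `8` hold `N` points and values. -/
structure Points {F : Type*} (D : Construction F) (N : ℕ) (x y : ℕ → F) (s : State) : Prop where
  kR : s.reg 3 = D.kR
  zero : s.reg 8 = 0
  one : s.reg 9 = 1
  length : s.reg 28 = N
  points : ∀ h < N, s.arr 7 h 0 = D.code (x h)
  values : ∀ h < N, s.arr 8 h 0 = D.code (y h)

theorem Points.of_eq {F : Type*} {D : Construction F} {N : ℕ} {x y : ℕ → F} {s t : State}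
    (h : Points D N x y s) (hr : ∀ x ∈ [3, 8, 9, 28], t.reg x = s.reg x)
    (ha : ∀ A ∈ [7, 8], t.arr A = s.arr A) : Points D N x y t := by
  constructor
  · rw [hr 3 (by decide), h.kR]
  · rw [hr 8 (by decide), h.zero]
  · rw [hr 9 (by decide), h.one]
  · rw [hr 28 (by decide), h.length]
  · rw [ha 7 (by decide)]; exact h.points
  · rw [ha 8 (by decide)]; exact h.values

/-- The pairs `(A, B)` are held by arrays `10` and `11`. -/
structure Pairs {F : Type*} [Field F] (D : Construction F) (N : ℕ) (x y : ℕ → F) (A B : ℕ → F[X])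
    (s : State) : Prop where
  fst : ∀ a < 2, ∀ h < N,
    s.arr 10 a h = D.code ((A a).eval (x h) + y h * (B a).eval (x h))
  snd : ∀ a < 2, ∀ h < N, s.arr 11 a h = D.code ((B a).eval (x h))

variable {F : Type*} [Field F] {D : Construction F} {N : ℕ} {x y : ℕ → F} {A B : ℕ → F[X]}
  {δ : ℕ → ℕ} {s : State}

theorem Points.exec (h : Points D N x y s) (P : Prog) (hr : ∀ x ∈ [3, 8, 9, 28], x ∉ P.regs)
    (ha : ∀ A ∈ [7, 8], A ∉ P.arrs) : Points D N x y (P.exec D s) :=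
  h.of_eq (fun x hx => reg_exec _ (hr x hx)) fun A hA => arr_exec _ (ha A hA)

theorem initPairs_spec (h : Points D N x y s) :
    Pairs D N x y (fun s => if s = 0 then 1 else 0) (fun s => if s = 0 then 0 else 1)
      (initPairs.exec D s) ∧ (initPairs.exec D s).reg 30 = D.code 0 ∧
    (initPairs.exec D s).reg 32 = 0 ∧ (initPairs.exec D s).reg 33 = D.kR - 1 := by
  rw [initPairs, exec_seq]
  set P := seq (instr (fzero 30)) (seq (instr (fone 31)) (seq (instr (const 32 0))
    (instr (sub 33 3 9)))) with hP
  have h' : Points D N x y (P.exec D s) := h.exec P (by decide) (by decide)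
  set s' := P.exec D s with hs'
  have s30 : s'.reg 30 = D.code 0 := by simp [hs', hP, Instr.exec]
  have s31 : s'.reg 31 = D.code 1 := by simp [hs', hP, Instr.exec]
  have s32 : s'.reg 32 = 0 := by simp [hs', hP, Instr.exec]
  have s33 : s'.reg 33 = D.kR - 1 := by simp [hs', hP, Instr.exec, h.kR, h.one]
  refine ⟨?_, by rw [reg_exec _ (by decide), s30], by rw [reg_exec _ (by decide), s32],
    by rw [reg_exec _ (by decide), s33]⟩
  have key := exec_loop_induct (D := D) (s := s') (i := 10) (x := 28)
    (P := seq (instr (store 10 8 10 31)) (seq (instr (store 11 8 10 30))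
    (seq (instr (load 14 8 10 8)) (seq (instr (store 10 9 10 14)) (instr (store 11 9 10 31))))))
    (fun j t => ∀ h < j, t.arr 10 0 h = D.code 1 ∧ t.arr 10 1 h = D.code (y h) ∧
      t.arr 11 0 h = D.code 0 ∧ t.arr 11 1 h = D.code 1) (by simp) ?_
  · rw [h'.length] at key
    constructor
    · intro a ha h hh
      obtain ⟨k1, k2, k3, k4⟩ := key h hh
      interval_cases a
      · simpa using k1
      · simpa using k2
    · intro a ha h hh
      obtain ⟨k1, k2, k3, k4⟩ := key h hh
      interval_cases a
      · simpa using k3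
      · simpa using k4
  · intro j hj t hr ha I i hi
    rw [h'.length] at hj
    have r8 := hr 8 (by decide)
    have r9 := hr 9 (by decide)
    have r30 := hr 30 (by decide)
    have r31 := hr 31 (by decide)
    have a8 : t.arr 8 j 0 = D.code (y j) := by rw [ha 8 (by decide)]; exact h'.values j hj
    rw [h'.zero] at r8
    rw [h'.one] at r9
    rw [s30] at r30
    rw [s31] at r31
    simp only [exec_seq, exec_instr, Instr.exec, State.reg_setArr, State.arr_setArr,
      State.reg_set, State.arr_set, Nat.reduceEqDiff, reduceIte, r8, r9, r30, r31, a8]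
    by_cases hij : i = j
    · subst hij
      simp
    · have := I i (by omega)
      simp [hij, this]

/-- A pair whose value at the new point is already `0` needs no reduction, so the other one is the
pivot whatever the degrees. Two zero values are covered too, since `0 / 0 = 0`. Otherwise the pair
of smaller bound is the pivot. -/
theorem choosePivot_spec [DecidableEq F] (h : Points D N x y s) (hp : Pairs D N x y A B s)
    (h30 : s.reg 30 = D.code 0) (h32 : s.reg 32 = δ 0) (h33 : s.reg 33 = δ 1)
    (hi : s.reg 10 < N) :
    ∃ a b c, (a = 0 ∧ b = 1 ∨ a = 1 ∧ b = 0) ∧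
      (A b).eval (x (s.reg 10)) + y (s.reg 10) * (B b).eval (x (s.reg 10)) =
        c * ((A a).eval (x (s.reg 10)) + y (s.reg 10) * (B a).eval (x (s.reg 10))) ∧
      (c ≠ 0 → δ a ≤ δ b) ∧
      (choosePivot.exec D s).reg 34 = a ∧ (choosePivot.exec D s).reg 35 = b ∧
      (choosePivot.exec D s).reg 36 = D.code c ∧
      (choosePivot.exec D s).reg 32 = (if 0 = a then δ a + 1 else δ b) ∧
      (choosePivot.exec D s).reg 33 = (if 1 = a then δ a + 1 else δ b) := by
  have e0 := hp.fst 0 two_pos _ hi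
  have e1 := hp.fst 1 one_lt_two _ hi
  set E0 := (A 0).eval (x (s.reg 10)) + y (s.reg 10) * (B 0).eval (x (s.reg 10))
  set E1 := (A 1).eval (x (s.reg 10)) + y (s.reg 10) * (B 1).eval (x (s.reg 10))
  simp only [choosePivot, exec_seq, exec_instr, exec_ifEq, exec_ifLe, Instr.exec, State.reg_set,
    State.arr_set, Nat.reduceEqDiff, reduceIte, h.zero, h.one, h30, h32, h33, e0, e1,
    Construction.code_inj]
  split_ifs with c0 c1 c2
  · refine ⟨1, 0, E0 / E1, Or.inr ⟨rfl, rfl⟩, ?_, ?_, ?_⟩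
    · change E0 = _; rw [c0, zero_div, zero_mul]
    · intro hc; exact absurd (by rw [c0, zero_div]) hc
    · simp [pivotOne, Instr.exec, h.one, h32, h33]
  · refine ⟨0, 1, E1 / E0, Or.inl ⟨rfl, rfl⟩, ?_, ?_, ?_⟩
    · change E1 = _; rw [c1, zero_div, zero_mul]
    · intro hc; exact absurd (by rw [c1, zero_div]) hc
    · simp [pivotZero, Instr.exec, h.one, h32, h33]
  · refine ⟨0, 1, E1 / E0, Or.inl ⟨rfl, rfl⟩, (div_mul_cancel₀ _ c0).symm, fun _ => c2, ?_⟩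
    simp [pivotZero, Instr.exec, h.one, h32, h33]
  · refine ⟨1, 0, E0 / E1, Or.inr ⟨rfl, rfl⟩, (div_mul_cancel₀ _ c1).symm, fun _ => by omega, ?_⟩
    simp [pivotOne, Instr.exec, h.one, h32, h33]

/-- The points in array `7` are read after a store to array `R`, hence `R ≠ 7`. -/
theorem updateEntry_spec {R : ℕ} (hR : R ≠ 7) {a b h : ℕ} {c xi xh ea eb : F}
    (h8 : s.reg 8 = 0) (h34 : s.reg 34 = a) (h35 : s.reg 35 = b) (h11 : s.reg 11 = h)
    (h36 : s.reg 36 = D.code c) (h37 : s.reg 37 = D.code xi) (h7 : s.arr 7 h 0 = D.code xh)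
    (ha : s.arr R a h = D.code ea) (hb : s.arr R b h = D.code eb) (R' a' h' : ℕ) :
    ((updateEntry R).exec D s).arr R' a' h' =
      if R' = R ∧ a' = a ∧ h' = h then D.code ((xh - xi) * ea)
      else if R' = R ∧ a' = b ∧ h' = h then D.code (eb - c * ea) else s.arr R' a' h' := by
  simp only [updateEntry, exec_seq, exec_instr, Instr.exec, State.reg_setArr, State.arr_setArr,
    State.reg_set, State.arr_set, Nat.reduceEqDiff, reduceIte, h8, h34, h35, h11, h36, h37, h7,
    ha, hb, Construction.elt_code, hR.symm, false_and]

/-- At a fixed point the update is linear in the pair, so `A + y B` and `B` follow the same rule and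
one piece of code serves both arrays. -/
theorem updateLoop_spec (h : Points D N x y s) (hp : Pairs D N x y A B s) {a b : ℕ}
    (hab : a = 0 ∧ b = 1 ∨ a = 1 ∧ b = 0) {c xi : F} (h34 : s.reg 34 = a) (h35 : s.reg 35 = b)
    (h36 : s.reg 36 = D.code c) (h37 : s.reg 37 = D.code xi) :
    Pairs D N x y (fun s => if s = a then (X - C xi) * A a else A b - C c * A a)
      (fun s => if s = a then (X - C xi) * B a else B b - C c * B a)
      ((loop 11 28 (seq (updateEntry 10) (updateEntry 11))).exec D s) := by
  have ha2 : a < 2 := by omega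
  have hb2 : b < 2 := by omega
  have hne : a ≠ b := by omega
  set v : ℕ → ℕ → F := fun e h => (A e).eval (x h) + y h * (B e).eval (x h) with hv
  set v' : ℕ → ℕ → F := fun e h => (B e).eval (x h) with hv'
  have key := exec_loop_induct (D := D) (s := s) (i := 11) (x := 28)
    (P := seq (updateEntry 10) (updateEntry 11))
    (fun j t => ∀ h < N,
      t.arr 10 a h = D.code (if h < j then (x h - xi) * v a h else v a h) ∧
      t.arr 10 b h = D.code (if h < j then v b h - c * v a h else v b h) ∧
      t.arr 11 a h = D.code (if h < j then (x h - xi) * v' a h else v' a h) ∧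
      t.arr 11 b h = D.code (if h < j then v' b h - c * v' a h else v' b h))
    (fun h hh => by
      simp [hv, hv', hp.fst a ha2 h hh, hp.fst b hb2 h hh, hp.snd a ha2 h hh, hp.snd b hb2 h hh]) ?_
  · rw [h.length] at key
    constructor
    · intro e he h hh
      obtain ⟨k1, k2, -, -⟩ := key h hh
      rw [if_pos hh] at k1 k2
      by_cases hea : e = a
      · subst hea
        rw [k1]
        simp only [if_true, eval_mul, eval_sub, eval_X, eval_C, hv]
        congr 1; ring
      · obtain rfl : e = b := by omega
        rw [k2]
        simp only [hea, if_false, eval_mul, eval_sub, eval_C, hv]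
        congr 1; ring
    · intro e he h hh
      obtain ⟨-, -, k1, k2⟩ := key h hh
      rw [if_pos hh] at k1 k2
      by_cases hea : e = a
      · subst hea
        rw [k1]
        simp only [if_true, eval_mul, eval_sub, eval_X, eval_C, hv']
      · obtain rfl : e = b := by omega
        rw [k2]
        simp only [hea, if_false, eval_mul, eval_sub, eval_C, hv']
  · intro j hj t hr ht I
    rw [h.length] at hj
    obtain ⟨I1, I2, I3, I4⟩ := I j hj
    rw [if_neg (lt_irrefl j)] at I1 I2 I3 I4
    have r8 := hr 8 (by decide)
    have r34 := hr 34 (by decide)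
    have r35 := hr 35 (by decide)
    have r36 := hr 36 (by decide)
    have r37 := hr 37 (by decide)
    have a7 : t.arr 7 j 0 = D.code (x j) := by rw [ht 7 (by decide)]; exact h.points j hj
    rw [h.zero] at r8
    rw [h34] at r34
    rw [h35] at r35
    rw [h36] at r36
    rw [h37] at r37
    have k1 := updateEntry_spec (s := t.set 11 j) (D := D) (R := 10) (a := a) (b := b)
      (c := c) (xi := xi) (by decide) (by simpa using r8)
      (by simpa using r34) (by simpa using r35) (by simp) (by simpa using r36) (by simpa using r37)
      a7 I1 I2
    have k2 := updateEntry_spec (s := (updateEntry 10).exec D (t.set 11 j)) (D := D) (R := 11)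
      (h := j) (a := a) (b := b) (c := c) (xi := xi) (by decide)
      (by rw [reg_exec _ (by decide)]; simpa using r8)
      (by rw [reg_exec _ (by decide)]; simpa using r34)
      (by rw [reg_exec _ (by decide)]; simpa using r35)
      (by rw [reg_exec _ (by decide)]; simp)
      (by rw [reg_exec _ (by decide)]; simpa using r36)
      (by rw [reg_exec _ (by decide)]; simpa using r37)
      (by rw [arr_exec _ (by decide)]; exact a7)
      (by rw [arr_exec _ (by decide)]; exact I3)
      (by rw [arr_exec _ (by decide)]; exact I4)
    rw [exec_seq]
    intro i hi
    obtain ⟨J1, J2, J3, J4⟩ := I i hi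
    simp only [k2, k1, State.arr_set]
    by_cases hij : i = j
    · subst hij
      simp [hne.symm]
    · have hiff : i < j + 1 ↔ i < j := by omega
      simp [hij, J1, J2, J3, J4, hiff]

end Prog
end RPS

/-! ### Correctness of elimination and interpolation -/

namespace RPS
namespace Prog

open Instr Polynomial

variable {F : Type*} [Field F] {D : Construction F} {N : ℕ} {x y : ℕ → F} {A B : ℕ → F[X]}
  {δ : ℕ → ℕ} {s : State}

/-- Polynomials exist in the invariant only: it couples the stored values and degree bounds with
some `KeyPairs`. -/
theorem eliminate_spec [DecidableEq F] (h : Points D N x y s)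
    (hp : Pairs D N x y (fun s => if s = 0 then 1 else 0) (fun s => if s = 0 then 0 else 1) s)
    (h30 : s.reg 30 = D.code 0) (h32 : s.reg 32 = 0) (h33 : s.reg 33 = D.kR - 1) :
    ∃ A B δ, KeyPairs x y D.kR N A B δ ∧ Pairs D N x y A B (eliminate.exec D s) ∧
      (eliminate.exec D s).reg 32 = δ 0 ∧ (eliminate.exec D s).reg 33 = δ 1 := by
  have key := exec_loop_induct (D := D) (s := s) (i := 10) (x := 28)
    (P := seq (seq choosePivot (instr (load 37 7 10 8)))
      (loop 11 28 (seq (updateEntry 10) (updateEntry 11))))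
    (fun j t => ∃ A B δ, KeyPairs x y D.kR j A B δ ∧ Pairs D N x y A B t ∧
      t.reg 32 = δ 0 ∧ t.reg 33 = δ 1)
    ⟨_, _, _, keyPairs_zero x y D.kR, hp, by simp [h32], by simp [h33]⟩ ?_
  · rwa [h.length] at key
  · rintro j hj t hr ha ⟨A, B, δ, hK, hP, t32, t33⟩
    rw [h.length] at hj
    have ht : Points D N x y (t.set 10 j) := h.of_eq
      (fun x hx => by
        rw [State.reg_set, if_neg (by rintro rfl; revert hx; decide)]
        exact hr x (by revert x; decide))
      fun A hA => ha A (by revert A; decide)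
    have hPt : Pairs D N x y A B (t.set 10 j) := ⟨hP.fst, hP.snd⟩
    obtain ⟨a, b, c, hab, hE, hc, p34, p35, p36, p32, p33⟩ := choosePivot_spec (δ := δ) ht hPt
      (by rw [State.reg_set, if_neg (by decide), hr 30 (by decide), h30])
      (by rw [State.reg_set, if_neg (by decide), t32])
      (by rw [State.reg_set, if_neg (by decide), t33]) (by simpa using hj)
    rw [State.reg_set, if_pos rfl] at hE
    rw [exec_seq]
    set Q := seq choosePivot (instr (load 37 7 10 8)) with hQ
    have hQt : Points D N x y (Q.exec D (t.set 10 j)) := ht.exec Q (by decide) (by decide)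
    have hQP : Pairs D N x y A B (Q.exec D (t.set 10 j)) :=
      ⟨by rw [arr_exec _ (by decide)]; exact hP.fst, by rw [arr_exec _ (by decide)]; exact hP.snd⟩
    have hQr : ∀ r, r ≠ 37 → (Q.exec D (t.set 10 j)).reg r =
        (choosePivot.exec D (t.set 10 j)).reg r := fun r hr => by
      simp [hQ, Instr.exec, hr]
    have q37 : (Q.exec D (t.set 10 j)).reg 37 = D.code (x j) := by
      have f8 := reg_exec (D := D) (P := choosePivot) (t.set 10 j) (y := 8) (by decide)
      have f10 := reg_exec (D := D) (P := choosePivot) (t.set 10 j) (y := 10) (by decide)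
      have f7 := arr_exec (D := D) (P := choosePivot) (t.set 10 j) (A := 7) (by decide)
      rw [ht.zero] at f8
      rw [State.reg_set, if_pos rfl] at f10
      simp only [hQ, exec_seq, exec_instr, Instr.exec, State.reg_set, if_true, f8, f10, f7]
      exact ht.points j hj
    refine ⟨_, _, _, hK.step hab hE hc,
      updateLoop_spec hQt hQP hab (by rw [hQr _ (by decide), p34]) (by rw [hQr _ (by decide), p35])
        (by rw [hQr _ (by decide), p36]) q37, ?_, ?_⟩
    · rw [reg_exec _ (by decide), hQr _ (by decide), p32]
    · rw [reg_exec _ (by decide), hQr _ (by decide), p33]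

theorem basisLoop_spec [DecidableEq F] (h : Points D N x y s) (hp : Pairs D N x y A B s) {a : ℕ}
    (ha : a < 2) {z xg v : F} (h30 : s.reg 30 = D.code 0) (h34 : s.reg 34 = a)
    (h37 : s.reg 37 = D.code z) (h44 : s.reg 44 = D.code xg) (h43 : s.reg 43 = D.code v) :
    (basisLoop.exec D s).reg 43 = D.code (v * ∏ i ∈ Finset.range N,
      if (B a).eval (x i) = 0 ∨ i = s.reg 11 then 1 else (z - x i) / (xg - x i)) := by
  have key := exec_loop_induct (D := D) (s := s) (i := 12) (x := 28)
    (P := seq (instr (load 15 11 34 12)) (ifEq 15 30 skip (ifEq 12 11 skip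
    (seq (instr (load 45 7 12 8)) (seq (instr (fsub 46 37 45)) (seq (instr (fsub 47 44 45))
      (seq (instr (fdiv 46 46 47)) (instr (fmul 43 43 46)))))))))
    (fun j t => t.reg 43 = D.code (v * ∏ i ∈ Finset.range j,
      if (B a).eval (x i) = 0 ∨ i = s.reg 11 then 1 else (z - x i) / (xg - x i)))
    (by simp [h43]) ?_
  · rwa [h.length] at key
  · intro j hj t hr ht I
    rw [h.length] at hj
    have r8 := hr 8 (by decide)
    have r11 := hr 11 (by decide)
    have r30 := hr 30 (by decide)
    have r34 := hr 34 (by decide)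
    have r37 := hr 37 (by decide)
    have r44 := hr 44 (by decide)
    have a7 : t.arr 7 j 0 = D.code (x j) := by rw [ht 7 (by decide)]; exact h.points j hj
    have a11 : t.arr 11 a j = D.code ((B a).eval (x j)) := by
      rw [ht 11 (by decide)]; exact hp.snd a ha j hj
    rw [h.zero] at r8
    rw [h30] at r30
    rw [h34] at r34
    rw [h37] at r37
    rw [h44] at r44
    simp only [exec_seq, exec_instr, exec_ifEq, exec_skip, Instr.exec, State.reg_set,
      State.arr_set, Nat.reduceEqDiff, reduceIte, r8, r11, r30, r34, r37, r44, a7, a11,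
      Construction.code_inj]
    rw [Finset.prod_range_succ]
    by_cases c1 : (B a).eval (x j) = 0
    · simp [I, c1]
    by_cases c2 : j = s.reg 11
    · simp [I, c2]
    · simp only [c1, c2, or_self, if_false, State.reg_set, Nat.reduceEqDiff, reduceIte, I,
        Construction.elt_code, mul_assoc]

theorem sumLoop_spec [DecidableEq F] (h : Points D N x y s) (hp : Pairs D N x y A B s) {a : ℕ}
    (ha : a < 2) {z : F} (h30 : s.reg 30 = D.code 0) (h34 : s.reg 34 = a)
    (h37 : s.reg 37 = D.code z) (h42 : s.reg 42 = D.code 0) :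
    (sumLoop.exec D s).reg 42 = D.code (∑ g ∈ Finset.range N, if (B a).eval (x g) = 0 then 0 else
      y g * ∏ i ∈ Finset.range N, if (B a).eval (x i) = 0 ∨ i = g then 1 else
        (z - x i) / (x g - x i)) := by
  have key := exec_loop_induct (D := D) (s := s) (i := 11) (x := 28)
    (P := seq (instr (load 14 11 34 11)) (ifEq 14 30 skip
    (seq (seq (instr (load 43 8 11 8)) (instr (load 44 7 11 8)))
      (seq basisLoop (instr (fadd 42 42 43))))))
    (fun j t => t.reg 42 = D.code (∑ g ∈ Finset.range j, if (B a).eval (x g) = 0 then 0 else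
      y g * ∏ i ∈ Finset.range N, if (B a).eval (x i) = 0 ∨ i = g then 1 else
        (z - x i) / (x g - x i)))
    (by simp [h42]) ?_
  · rwa [h.length] at key
  · intro j hj t hr ht I
    rw [h.length] at hj
    have r30 := hr 30 (by decide)
    have r34 := hr 34 (by decide)
    have r37 := hr 37 (by decide)
    have a11 : t.arr 11 a j = D.code ((B a).eval (x j)) := by
      rw [ht 11 (by decide)]; exact hp.snd a ha j hj
    rw [h30] at r30
    rw [h34] at r34
    rw [h37] at r37
    rw [exec_seq, exec_ifEq]
    set t₁ := (instr (load 14 11 34 11)).exec D (t.set 11 j) with ht₁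
    have q14 : t₁.reg 14 = D.code ((B a).eval (x j)) := by
      simp [ht₁, Instr.exec, r34, a11]
    have q30 : t₁.reg 30 = D.code 0 := by simp [ht₁, Instr.exec, r30]
    simp only [q14, q30, Construction.code_inj]
    rw [Finset.sum_range_succ]
    split_ifs with c1
    · simp [ht₁, Instr.exec, I]
    rw [exec_seq, exec_seq]
    set P := seq (instr (load 43 8 11 8)) (instr (load 44 7 11 8)) with hP
    set t₂ := P.exec D t₁ with ht₂
    have hr₂ : ∀ q ∈ [3, 8, 9, 28, 30, 34, 37, 42], t₂.reg q = t.reg q := by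
      intro q hq
      rw [ht₂, reg_exec _ (by revert q; decide), ht₁, reg_exec _ (by revert q; decide),
        State.reg_set, if_neg (by revert q; decide)]
    have ha₂ : t₂.arr = t.arr := rfl
    have p₂ : Points D N x y t₂ := h.of_eq
      (fun q hq => by
        rw [hr₂ q (by revert q; decide)]
        exact hr q (by revert q; decide))
      fun R hR => by rw [ha₂]; exact ht R (by revert R; decide)
    have P₂ : Pairs D N x y A B t₂ :=
      ⟨by rw [ha₂, ht 10 (by decide)]; exact hp.fst, by rw [ha₂, ht 11 (by decide)]; exact hp.snd⟩
    have q11 : t₂.reg 11 = j := by simp [ht₂, hP, ht₁, Instr.exec]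
    have r8 : t.reg 8 = 0 := by rw [hr 8 (by decide), h.zero]
    have q43 : t₂.reg 43 = D.code (y j) := by
      simp [ht₂, hP, ht₁, Instr.exec, r8, ht 8 (by decide), h.values j hj]
    have q44 : t₂.reg 44 = D.code (x j) := by
      simp [ht₂, hP, ht₁, Instr.exec, r8, ht 7 (by decide), h.points j hj]
    have hb := basisLoop_spec p₂ P₂ ha (z := z) (xg := x j) (v := y j)
      (by rw [hr₂ 30 (by decide), r30]) (by rw [hr₂ 34 (by decide), r34])
      (by rw [hr₂ 37 (by decide), r37]) q44 q43
    rw [q11] at hb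
    have h42 : (basisLoop.exec D t₂).reg 42 = t.reg 42 := by
      rw [reg_exec _ (by decide), hr₂ 42 (by decide)]
    rw [exec_instr, Instr.exec, State.reg_set, if_pos rfl, hb, h42, I, Construction.elt_code,
      Construction.elt_code]

theorem interpolate_spec [DecidableEq F] (h : Points D N x y s) (hp : Pairs D N x y A B s)
    {a : ℕ} (ha : a < 2) (h30 : s.reg 30 = D.code 0) (h34 : s.reg 34 = a) (hN : D.kR ≤ N) :
    ∀ j < D.kR, (interpolate.exec D s).arr 5 j 0 =
      D.code (∑ g ∈ Finset.range N, if (B a).eval (x g) = 0 then 0 else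
      y g * ∏ i ∈ Finset.range N, if (B a).eval (x i) = 0 ∨ i = g then 1 else
        (x j - x i) / (x g - x i)) := by
  set V : ℕ → F := fun j => ∑ g ∈ Finset.range N, if (B a).eval (x g) = 0 then 0 else
      y g * ∏ i ∈ Finset.range N, if (B a).eval (x i) = 0 ∨ i = g then 1 else
        (x j - x i) / (x g - x i) with hV
  have key := exec_loop_induct (D := D) (s := s) (i := 10) (x := 3)
    (P := seq (seq (instr (load 37 7 10 8)) (instr (fzero 42)))
      (seq sumLoop (instr (store 5 10 8 42))))
    (fun j t => ∀ i < j, t.arr 5 i 0 = D.code (V i)) (by simp) ?_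
  · rwa [h.kR] at key
  · intro j hj t hr ht I i hi
    rw [h.kR] at hj
    rw [exec_seq, exec_seq]
    set P := seq (instr (load 37 7 10 8)) (instr (fzero 42)) with hP
    set t₂ := P.exec D (t.set 10 j) with ht₂
    have hr₂ : ∀ q ∈ [3, 8, 9, 28, 30, 34], t₂.reg q = t.reg q := by
      intro q hq
      rw [ht₂, reg_exec _ (by revert q; decide), State.reg_set, if_neg (by revert q; decide)]
    have ha₂ : t₂.arr = t.arr := rfl
    have p₂ : Points D N x y t₂ := h.of_eq
      (fun q hq => by
        rw [hr₂ q (by revert q; decide)]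
        exact hr q (by revert q; decide))
      fun R hR => by rw [ha₂]; exact ht R (by revert R; decide)
    have P₂ : Pairs D N x y A B t₂ :=
      ⟨by rw [ha₂, ht 10 (by decide)]; exact hp.fst, by rw [ha₂, ht 11 (by decide)]; exact hp.snd⟩
    have r8 : t.reg 8 = 0 := by rw [hr 8 (by decide), h.zero]
    have q10 : t₂.reg 10 = j := by simp [ht₂, hP, Instr.exec]
    have q42 : t₂.reg 42 = D.code 0 := by simp [ht₂, hP, Instr.exec]
    have q37 : t₂.reg 37 = D.code (x j) := by
      simp [ht₂, hP, Instr.exec, r8, ht 7 (by decide), h.points j (by omega)]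
    have hb := sumLoop_spec p₂ P₂ ha (z := x j)
      (by rw [hr₂ 30 (by decide), hr 30 (by decide), h30])
      (by rw [hr₂ 34 (by decide), hr 34 (by decide), h34]) q37 q42
    have f8 := reg_exec (D := D) (P := sumLoop) t₂ (y := 8) (by decide)
    have f10 := reg_exec (D := D) (P := sumLoop) t₂ (y := 10) (by decide)
    have f5 := arr_exec (D := D) (P := sumLoop) t₂ (A := 5) (by decide)
    rw [p₂.zero] at f8
    rw [q10] at f10
    rw [exec_instr, Instr.exec, State.arr_setArr, f8, f10, f5, hb, ha₂]
    split_ifs with c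
    · rw [hV, c.2.1]
    · exact I i (by simp at c; omega)

/-- Nothing is claimed unless some `f` is close to the data; the link with `decRS` is made later
through `decoded_eq`. -/
theorem decode_spec [DecidableEq F] (h : Points D N x y s) (hx : Set.InjOn x (Finset.range N))
    (hN : D.kR ≤ N) {f : F[X]} (hf : f.degree < (D.kR : WithBot ℕ))
    (hy : 2 * ((Finset.range N).filter fun h => y h ≠ f.eval (x h)).card ≤ N - D.kR) :
    ∀ j < D.kR, (decode.exec D s).arr 5 j 0 = D.code (f.eval (x j)) := by
  rw [decode, exec_seq, exec_seq, exec_seq]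
  obtain ⟨hP₁, h30, h32, h33⟩ := initPairs_spec h
  have h₁ : Points D N x y (initPairs.exec D s) := h.exec _ (by decide) (by decide)
  obtain ⟨A, B, δ, hK, hP₂, h32, h33⟩ := eliminate_spec h₁ hP₁ h30 h32 h33
  set s₁ := initPairs.exec D s
  have h₂ : Points D N x y (eliminate.exec D s₁) := h₁.exec _ (by decide) (by decide)
  have h30' : (eliminate.exec D s₁).reg 30 = D.code 0 := by rw [reg_exec _ (by decide), h30]
  set s₂ := eliminate.exec D s₁
  have h₃ : Points D N x y (selectPair.exec D s₂) := h₂.exec _ (by decide) (by decide)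
  have h30₃ : (selectPair.exec D s₂).reg 30 = D.code 0 := by rw [reg_exec _ (by decide), h30']
  have hP₃ : Pairs D N x y A B (selectPair.exec D s₂) :=
    ⟨by rw [arr_exec _ (by decide)]; exact hP₂.fst, by rw [arr_exec _ (by decide)]; exact hP₂.snd⟩
  obtain ⟨a, ha, ha'⟩ : ∃ a, (selectPair.exec D s₂).reg 34 = a ∧
      (a = 0 ∧ δ 0 ≤ δ 1 ∨ a = 1 ∧ δ 1 ≤ δ 0) := by
    simp only [selectPair, exec_ifLe, h32, h33]
    split_ifs with c
    · exact ⟨0, by simp [Instr.exec], Or.inl ⟨rfl, c⟩⟩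
    · exact ⟨1, by simp [Instr.exec], Or.inr ⟨rfl, by omega⟩⟩
  intro j hj
  rw [interpolate_spec h₃ hP₃ (by omega) h30₃ ha hN j hj,
    hK.eval_eq hx D.one_le_kR hN hf hy ha' (x j)]

end Prog
end RPS

/-! ### The program for step 3 and its running time -/

namespace RPS
namespace Prog

open Instr

theorem bound_mono {m : ℕ} {v v' : ℕ → ℕ} {P : Prog} (h : ∀ x ∈ P.counters, v x ≤ v' x) :
    P.bound m v ≤ P.bound m v' := by
  induction P with
  | skip => exact le_rfl
  | instr I => exact le_rfl
  | seq P Q hP hQ =>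
    simp only [counters, List.mem_append] at h
    exact Nat.add_le_add (hP fun x hx => h x (Or.inl hx)) (hQ fun x hx => h x (Or.inr hx))
  | ifLe x y P Q hP hQ =>
    simp only [counters, List.mem_append] at h
    exact Nat.add_le_add_right
      (Nat.add_le_add (hP fun x hx => h x (Or.inl hx)) (hQ fun x hx => h x (Or.inr hx))) 1
  | loop i x P hP =>
    exact Nat.add_le_add_left (Nat.mul_le_mul (h x List.mem_cons_self)
      (Nat.add_le_add_right (hP fun y hy => h y (List.mem_cons_of_mem _ hy)) 1)) 1

theorem run_le_bound_const {F : Type*} [Field F] {D : Construction F} {P : Prog}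
    (h : ∀ x ∈ P.counters, x ∉ P.regs) {s : State} (b : ℕ) (hb : ∀ x ∈ P.counters, s.reg x ≤ b) :
    (P.run D s).2 ≤ P.bound D.m fun _ => b :=
  (run_le_bound h fun _ _ => rfl).trans (bound_mono hb)

theorem run_seq {F : Type*} [Field F] {D : Construction F} (P Q : Prog) (s : State) :
    ((seq P Q).run D s).2 = (P.run D s).2 + (Q.run D (P.exec D s)).2 := rfl

theorem run_eq {F : Type*} [Field F] {D : Construction F} (P : Prog) (s : State) :
    P.run D s = (P.exec D s, (P.run D s).2) := rfl

/-! ### The selection of the coordinates -/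

/-- Register `21` becomes the residue of the position modulo the length of the word. -/
def modPosition : Prog := seq (instr (sub 21 0 6)) (ifLe 0 21 (instr (const 21 0)) skip)

/-- Register `22` becomes the position of the first parity block. -/
def parityStart : Prog := seq (instr (add 22 4 8)) (loop 10 3 (instr (add 22 22 2)))

/-- Register `24` becomes `d + 1`, register `25` the length of a parity block. -/
def halfCount : Prog :=
  seq (instr (add 23 22 8)) (seq (instr (add 24 1 9)) (instr (add 25 2 1)))

/-- Register `23` becomes the position of the middle parity block. -/
def parityMiddle : Prog := loop 10 24 (instr (add 23 23 25))

/-- Registers `26` and `27` become the number of parity symbols to skip and to keep. -/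
def chooseCase : Prog :=
  ifLe 22 21 (ifLe 23 21 (seq (instr (const 26 0)) (instr (add 27 24 8)))
    (seq (instr (add 26 24 8)) (instr (add 27 24 8))))
    (seq (instr (const 26 0)) (instr (add 27 19 8)))

/-- Sets up the choice of the coordinates. -/
def chooseRange : Prog := seq chooseCase (seq (instr (add 28 3 27)) (instr (add 29 3 26)))

/-- Copies a coordinate. -/
def copyEntry (a b : ℕ) : Prog :=
  seq (instr (load 14 1 a 8)) (seq (instr (store 7 b 8 14)) (seq (instr (load 14 4 a 8))
    (instr (store 8 b 8 14))))

/-- Copies the information coordinates. -/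
def copyInfo : Prog := loop 10 3 (copyEntry 10 10)

/-- Copies the chosen parity coordinates. -/
def copyParity : Prog :=
  loop 10 27 (seq (seq (instr (add 11 29 10)) (instr (add 12 3 10))) (copyEntry 11 12))

/-- Chooses the coordinates and decodes. -/
def decodeProg : Prog :=
  seq (seq modPosition (seq parityStart halfCount))
    (seq parityMiddle (seq chooseRange (seq (seq copyInfo copyParity) decode)))

variable {F : Type*} [Field F] {D : Construction F} {ρ : Fin D.r ≃ D.X} {w : Fin D.n → ZMod 2}
  {s : State}

/-- Multiplication by repeated addition, cheap enough for the factors `k_R` and `d + 1`. -/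
theorem reg_addLoop {i x a b : ℕ} (hai : a ≠ i) (hbi : b ≠ i) (hab : b ≠ a) :
    ((loop i x (instr (add a a b))).exec D s).reg a = s.reg a + s.reg x * s.reg b := by
  refine (exec_loop_induct (D := D) (s := s) (i := i) (x := x) (P := instr (add a a b))
    (fun j t => t.reg a = s.reg a + j * s.reg b) (by simp) ?_)
  intro j hj t hr ht I
  have hb := hr b (by simp [regs, Instr.regs, hbi, hab])
  simp only [exec_instr, Instr.exec, State.reg_set, if_true, if_neg hai, if_neg hbi, I, hb]
  ring

theorem reg_modPosition (h : Input D ρ w s) (ho : D.offset w < D.n) (hs : s.reg 6 = D.offset w) :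
    (modPosition.exec D s).reg 21 = D.modPos w := by
  simp only [modPosition, exec_seq, exec_instr, exec_ifLe, exec_skip, Instr.exec, State.reg_set,
    Nat.reduceEqDiff, reduceIte, h.n, hs, Construction.modPos]
  split_ifs with c
  · rw [show D.offset w = 0 by omega, Nat.sub_zero, Nat.mod_self]; simp
  · rw [Nat.mod_eq_of_lt (by omega)]; simp

/-- The registers set up for the choice of the coordinates. -/
structure Thresholds (D : Construction F) (w : Fin D.n → ZMod 2) (s : State) : Prop where
  modPos : s.reg 21 = D.modPos w
  start : s.reg 22 = D.lp + D.m * D.kR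
  middle : s.reg 23 = D.lp + D.m * D.kR + (D.d + 1) * (D.m + D.d)
  half : s.reg 24 = D.d + 1
  all : s.reg 19 = 2 * D.d + 2

theorem thresholds_spec (h : Input D ρ w s) (ho : D.offset w < D.n) (hs : s.reg 6 = D.offset w)
    (h19 : s.reg 19 = 2 * D.d + 2) :
    ((seq modPosition (seq parityStart halfCount)).exec D s).reg 24 = D.d + 1 ∧
    Thresholds D w (parityMiddle.exec D ((seq modPosition (seq parityStart halfCount)).exec D s)) := by
  rw [exec_seq, exec_seq]
  have m1 := reg_modPosition h ho hs
  have h1 : Input D ρ w (modPosition.exec D s) := h.exec _ (by decide) (by decide)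
  have h19' := reg_exec (D := D) (P := modPosition) s (y := 19) (by decide)
  rw [h19] at h19'
  set s₁ := modPosition.exec D s
  have h2 : Input D ρ w (parityStart.exec D s₁) := h1.exec _ (by decide) (by decide)
  have m2 : (parityStart.exec D s₁).reg 22 = D.lp + D.m * D.kR := by
    rw [parityStart, exec_seq, reg_addLoop (by decide) (by decide) (by decide)]
    simp [Instr.exec, h1.lp, h1.zero, h1.kR, h1.m, mul_comm]
  have m21 := reg_exec (D := D) (P := parityStart) s₁ (y := 21) (by decide)
  have m19 := reg_exec (D := D) (P := parityStart) s₁ (y := 19) (by decide)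
  rw [m1] at m21
  rw [h19'] at m19
  set s₂ := parityStart.exec D s₁
  have h24 : (halfCount.exec D s₂).reg 24 = D.d + 1 := by
    simp [halfCount, Instr.exec, h2.d, h2.one]
  refine ⟨h24, ?_, ?_, ?_, ?_, ?_⟩
  · rw [reg_exec _ (by decide), reg_exec _ (by decide), m21]
  · rw [reg_exec _ (by decide), reg_exec _ (by decide), m2]
  · rw [parityMiddle, reg_addLoop (by decide) (by decide) (by decide), h24]
    simp [halfCount, Instr.exec, h2.d, h2.m, h2.zero, m2]
  · rw [reg_exec _ (by decide), h24]
  · rw [reg_exec _ (by decide), reg_exec _ (by decide), m19]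

/-- The extension of a word by zeros. -/
def extend {n : ℕ} (v : Fin n → F) (i : ℕ) : F := if h : i < n then v ⟨i, h⟩ else 0

theorem extend_val {n : ℕ} (v : Fin n → F) (i : Fin n) : extend v i = v i := by
  simp [extend]

theorem copyEntry_spec {a b i j : ℕ} (h8 : s.reg 8 = 0) (ha : s.reg a = i)
    (hb : s.reg b = j) (ha8 : a ≠ 14) (hb8 : b ≠ 14) (h1 : s.arr 1 i 0 = D.code (extend D.x i))
    (h4 : s.arr 4 i 0 = D.code (extend (D.cbar w) i)) (R t : ℕ) :
    ((copyEntry a b).exec D s).arr R t 0 =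
      if R = 8 ∧ t = j then D.code (extend (D.cbar w) i) else
      if R = 7 ∧ t = j then D.code (extend D.x i) else s.arr R t 0 := by
  simp only [copyEntry, exec_seq, exec_instr, Instr.exec, State.reg_setArr, State.arr_setArr,
    State.reg_set, State.arr_set, Nat.reduceEqDiff, reduceIte, h8, ha, hb, ha8, hb8, h1, h4,
    and_true, false_and, if_false]

/-- All three coordinate sets have the form `[0, k_R) ∪ [k_R + a, k_R + a + b)`, so one copying
program with parameters `a` and `b` serves all cases. -/
theorem copy_spec (h : Input D ρ w s)
    (h4 : ∀ j : Fin D.nR, s.arr 4 j 0 = D.code (D.cbar w j)) {a b : ℕ} (hab : a + b ≤ 2 * D.d + 2)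
    (h26 : s.reg 29 = D.kR + a) (h27 : s.reg 27 = b) (h28 : s.reg 28 = D.kR + b) :
    Points D (D.kR + b) (fun i => extend D.x (if i < D.kR then i else i + a))
      (fun i => extend (D.cbar w) (if i < D.kR then i else i + a))
      ((seq copyInfo copyParity).exec D s) := by
  have e1 : ∀ i < D.nR, s.arr 1 i 0 = D.code (extend D.x i) := fun i hi => by
    rw [extend, dif_pos hi]; exact h.points ⟨i, hi⟩
  have e4 : ∀ i < D.nR, s.arr 4 i 0 = D.code (extend (D.cbar w) i) := fun i hi => by
    rw [extend, dif_pos hi]; exact h4 ⟨i, hi⟩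
  have hnR : D.nR = D.kR + (2 * D.d + 2) := rfl
  rw [exec_seq]
  have k1 := exec_loop_induct (D := D) (s := s) (i := 10) (x := 3) (P := copyEntry 10 10)
    (fun j t => ∀ i < j, t.arr 7 i 0 = D.code (extend D.x i) ∧
      t.arr 8 i 0 = D.code (extend (D.cbar w) i)) (by simp) (by
    intro j hj t hr ht I i hi
    rw [h.kR] at hj
    have hc := copyEntry_spec (D := D) (w := w) (s := t.set 10 j) (a := 10) (b := 10) (i := j)
      (j := j) (by rw [State.reg_set, if_neg (by decide), hr 8 (by decide), h.zero])
      (by simp) (by simp) (by decide) (by decide)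
      (by rw [State.arr_set, ht 1 (by decide), e1 j (by omega)])
      (by rw [State.arr_set, ht 4 (by decide), e4 j (by omega)])
    rw [hc, hc]
    by_cases hij : i = j
    · simp [hij]
    · have := I i (by omega)
      simp [hij, this])
  change ∀ i < s.reg 3, _ at k1
  rw [h.kR] at k1
  have h' : Input D ρ w (copyInfo.exec D s) := h.exec _ (by decide) (by decide)
  have r29 : (copyInfo.exec D s).reg 29 = D.kR + a := by rw [reg_exec _ (by decide), h26]
  have r27 : (copyInfo.exec D s).reg 27 = b := by rw [reg_exec _ (by decide), h27]
  have r28 : (copyInfo.exec D s).reg 28 = D.kR + b := by rw [reg_exec _ (by decide), h28]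
  have a1 : (copyInfo.exec D s).arr 1 = s.arr 1 := arr_exec _ (by decide)
  have a4 : (copyInfo.exec D s).arr 4 = s.arr 4 := arr_exec _ (by decide)
  set s' := copyInfo.exec D s with hs'
  have k2 := exec_loop_induct (D := D) (s := s') (i := 10) (x := 27)
    (P := seq (seq (instr (add 11 29 10)) (instr (add 12 3 10))) (copyEntry 11 12))
    (fun j t => ∀ i < D.kR + j,
      t.arr 7 i 0 = D.code (extend D.x (if i < D.kR then i else i + a)) ∧
      t.arr 8 i 0 = D.code (extend (D.cbar w) (if i < D.kR then i else i + a)))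
    (fun i hi => by rw [if_pos (by omega)]; exact k1 i (by omega)) (by
    intro j hj t hr ht I i hi
    rw [r27] at hj
    have t8 : t.reg 8 = 0 := by rw [hr 8 (by decide), h'.zero]
    have t3 : t.reg 3 = D.kR := by rw [hr 3 (by decide), h'.kR]
    have t29 : t.reg 29 = D.kR + a := by rw [hr 29 (by decide), r29]
    rw [exec_seq]
    have hc := copyEntry_spec (D := D) (w := w)
      (s := (seq (instr (add 11 29 10)) (instr (add 12 3 10))).exec D (t.set 10 j))
      (a := 11) (b := 12) (i := D.kR + a + j) (j := D.kR + j)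
      (by simp [Instr.exec, t8]) (by simp [Instr.exec, t29]) (by simp [Instr.exec, t3])
      (by decide) (by decide)
      (by simp only [exec_seq, exec_instr, Instr.exec, State.arr_set]
          rw [ht 1 (by decide), a1, e1 _ (by omega)])
      (by simp only [exec_seq, exec_instr, Instr.exec, State.arr_set]
          rw [ht 4 (by decide), a4, e4 _ (by omega)])
    rw [hc, hc]
    by_cases hij : i = D.kR + j
    · rw [if_neg (show ¬ i < D.kR by omega), show i + a = D.kR + a + j by omega]
      simp [hij]
    · have := I i (by omega)
      simp [hij, this, Instr.exec])
  rw [r27] at k2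
  have h'' : Input D ρ w (copyParity.exec D s') := h'.exec _ (by decide) (by decide)
  exact ⟨h''.kR, h''.zero, h''.one, by rw [reg_exec _ (by decide), r28],
    fun i hi => (k2 i hi).1, fun i hi => (k2 i hi).2⟩

theorem decodeRange_spec [DecidableEq F] (h : Input D ρ w s)
    (h4 : ∀ j : Fin D.nR, s.arr 4 j 0 = D.code (D.cbar w j)) {a b : ℕ} (hab : a + b ≤ 2 * D.d + 2)
    (h26 : s.reg 29 = D.kR + a) (h27 : s.reg 27 = b) (h28 : s.reg 28 = D.kR + b)
    {κ : Fin (D.kR + b) → Fin D.nR} (hκ : Function.Injective κ)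
    (hκv : ∀ i, (κ i : ℕ) = if (i : ℕ) < D.kR then (i : ℕ) else i + a) (σ : Fin D.kR → F)
    (hσ : 2 * hammingDist (D.cbar w ∘ κ) (D.enc σ ∘ κ) ≤ D.kR + b - D.kR) (j : Fin D.kR) :
    ((seq (seq copyInfo copyParity) decode).exec D s).arr 5 j 0 = D.code (σ j) := by
  have hP := copy_spec h h4 hab h26 h27 h28
  have hnR : D.nR = D.kR + (2 * D.d + 2) := rfl
  have e : ∀ (v : Fin D.nR → F) (i : Fin (D.kR + b)),
      extend v (if (i : ℕ) < D.kR then (i : ℕ) else i + a) = v (κ i) := fun v i => by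
    rw [← hκv, extend_val]
  rw [exec_seq, decode_spec hP ?_ (by omega) (D.degree_encPoly σ) ?_ j j.isLt]
  · rw [if_pos j.isLt, ← D.enc_castAdd σ j, Construction.enc_eq]
    congr 2
    exact extend_val D.x (Fin.castAdd (2 * D.d + 2) j)
  · intro i hi i' hi' hii
    rw [Finset.coe_range, Set.mem_Iio] at hi hi'
    have e1 := e D.x ⟨i, hi⟩
    have e2 := e D.x ⟨i', hi'⟩
    simp only at e1 e2 hii
    rw [e1, e2] at hii
    exact Fin.mk.inj_iff.1 (hκ (D.x_injective hii))
  · refine le_trans (le_of_eq ?_) hσ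
    rw [hammingDist, Finset.card_filter, Finset.card_filter, Finset.sum_range]
    refine congrArg _ (Finset.sum_congr rfl fun i _ => ?_)
    rw [e, e]
    rfl

theorem chooseRange_spec (h : Input D ρ w s) (ht : Thresholds D w s) :
    ∃ a b, (chooseRange.exec D s).reg 29 = D.kR + a ∧ (chooseRange.exec D s).reg 27 = b ∧
      (chooseRange.exec D s).reg 28 = D.kR + b ∧ a + b ≤ 2 * D.d + 2 ∧
      (D.modPos w < D.lp + D.m * D.kR → a = 0 ∧ b = 2 * D.d + 2) ∧
      (D.lp + D.m * D.kR ≤ D.modPos w →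
        D.modPos w < D.lp + D.m * D.kR + (D.d + 1) * (D.m + D.d) → a = D.d + 1 ∧ b = D.d + 1) ∧
      (D.lp + D.m * D.kR + (D.d + 1) * (D.m + D.d) ≤ D.modPos w → a = 0 ∧ b = D.d + 1) := by
  rw [chooseRange, exec_seq]
  have h3 : (chooseCase.exec D s).reg 3 = D.kR := by rw [reg_exec _ (by decide), h.kR]
  have key : ∃ a b, (chooseCase.exec D s).reg 26 = a ∧ (chooseCase.exec D s).reg 27 = b ∧
      a + b ≤ 2 * D.d + 2 ∧
      (D.modPos w < D.lp + D.m * D.kR → a = 0 ∧ b = 2 * D.d + 2) ∧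
      (D.lp + D.m * D.kR ≤ D.modPos w →
        D.modPos w < D.lp + D.m * D.kR + (D.d + 1) * (D.m + D.d) → a = D.d + 1 ∧ b = D.d + 1) ∧
      (D.lp + D.m * D.kR + (D.d + 1) * (D.m + D.d) ≤ D.modPos w → a = 0 ∧ b = D.d + 1) := by
    simp only [chooseCase, exec_ifLe, ht.modPos, ht.start, ht.middle]
    split_ifs with c1 c2
    · refine ⟨0, D.d + 1, by simp [Instr.exec], by simp [Instr.exec, ht.half, h.zero], ?_⟩
      omega
    · refine ⟨D.d + 1, D.d + 1, by simp [Instr.exec, ht.half, h.zero],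
        by simp [Instr.exec, ht.half, h.zero], ?_⟩
      omega
    · refine ⟨0, 2 * D.d + 2, by simp [Instr.exec], by simp [Instr.exec, ht.all, h.zero], ?_⟩
      omega
  obtain ⟨a, b, ha, hb, hab⟩ := key
  exact ⟨a, b, by simp [Instr.exec, h3, ha], by simp [Instr.exec, hb],
    by simp [Instr.exec, h3, hb], hab⟩

theorem decodeProg_spec [DecidableEq F] (h : Input D ρ w s) (ho : D.offset w < D.n)
    (hs : s.reg 6 = D.offset w) (h19 : s.reg 19 = 2 * D.d + 2)
    (h4 : ∀ j : Fin D.nR, s.arr 4 j 0 = D.code (D.cbar w j)) {c₀ c₁ : Fin D.kR → F}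
    (hc : Construction.Close w (D.modPos w) (D.enc c₀) (D.enc c₁)) :
    Input D ρ w (decodeProg.exec D s) ∧ Thresholds D w (decodeProg.exec D s) ∧
      ∀ j : Fin D.kR, (decodeProg.exec D s).arr 5 j 0 = D.code (D.decoded w j) := by
  obtain ⟨-, hT⟩ := thresholds_spec h ho hs h19
  refine ⟨h.exec _ (by decide) (by decide), ?_, ?_⟩
  · rw [decodeProg, exec_seq, exec_seq]
    exact ⟨by rw [reg_exec _ (by decide), hT.modPos], by rw [reg_exec _ (by decide), hT.start],
      by rw [reg_exec _ (by decide), hT.middle], by rw [reg_exec _ (by decide), hT.half],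
      by rw [reg_exec _ (by decide), hT.all]⟩
  intro j
  rw [decodeProg, exec_seq, exec_seq, exec_seq]
  have h₁ : Input D ρ w (parityMiddle.exec D
    ((seq modPosition (seq parityStart halfCount)).exec D s)) :=
    (h.exec _ (by decide) (by decide)).exec _ (by decide) (by decide)
  have h4₁ : (parityMiddle.exec D
    ((seq modPosition (seq parityStart halfCount)).exec D s)).arr 4 = s.arr 4 := by
    rw [arr_exec _ (by decide), arr_exec _ (by decide)]
  set s₁ := parityMiddle.exec D ((seq modPosition (seq parityStart halfCount)).exec D s)
  obtain ⟨a, b, h29, h27, h28, hab, r1, r2, r3⟩ := chooseRange_spec h₁ hT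
  have h₂ : Input D ρ w (chooseRange.exec D s₁) := h₁.exec _ (by decide) (by decide)
  have h4₂ : ∀ j : Fin D.nR, (chooseRange.exec D s₁).arr 4 j 0 = D.code (D.cbar w j) := by
    rw [arr_exec _ (by decide), h4₁]; exact h4
  -- The specified result is `c₀` or `c₁`, so it is enough that the program recovers the nearby
  -- codeword.
  rw [Construction.decoded_eq hc]
  obtain ⟨g1, g2, g3⟩ := hc
  rcases Nat.lt_or_ge (D.modPos w) (D.lp + D.m * D.kR) with c | c
  · obtain ⟨rfl, rfl⟩ := r1 c
    rw [if_pos (by omega)]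
    exact decodeRange_spec h₂ h4₂ hab h29 h27 h28 (κ := id) Function.injective_id (by simp) c₀
      (g1 c) j
  rcases Nat.lt_or_ge (D.modPos w) (D.lp + D.m * D.kR + (D.d + 1) * (D.m + D.d)) with c' | c'
  · obtain ⟨rfl, rfl⟩ := r2 c c'
    rw [if_pos c']
    exact decodeRange_spec h₂ h4₂ hab h29 h27 h28 Construction.keepLast_injective
      Construction.keepLast_val c₀ (g2 c c') j
  · obtain ⟨rfl, rfl⟩ := r3 c'
    rw [if_neg (by omega)]
    exact decodeRange_spec h₂ h4₂ hab h29 h27 h28 Construction.keepFirst_injective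
      (by simp [Construction.keepFirst]) c₁ (g3 c') j

/-- Elimination takes `O(N^2)` field operations. Interpolation dominates: at most `N` values, each
with `N` terms of `N` factors. -/
theorem cost_decode {N : ℕ} (h28 : s.reg 28 = N) (h3 : s.reg 3 ≤ N) (hN : 0 < N) (hm : 0 < D.m) :
    (decode.run D s).2 ≤ 200 * (N ^ 3 * D.m ^ 2) := by
  refine (run_le_bound_const (by decide) N fun x hx => ?_).trans ?_
  · have : x = 28 ∨ x = 3 := by revert x; decide
    rcases this with rfl | rfl <;> omega
  simp only [decode, initPairs, eliminate, choosePivot, pivotOne, pivotZero, ifEq, updateEntry,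
    selectPair, interpolate, sumLoop, basisLoop, bound, Instr.cost]
  have hM : 1 ≤ D.m ^ 2 := Nat.one_le_pow _ _ hm
  generalize D.m ^ 2 = M at *
  have a1 : N * M ≤ N ^ 3 * M := Nat.mul_le_mul_right _ (Nat.le_self_pow (by norm_num) _)
  have a2 : N ^ 2 * M ≤ N ^ 3 * M := Nat.mul_le_mul_right _ (Nat.pow_le_pow_right hN (by norm_num))
  have a0 : M ≤ N * M := Nat.le_mul_of_pos_left _ hN
  have b1 : N ≤ N * M := Nat.le_mul_of_pos_right _ hM
  have b2 : N ^ 2 ≤ N ^ 2 * M := Nat.le_mul_of_pos_right _ hM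
  have b3 : N ^ 3 ≤ N ^ 3 * M := Nat.le_mul_of_pos_right _ hM
  nlinarith

theorem cost_decodeProg (h : Input D ρ w s) (hd : 0 < D.d) (ho : D.offset w < D.n)
    (hs : s.reg 6 = D.offset w) (h19 : s.reg 19 = 2 * D.d + 2) :
    (decodeProg.run D s).2 ≤ 300 * D.n ^ 3 := by
  obtain ⟨hn1, hm, hk, hnR, hnm⟩ := size_bounds D hd
  obtain ⟨h24, hT⟩ := thresholds_spec h ho hs h19
  rw [decodeProg, run_seq, run_seq parityMiddle, run_seq chooseRange, run_seq (seq copyInfo copyParity)]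
  have c1 : ((seq modPosition (seq parityStart halfCount)).run D s).2 ≤ 8 + 2 * D.n :=
    (run_le_bound_const (by decide) D.n (fun x hx => by
      obtain rfl : x = 3 := by revert x; decide
      rw [h.kR]; exact hk)).trans (by
        simp only [modPosition, parityStart, halfCount, bound, Instr.cost]; omega)
  have h₁ : Input D ρ w ((seq modPosition (seq parityStart halfCount)).exec D s) :=
    h.exec _ (by decide) (by decide)
  set s₁ := (seq modPosition (seq parityStart halfCount)).exec D s
  have c2 : (parityMiddle.run D s₁).2 ≤ 1 + 2 * D.n :=
    (run_le_bound_const (by decide) D.n (fun x hx => by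
      obtain rfl : x = 24 := by revert x; decide
      rw [h24]; exact hn1)).trans (by
        simp only [parityMiddle, bound, Instr.cost]; omega)
  have h₂ : Input D ρ w (parityMiddle.exec D s₁) := h₁.exec _ (by decide) (by decide)
  obtain ⟨a, b, h29, h27, h28, hab, -⟩ := chooseRange_spec h₂ hT
  set s₂ := parityMiddle.exec D s₁
  have c3 : (chooseRange.run D s₂).2 ≤ 10 :=
    (run_le_bound_const (by decide) D.n (fun x hx => by
      exact absurd hx (by revert x; decide))).trans (by
        simp only [chooseRange, chooseCase, bound, Instr.cost]; omega)
  have h₃ : Input D ρ w (chooseRange.exec D s₂) := h₂.exec _ (by decide) (by decide)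
  set s₃ := chooseRange.exec D s₂
  have hb : D.kR + b ≤ D.nR := by unfold Construction.nR; omega
  have c4 : ((seq copyInfo copyParity).run D s₃).2 ≤ 2 + 12 * D.n :=
    (run_le_bound_const (by decide) D.n (fun x hx => by
      have : x = 3 ∨ x = 27 := by revert x; decide
      rcases this with rfl | rfl
      · rw [h₃.kR]; exact hk
      · omega)).trans (by
        simp only [copyInfo, copyParity, copyEntry, bound, Instr.cost]; omega)
  have h₄ : Input D ρ w ((seq copyInfo copyParity).exec D s₃) := h₃.exec _ (by decide) (by decide)
  have c5 := cost_decode (D := D) (s := (seq copyInfo copyParity).exec D s₃) (N := D.kR + b)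
    (by rw [reg_exec _ (by decide), h28]) (by rw [h₄.kR]; omega)
    (by have := D.one_le_kR; omega) hm
  -- Only two of the three factors `n_R` are paired with an `m`: `n_R^3 m^2 = n_R (n_R m)^2`.
  have c6 : (D.kR + b) ^ 3 * D.m ^ 2 ≤ D.n ^ 3 := by
    calc (D.kR + b) ^ 3 * D.m ^ 2 ≤ D.nR ^ 3 * D.m ^ 2 :=
          Nat.mul_le_mul_right _ (Nat.pow_le_pow_left hb 3)
      _ = D.nR * (D.nR * D.m) ^ 2 := by ring
      _ ≤ D.n * D.n ^ 2 := Nat.mul_le_mul hnR (Nat.pow_le_pow_left hnm 2)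
      _ = D.n ^ 3 := by ring
  have hn : D.n ≤ D.n ^ 3 := Nat.le_self_pow (by norm_num) _
  have hn' : 1 ≤ D.n := by omega
  omega

end Prog
end RPS

/-! ### The Gray index and the final position -/

namespace RPS

namespace Construction

theorem r_lt {F : Type*} (D : Construction F) (hd : 0 < D.d) : D.r < 2 ^ D.n := by
  have h1 : D.r ≤ 2 ^ D.m := by
    rw [r, ← Nat.sum_range_choose]
    refine Finset.sum_le_sum_of_subset fun i hi => ?_
    rw [Finset.mem_Icc] at hi
    rw [Finset.mem_range]
    omega
  have h2 : D.m < D.n := by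
    have h3 := D.d_le_m
    have h4 : D.m * 2 ≤ D.m * D.nR := Nat.mul_le_mul_left _ (by unfold nR; omega)
    unfold n
    omega
  exact h1.trans_lt (Nat.pow_lt_pow_right one_lt_two h2)

end Construction

namespace Prog

open Instr

/-! ### The index in the Gray code -/

/-- Register `17` becomes the product of the registers `18` and `20`. -/
def multiply : Prog :=
  seq (instr (const 17 0)) (loop 11 0 (seq (instr (half 49 20)) (seq (instr (add 50 49 49))
    (seq (ifLe 20 50 skip (instr (add 17 17 18))) (seq (instr (add 18 18 18))
      (instr (add 20 49 8)))))))

/-- Register `15` becomes the next digit, registers `18` and `20` the factors. -/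
def nextDigit : Prog :=
  seq (instr (load 14 5 10 8)) (seq (instr (load 15 3 14 8)) (seq (instr (half 16 48))
    (seq (instr (add 16 16 16)) (seq
      (ifLe 48 16 skip (seq (instr (sub 15 5 15)) (instr (sub 15 15 9))))
      (seq (instr (add 18 48 8)) (instr (add 20 5 8)))))))

/-- Register `48` becomes the index in the reflected Gray code. -/
def rank : Prog :=
  seq (instr (const 48 0)) (loop 10 3 (seq nextDigit (seq multiply (instr (add 48 17 15)))))

/-- The corrected index and the length become the factors. -/
def correct : Prog :=
  seq (ifLe 23 21 (instr (sub 48 48 9)) skip)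
    (seq (instr (add 18 48 8)) (instr (add 20 0 8)))

/-- Computes the position from the decoded symbols. -/
def positionProg : Prog := seq rank (seq correct (seq multiply (instr (add 7 17 21))))

variable {F : Type*} [Field F] {D : Construction F} {ρ : Fin D.r ≃ D.X} {w : Fin D.n → ZMod 2}
  {s : State}

/-- Shift-and-add: accumulator plus product of the current factors is invariant, and `n` halvings
exhaust a factor below `2 ^ n`. -/
theorem multiply_spec (h : Input D ρ w s) (hb : s.reg 20 < 2 ^ D.n) :
    (multiply.exec D s).reg 17 = s.reg 18 * s.reg 20 := by
  rw [multiply, exec_seq]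
  have h' : Input D ρ w ((instr (const 17 0)).exec D s) := h.exec _ (by decide) (by decide)
  have e18 : ((instr (const 17 0)).exec D s).reg 18 = s.reg 18 := reg_exec _ (by decide)
  have e20 : ((instr (const 17 0)).exec D s).reg 20 = s.reg 20 := reg_exec _ (by decide)
  have e17 : ((instr (const 17 0)).exec D s).reg 17 = 0 := by simp [Instr.exec]
  set s' := (instr (const 17 0)).exec D s
  have key := exec_loop_induct (D := D) (s := s') (i := 11) (x := 0)
    (P := seq (instr (half 49 20)) (seq (instr (add 50 49 49))
    (seq (ifLe 20 50 skip (instr (add 17 17 18))) (seq (instr (add 18 18 18))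
      (instr (add 20 49 8))))))
    (fun j t => t.reg 20 = s.reg 20 / 2 ^ j ∧
      t.reg 17 + t.reg 18 * t.reg 20 = s.reg 18 * s.reg 20) (by simp [e18, e20, e17]) ?_
  · rw [h'.n] at key
    obtain ⟨k1, k2⟩ := key
    rw [Nat.div_eq_of_lt hb] at k1
    rwa [k1, mul_zero, add_zero] at k2
  · rintro j hj t hr ht ⟨I1, I2⟩
    have r8 : t.reg 8 = 0 := by rw [hr 8 (by decide), h'.zero]
    rw [pow_succ, ← Nat.div_div_eq_div_mul, ← I1, ← I2]
    simp only [exec_seq, exec_instr, exec_ifLe, exec_skip, Instr.exec, State.reg_set,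
      Nat.reduceEqDiff, reduceIte]
    generalize hv : t.reg 20 = v
    split_ifs with c
    · simp only [State.reg_set, Nat.reduceEqDiff, reduceIte, r8]
      refine ⟨rfl, ?_⟩
      conv_rhs => rw [show v = v / 2 + v / 2 by omega]
      ring
    · simp only [State.reg_set, Nat.reduceEqDiff, reduceIte, r8]
      refine ⟨rfl, ?_⟩
      conv_rhs => rw [show v = v / 2 + v / 2 + 1 by omega]
      ring

/-- The index `v` of the prefix read so far decides by its parity whether the digit is reflected;
`v` is even exactly when it is at most twice its half. -/
theorem nextDigit_spec (h : Input D ρ w s) {a v : ℕ} (hv : s.reg 48 = v) {g : D.X}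
    (ha : s.reg 10 = a) (hg : s.arr 5 a 0 = D.code g) :
    (nextDigit.exec D s).reg 15 =
        (if v % 2 = 0 then (ρ.symm g : ℕ) else D.r - 1 - (ρ.symm g : ℕ)) ∧
      (nextDigit.exec D s).reg 18 = v ∧ (nextDigit.exec D s).reg 20 = D.r := by
  simp only [nextDigit, exec_seq, exec_instr, exec_ifLe, exec_skip, Instr.exec, State.reg_set,
    State.arr_set, Nat.reduceEqDiff, reduceIte, hv, ha, hg, h.zero, h.numbers]
  have hiff : v ≤ v / 2 + v / 2 ↔ v % 2 = 0 := by omega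
  simp only [hiff]
  split_ifs with c
  · simp [hv, h.zero, h.r]
  · simp [hv, h.zero, h.r, h.one]
    omega

/-- Horner's scheme: after `j` digits register `48` holds `b / r ^ (k_R - j)`, and `div_pow_step` is
the step. Each multiplication by `r` takes `O(n)` steps. -/
theorem rank_spec (h : Input D ρ w s) (hd : 0 < D.d) (b : Fin (D.r ^ D.kR))
    (h5 : ∀ j : Fin D.kR, s.arr 5 j 0 = D.code ((reflectedGray D.kR ρ b j : D.X) : F)) :
    (rank.exec D s).reg 48 = b := by
  rw [rank, exec_seq]
  have h' : Input D ρ w ((instr (const 48 0)).exec D s) := h.exec _ (by decide) (by decide)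
  have e48 : ((instr (const 48 0)).exec D s).reg 48 = 0 := by simp [Instr.exec]
  have e5 : ((instr (const 48 0)).exec D s).arr 5 = s.arr 5 := rfl
  set s' := (instr (const 48 0)).exec D s
  have key := exec_loop_induct (D := D) (s := s') (i := 10) (x := 3)
    (P := seq nextDigit (seq multiply (instr (add 48 17 15))))
    (fun j t => t.reg 48 = b / D.r ^ (D.kR - j))
    (by rw [e48, Nat.sub_zero, Nat.div_eq_of_lt b.isLt]) ?_
  · rw [h'.kR] at key
    simpa using key
  · intro j hj t hr ht I
    rw [h'.kR] at hj
    have ht' : Input D ρ w (t.set 10 j) := h'.of_eq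
      (fun x hx => by
        rw [State.reg_set, if_neg (by rintro rfl; revert hx; decide)]
        exact hr x (by revert x; decide))
      fun A hA => ht A (by revert A; decide)
    obtain ⟨d1, d2, d3⟩ := nextDigit_spec ht' (v := t.reg 48) (a := j)
      (g := reflectedGray D.kR ρ b ⟨j, hj⟩) (by simp) (by simp)
      (by rw [State.arr_set, ht 5 (by decide), e5]; exact h5 ⟨j, hj⟩)
    have hm := multiply_spec (s := nextDigit.exec D (t.set 10 j))
      (ht'.exec _ (by decide) (by decide)) (by rw [d3]; exact D.r_lt hd)
    have f15 := reg_exec (D := D) (P := multiply) (nextDigit.exec D (t.set 10 j)) (y := 15)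
      (by decide)
    rw [exec_seq, exec_seq, exec_instr, Instr.exec, State.reg_set, if_pos rfl, hm, f15, d1, d2, d3,
      I, div_pow_step (D.kR - (j + 1)), show D.kR - (j + 1) + 1 = D.kR - j by omega,
      reflectedGray, Equiv.symm_apply_apply, show D.kR - (j + 1) = D.kR - 1 - j by omega]

theorem positionProg_spec [DecidableEq F] (h : Input D ρ w s) (hT : Thresholds D w s) (hd : 0 < D.d)
    (b : Fin (D.r ^ D.kR)) (hb : D.decoded w = fun j => ((reflectedGray D.kR ρ b j : D.X) : F))
    (h5 : ∀ j : Fin D.kR, s.arr 5 j 0 = D.code (D.decoded w j)) :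
    (positionProg.exec D s).reg 7 = D.locate (reflectedGray D.kR ρ) w := by
  have hr := rank_spec h hd b (by rw [hb] at h5; exact h5)
  rw [positionProg, exec_seq, exec_seq, exec_seq]
  have h₁ : Input D ρ w (rank.exec D s) := h.exec _ (by decide) (by decide)
  have m₁ : (rank.exec D s).reg 21 = D.modPos w := by rw [reg_exec _ (by decide), hT.modPos]
  have n₁ : (rank.exec D s).reg 23 = D.lp + D.m * D.kR + (D.d + 1) * (D.m + D.d) := by
    rw [reg_exec _ (by decide), hT.middle]
  set s₁ := rank.exec D s
  have h₂ : Input D ρ w (correct.exec D s₁) := h₁.exec _ (by decide) (by decide)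
  have m₂ : (correct.exec D s₁).reg 21 = D.modPos w := by rw [reg_exec _ (by decide), m₁]
  have f₂ : (correct.exec D s₁).reg 20 = D.n ∧ (correct.exec D s₁).reg 18 =
      if D.lp + D.m * D.kR + (D.d + 1) * (D.m + D.d) ≤ D.modPos w then (b : ℕ) - 1 else b := by
    simp only [correct, exec_seq, exec_instr, exec_ifLe, exec_skip, m₁, n₁]
    split_ifs with c
    · simp [Instr.exec, h₁.zero, h₁.one, h₁.n, hr]
    · simp [Instr.exec, h₁.zero, h₁.n, hr]
  have hm := multiply_spec h₂ (by rw [f₂.1]; exact Nat.lt_two_pow_self)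
  have m₃ : (multiply.exec D (correct.exec D s₁)).reg 21 = D.modPos w := by
    rw [reg_exec _ (by decide), m₂]
  rw [exec_instr, Instr.exec, State.reg_set, if_pos rfl, hm, m₃, f₂.1, f₂.2, Construction.locate,
    hb, Construction.decGray_eq (isGrayCode_reflectedGray D.kR ρ)]
  split_ifs <;> first | rfl | omega

theorem cost_positionProg (h : Input D ρ w s) (hd : 0 < D.d) : (positionProg.run D s).2 ≤ 100 * D.n ^ 3 := by
  obtain ⟨hn1, hm, hk, hnR, hnm⟩ := size_bounds D hd
  refine (run_le_bound_const (by decide) D.n fun x hx => ?_).trans ?_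
  · have : x = 0 ∨ x = 3 := by revert x; decide
    rcases this with rfl | rfl
    · rw [h.n]
    · rw [h.kR]; exact hk
  · simp only [positionProg, rank, nextDigit, correct, multiply, bound, Instr.cost]
    have h1 : D.n ≤ D.n ^ 3 := Nat.le_self_pow (by norm_num) _
    have h2 : D.n ^ 2 ≤ D.n ^ 3 := Nat.pow_le_pow_right (by omega) (by norm_num)
    nlinarith

end Prog

end RPS

/-! ### Assembly -/

theorem mainTheorem2 :
    -- correctness of the algorithm, for every Gray code
    (∀ (F : Type*) [Field F] [DecidableEq F] (D : RPS.Construction F)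
        (G : Fin (D.r ^ D.kR) → Fin D.kR → D.X), RPS.IsGrayCode G →
      ∀ (i e : ℕ) (w : Fin D.n → ZMod 2),
        i + D.n ≤ (D.S G).length →
        hammingDist (D.window G i) w = e → 2 * e < D.d →
        (∃! t, D.IsOffset w t) ∧ D.locate G w = i) ∧
    -- running time: one program, consisting of the four steps of the algorithm, for all parameters
    (∃ (P₁ P₂ P₃ P₄ : RPS.Prog) (C : ℕ),
      ∀ (F : Type*) [Field F] [DecidableEq F] (D : RPS.Construction F) (ρ : Fin D.r ≃ D.X)
        (i e : ℕ) (w : Fin D.n → ZMod 2),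
        i + D.n ≤ (D.S (RPS.reflectedGray D.kR ρ)).length →
        hammingDist (D.window (RPS.reflectedGray D.kR ρ) i) w = e → 2 * e < D.d →
        ∃ s₁ s₂ s₃ s₄ : RPS.State, ∃ t₁ t₂ t₃ t₄ : ℕ,
          P₁.run D (RPS.initState D ρ w) = (s₁, t₁) ∧
          P₂.run D s₁ = (s₂, t₂) ∧ P₃.run D s₂ = (s₃, t₃) ∧ P₄.run D s₃ = (s₄, t₄) ∧
          s₁.reg 6 = D.offset w ∧
          (∀ j : Fin D.nR, s₂.arr 4 j 0 = D.code (D.cbar w j)) ∧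
          (∀ j : Fin D.kR, s₃.arr 5 j 0 = D.code (D.decoded w j)) ∧
          s₄.reg 7 = D.locate (RPS.reflectedGray D.kR ρ) w ∧ s₄.reg 7 = i ∧
          t₁ + t₂ + t₃ + t₄ ≤ C * D.n ^ 3) := by
  -- `490 = 30 + 60 + 300 + 100`, the constants of the four programs.
  refine ⟨?_, RPS.Prog.markerProg, RPS.Prog.symbolsProg, RPS.Prog.decodeProg, RPS.Prog.positionProg, 490, ?_⟩
  · rintro F _ _ D G hG i e w hi rfl hw
    refine ⟨?_, RPS.Construction.locate_eq hG hi hw⟩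
    simp only [RPS.Construction.isOffset_iff hG hi hw]
    exact ⟨_, rfl, fun _ h => h⟩
  · rintro F _ _ D ρ i e w hi rfl hw
    have hd : 0 < D.d := by omega
    have hG := RPS.isGrayCode_reflectedGray D.kR ρ
    have hoff : ∀ s, D.IsOffset w s ↔ s = D.offset w := fun s => by
      rw [RPS.Construction.offset_eq hG hi hw]
      exact RPS.Construction.isOffset_iff hG hi hw s
    have ho : D.offset w < D.n := ((hoff _).2 rfl).1
    have hloc := RPS.Construction.locate_eq hG hi hw
    obtain ⟨b₀, b₁, -, -, hc⟩ := RPS.Construction.exists_close hG hi hw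
    -- Ranking is specified for Gray vectors only; the decoded word is one, in each of the three
    -- cases.
    obtain ⟨b, hb⟩ : ∃ b, D.decoded w =
        fun j => ((RPS.reflectedGray D.kR ρ b j : D.X) : F) := by
      rw [RPS.Construction.decoded_eq hc]
      split_ifs
      exacts [⟨b₀, rfl⟩, ⟨b₁, rfl⟩]
    obtain ⟨i₁, w₁, o₁⟩ := RPS.Prog.markerProg_spec (ρ := ρ) hoff
    have t₁ := RPS.Prog.cost_markerProg (ρ := ρ) (w := w)
    obtain ⟨i₂, o₂, c₂, a₂⟩ := RPS.Prog.symbolsProg_spec i₁ w₁ ho o₁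
    have t₂ := RPS.Prog.cost_symbolsProg i₁ hd
    obtain ⟨i₃, T₃, a₃⟩ := RPS.Prog.decodeProg_spec i₂ ho o₂ c₂ a₂ hc
    have t₃ := RPS.Prog.cost_decodeProg i₂ hd ho o₂ c₂
    have r₄ := RPS.Prog.positionProg_spec i₃ T₃ hd b hb a₃
    have t₄ := RPS.Prog.cost_positionProg i₃ hd
    exact ⟨_, _, _, _, _, _, _, _, RPS.Prog.run_eq _ _, RPS.Prog.run_eq _ _,
      RPS.Prog.run_eq _ _, RPS.Prog.run_eq _ _, o₁, a₂, a₃, r₄, r₄.trans hloc, by omega⟩
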